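/- Let $k\ge 3$. For a $k$-CNF formula $\mathbf F$ (every clause has at most $k$ literals) with $n$ variables and $m$ clauses let $\Omega_{\mathbf F}\subseteq\{0,1\}^n$ be its set of satisfying assignments, $d_H$ the Hamming distance, and, for satisfiable $\mathbf F$, $\mathrm{Diam}(\mathbf F)=\max_{z_1,z_2\in\Omega_{\mathbf F}}d_H(z_1,z_2)$. For $\rho\in\mathbb R$ and $T:\mathbb N\to\mathbb R$, say that *the diameter of $k$-CNF formulas is $\rho$-approximable in time $O^*(T)$* if there are a randomized algorithm (a program of a random access machine with logarithmic cost that can draw uniform random numbers), constants $C,d$, and a function $\varepsilon(n)\to 0$ (as $n\to\infty$) such that on every $k$-CNF formula $\mathbf F$ the algorithm always halts within time $C(n+m+1)^d\,T(n)$ and, if $\mathbf F$ is satisfiable, outputs with probability at least $1-\varepsilon(n)$ two assignments $z_1^*,z_2^*\in\Omega_{\mathbf F}$ with $d_H(z_1^*,z_2^*)\ge\rho\cdot\mathrm{Diam}(\mathbf F)$. Put $$\tau_1(\delta,k,n)=\frac{2^n k^{R_1}}{\binom n{R_1}},\quad R_1=\Big\lfloor\frac{\delta n}{2(2+\delta)}\Big\rfloor,\qquad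 \tau_2(\delta,k,n)=\frac{2^n (k-1)^{R_2}}{\binom n{R_2}},\quad R_2=\Big\lfloor\frac{\delta n}{2\left(2+\delta+\frac2{k-2}\right)}\Big\rfloor .$$ 1. For each real $0<\delta\le\min\{1,\frac4{k-1}\}$, the diameter of $k$-CNF formulas is $\frac12(1-\delta)$-approximable in time $O^*(\tau_1(\delta,k,n))$. 2. For each real $0<\delta\le\min\{1,\frac4{k-1}(1+\frac1{k-2})^2\}$, the diameter of $k$-CNF formulas is $\frac12(1-\delta)$-approximable in time $O^*(\tau_2(\delta,k,n))$. 3. In particular, with $\delta_k=\frac4{k-1}(1+\frac1{k-2})^2=\frac4k+\Theta(\frac1{k^2})$ (as $k\to\infty$), the diameter of $k$-CNF formulas is $\frac12(1-\delta_k)$-approximable in time $O^*\big((2(1-\frac1k))^n\big)$. -/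

import Mathlib

open Filter Topology Asymptotics

/-! ### Randomized random access machines with logarithmic cost -/

namespace RandRAM

/-- A memory: cell `i` holds the natural number `σ i`. -/
abbrev Mem : Type := ℕ → ℕ

/-- The arithmetic operations of the machine; `sub` is truncated subtraction and the two
comparisons return `1` or `0`. -/
inductive BinOp : Type
  | add | sub | mul | div | mod | lt | eq

def BinOp.eval : BinOp → ℕ → ℕ → ℕ
  | .add, x, y => x + y
  | .sub, x, y => x - y
  | .mul, x, y => x * y
  | .div, x, y => x / y
  | .mod, x, y => x % y
  | .lt, x, y => if x < y then 1 else 0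
  | .eq, x, y => if x = y then 1 else 0

/-- Expressions: literals, the content of the cell with a computed address, operations. -/
inductive Expr : Type
  | lit (c : ℕ)
  | deref (a : Expr)
  | op (o : BinOp) (a b : Expr)

def Expr.eval (σ : Mem) : Expr → ℕ
  | .lit c => c
  | .deref a => σ (a.eval σ)
  | .op o a b => o.eval (a.eval σ) (b.eval σ)

/-- The logarithmic cost of evaluating an expression: every node costs one plus the binary length
of its value. -/
def Expr.cost (σ : Mem) : Expr → ℕ
  | .lit c => 1 + Nat.size c
  | .deref a => a.cost σ + (1 + Nat.size (σ (a.eval σ)))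
  | .op o a b => a.cost σ + b.cost σ + (1 + Nat.size (o.eval (a.eval σ) (b.eval σ)))

/-- Programs. `assign a e` writes the value of `e` into the cell whose address is the value of `a`;
`rand a e` writes into that cell a uniformly random element of `{0, …, v}`, where `v` is the value
of `e` (`v = 1` is a fair coin); conditions are true when their value is nonzero. -/
inductive Prog : Type
  | skip
  | assign (a e : Expr)
  | rand (a e : Expr)
  | seq (p q : Prog)
  | ite (e : Expr) (p q : Prog)
  | loop (e : Expr) (p : Prog)

/-- A final memory together with the time that was spent. -/
abbrev Outcome : Type := Mem × ℕ

def Outcome.addTime (t : ℕ) (o : Outcome) : Outcome := (o.1, t + o.2)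

/-- `Exec p σ μ`: started on the memory `σ`, the program `p` halts for all outcomes of its random
choices (each of positive probability), and `μ` is the joint distribution of the final memory and
the running time. -/
inductive Exec : Prog → Mem → PMF Outcome → Prop
  | skip (σ : Mem) : Exec .skip σ (PMF.pure (σ, 1))
  | assign (a e : Expr) (σ : Mem) :
      Exec (.assign a e) σ
        (PMF.pure (Function.update σ (a.eval σ) (e.eval σ), 1 + a.cost σ + e.cost σ))
  | rand (a e : Expr) (σ : Mem) :
      Exec (.rand a e) σ
        ((PMF.uniformOfFintype (Fin (e.eval σ + 1))).map fun i =>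
          (Function.update σ (a.eval σ) (i : ℕ), 1 + a.cost σ + e.cost σ))
  | seq (p q : Prog) (σ : Mem) (μ : PMF Outcome) (ν : Outcome → PMF Outcome)
      (hp : Exec p σ μ) (hq : ∀ o ∈ μ.support, Exec q o.1 (ν o)) :
      Exec (.seq p q) σ (μ.bind fun o => (ν o).map (Outcome.addTime o.2))
  | ite_true (e : Expr) (p q : Prog) (σ : Mem) (μ : PMF Outcome) (he : e.eval σ ≠ 0)
      (hp : Exec p σ μ) :
      Exec (.ite e p q) σ (μ.map (Outcome.addTime (1 + e.cost σ)))
  | ite_false (e : Expr) (p q : Prog) (σ : Mem) (μ : PMF Outcome) (he : e.eval σ = 0)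
      (hq : Exec q σ μ) :
      Exec (.ite e p q) σ (μ.map (Outcome.addTime (1 + e.cost σ)))
  | loop_true (e : Expr) (p : Prog) (σ : Mem) (μ : PMF Outcome) (he : e.eval σ ≠ 0)
      (hp : Exec (.seq p (.loop e p)) σ μ) :
      Exec (.loop e p) σ (μ.map (Outcome.addTime (1 + e.cost σ)))
  | loop_false (e : Expr) (p : Prog) (σ : Mem) (he : e.eval σ = 0) :
      Exec (.loop e p) σ (PMF.pure (σ, 1 + e.cost σ))

end RandRAM

/-! ### CNF formulas, satisfying assignments, diameter -/

namespace KSat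

open Std.Sat

/-- A CNF formula on the `n` variables `0, …, n - 1`. -/
abbrev Formula (n : ℕ) : Type := CNF (Fin n)

/-- Every clause has at most `k` literals. -/
def IsKCNF {n : ℕ} (k : ℕ) (F : Formula n) : Prop := ∀ c ∈ F.clauses, c.length ≤ k

/-- The set of satisfying assignments. -/
def solutions {n : ℕ} (F : Formula n) : Finset (Fin n → Bool) :=
  Finset.univ.filter fun z => F.eval z = true

/-- The largest Hamming distance between two satisfying assignments (meaningful only if there is
one). -/
def diam {n : ℕ} (F : Formula n) : ℕ :=
  (solutions F ×ˢ solutions F).sup fun p => hammingDist p.1 p.2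

/-- A formula as a list of numbers: the number of variables, the number of clauses, and then, for
each clause, its length followed by its literals; the literal of variable `i` is coded by `2 * i + 1`
if it is positive and by `2 * i` if it is negated. -/
def encode {n : ℕ} (F : Formula n) : List ℕ :=
  n :: F.clauses.size ::
    F.clauses.toList.flatMap fun c => c.length :: c.map fun l => 2 * (l.1 : ℕ) + l.2.toNat

/-- The initial memory: the code of the formula, followed by zeros. -/
def inputMem {n : ℕ} (F : Formula n) : RandRAM.Mem := fun i => (encode F).getD i 0

/-- The assignment written in the `n` cells from address `a` on. -/
def readAssignment (n a : ℕ) (σ : RandRAM.Mem) : Fin n → Bool := fun i => σ (a + i) != 0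

/-- The two assignments output in the cells `0, …, 2 * n - 1` satisfy `F`, and their Hamming
distance is at least `ρ` times the diameter. -/
def GoodOutput {n : ℕ} (ρ : ℝ) (F : Formula n) (σ : RandRAM.Mem) : Prop :=
  readAssignment n 0 σ ∈ solutions F ∧ readAssignment n n σ ∈ solutions F ∧
    ρ * (diam F : ℝ) ≤ (hammingDist (readAssignment n 0 σ) (readAssignment n n σ) : ℝ)

/-- There is a randomized algorithm that halts on every `k`-CNF formula `F` with `n` variables and
`m` clauses, always within time `O*(T n)` (that is, `T n` up to a factor polynomial in `n` and `m`),
and that, if `F` is satisfiable, outputs with probability `1 - o(1)` (as `n → ∞`, uniformly in `F`)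
two satisfying assignments at distance at least `ρ` times the diameter. -/
def HasDiamAlgorithm (k : ℕ) (ρ : ℝ) (T : ℕ → ℝ) : Prop :=
  ∃ (P : RandRAM.Prog) (C d : ℕ) (err : ℕ → ℝ), Tendsto err atTop (𝓝 0) ∧
    ∀ (n : ℕ) (F : Formula n), IsKCNF k F →
      ∃ μ : PMF RandRAM.Outcome, RandRAM.Exec P (inputMem F) μ ∧
        (∀ o ∈ μ.support, (o.2 : ℝ) ≤ C * ((n : ℝ) + F.clauses.size + 1) ^ d * T n) ∧
        ((solutions F).Nonempty →
          1 - err n ≤ (μ.toOuterMeasure {o | GoodOutput ρ F o.1}).toReal)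

/-! ### The running times and the ranges of the loss parameter -/

noncomputable def R₁ (δ : ℝ) (n : ℕ) : ℕ := ⌊δ * n / (2 * (2 + δ))⌋₊

noncomputable def R₂ (δ : ℝ) (k n : ℕ) : ℕ := ⌊δ * n / (2 * (2 + δ + 2 / ((k : ℝ) - 2)))⌋₊

noncomputable def τ₁ (δ : ℝ) (k n : ℕ) : ℝ :=
  2 ^ n * (k : ℝ) ^ R₁ δ n / (n.choose (R₁ δ n) : ℝ)

noncomputable def τ₂ (δ : ℝ) (k n : ℕ) : ℝ :=
  2 ^ n * ((k : ℝ) - 1) ^ R₂ δ k n / (n.choose (R₂ δ k n) : ℝ)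

noncomputable def δ₁ (k : ℕ) : ℝ := 4 / ((k : ℝ) - 1)

noncomputable def δ₂ (k : ℕ) : ℝ := 4 / ((k : ℝ) - 1) * (1 + 1 / ((k : ℝ) - 2)) ^ 2

end KSat

/-! The algorithm keeps a reference assignment z. Independent attempts first replace z by a solution
and then look for a solution far from z. By the triangle inequality one end of a diameter is at
distance at least Diam/2 from z (`exists_far_solution`). Hence it suffices that, for every z and
every solution w, one attempt finds with probability at least p a solution v with d(z,v) ≥ (1-δ)
d(z,w); this is `AttemptBound`. A number of repetitions of order poly(n)/p makes the error
exponentially small (`amplify`, `error_bound`).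

An attempt perturbs z at random and then runs Schöning's walk, which flips a random literal of an
unsatisfied clause. A clause that is false at y and true at w has a literal on which they differ, so
the distance to w behaves at least as well as a walk on ℕ that steps down with probability 1/k. From
distance R the walk therefore reaches some solution within T steps with probability at least `hit k
T R` (`walk_loop_spec`). This is at least k^(-R) for T = R (`pow_le_hit`), and (k-1)^(-R) up to a
factor O(n) for T about kR/(k-2) (`le_hit`). The solution reached need not be w, but it lies within
T of the starting point, so the starting point has to be far from z.

For a uniform start, consider the points obtained from w by flipping a set S of R coordinates. If A
is the set where z and w differ, such a point has distance d(z,w) + R - 2|S ∩ A| from z. The mean of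
|S ∩ A| is R|A|/n, and Markov's inequality leaves a constant fraction of sets S with a small
intersection (`card_few_le`). With T = R every radius R = yn with y < δ/2 is admissible, with
success probability about 2^(-n) C(n,R) k^(-R). Such radii may exceed R₁, and a larger radius below
n/(k+1) gives a better rate; the upper bound on δ says that R₁ stays in this range.

With the longer walk the k of the rate becomes k-1, but the excess length 2R/(k-2) can be charged to
the loss δ d(z,w) only if d(z,w) ≥ n/m for a suitable m. Closer solutions are reached by a second
mode of perturbation with a small flip probability t. If all r = d(z,w) differing coordinates get
flipped, then w lies between z and the start, and a shortest walk cannot end closer to z than w.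
This has probability at least t^r (1-t+t/k)^(n-r) (`exists_walkBound_of_near`).

The machine computes its number of rounds from a rational base u/v. The admissible radii exceed R₁
and R₂ strictly, which leaves room for a rational number between the base that the attempts need and
the base of the time bound (`exists_radius`, `IsBaseBound`, `exists_base`). The generic choice m = k
works for k ≥ 5. For k = 4 two numerical choices are made, and for k = 3 shortest walks already beat
τ₂.

The program is verified with `Spec`, which controls the number of steps, a bound M for all memory
cells, a postcondition and a lower bound for an expectation simultaneously. With M = 2^O(n+m) every
step has logarithmic cost O(n+m), so counting steps suffices. -/

namespace RandRAM

/-! ### Expected values of functions of the outcome -/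

open scoped ENNReal

/-- The expectation of a nonnegative function. -/
noncomputable def expect {α : Type*} (μ : PMF α) (f : α → ℝ≥0∞) : ℝ≥0∞ := ∑' a, μ a * f a

theorem expect_pure {α : Type*} (a : α) (f : α → ℝ≥0∞) : expect (PMF.pure a) f = f a := by
  rw [expect, tsum_eq_single a]
  · simp
  · intro b hb; simp [PMF.pure_apply, hb]

theorem expect_bind {α β : Type*} (μ : PMF α) (ν : α → PMF β) (f : β → ℝ≥0∞) :
    expect (μ.bind ν) f = expect μ fun a => expect (ν a) f := by
  simp only [expect, PMF.bind_apply, ← ENNReal.tsum_mul_left, ← ENNReal.tsum_mul_right]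
  rw [ENNReal.tsum_comm]
  simp only [mul_assoc]

theorem expect_map {α β : Type*} (μ : PMF α) (g : α → β) (f : β → ℝ≥0∞) :
    expect (μ.map g) f = expect μ fun a => f (g a) := by
  rw [PMF.map, expect_bind]
  simp [Function.comp, expect_pure]

theorem expect_uniform (v : ℕ) (f : Fin (v + 1) → ℝ≥0∞) :
    expect (PMF.uniformOfFintype (Fin (v + 1))) f = (∑ i, f i) / ((v : ℝ≥0∞) + 1) := by
  simp [expect, tsum_fintype, ENNReal.div_eq_inv_mul, Finset.mul_sum]

theorem expect_mono {α : Type*} (μ : PMF α) {f g : α → ℝ≥0∞}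
    (h : ∀ a ∈ μ.support, f a ≤ g a) : expect μ f ≤ expect μ g := by
  refine ENNReal.tsum_le_tsum fun a => ?_
  by_cases ha : a ∈ μ.support
  · exact mul_le_mul_right (h a ha) _
  · simp [(PMF.apply_eq_zero_iff μ a).2 ha]

theorem expect_const {α : Type*} (μ : PMF α) (c : ℝ≥0∞) : expect μ (fun _ => c) = c := by
  simp [expect, ENNReal.tsum_mul_right, μ.tsum_coe]

/-! ### Bounds for the cost of evaluation -/

/-- Every operation gives a result of binary length at most the sum of the lengths of its arguments
plus one; multiplication is the worst case. For a fixed expression the length is therefore linear in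
log M, so a bound for the memory cells bounds the cost of every step. -/
theorem exists_eval_size_le (e : Expr) : ∃ c : ℕ, ∀ (σ : Mem) (M : ℕ), (∀ a, σ a ≤ M) →
    Nat.size (e.eval σ) ≤ c * (Nat.size M + 1) := by
  induction e with
  | lit c => exact ⟨Nat.size c, fun σ M _ => by simp only [Expr.eval]; nlinarith [Nat.zero_le (Nat.size c * Nat.size M)]⟩
  | deref a _ =>
    exact ⟨1, fun σ M h => by
      have := Nat.size_le_size (h (a.eval σ)); simp only [Expr.eval]; omega⟩
  | op o a b iha ihb =>
    obtain ⟨c, hc⟩ := iha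
    obtain ⟨d, hd⟩ := ihb
    refine ⟨c + d + 1, fun σ M h => ?_⟩
    have h1 := hc σ M h
    have h2 := hd σ M h
    simp only [Expr.eval]
    generalize a.eval σ = x at *
    generalize b.eval σ = y at *
    have hx := Nat.lt_size_self x
    have hy := Nat.lt_size_self y
    have h3 : Nat.size (o.eval x y) ≤ Nat.size x + Nat.size y + 1 := by
      have hle : ∀ z, z ≤ x → Nat.size z ≤ Nat.size x + Nat.size y + 1 := fun z hz => by
        have := Nat.size_le_size hz; omega
      have h01 : ∀ z, z ≤ 1 → Nat.size z ≤ Nat.size x + Nat.size y + 1 := fun z hz => by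
        have := Nat.size_le_size hz; simp at this; omega
      cases o <;> simp only [BinOp.eval]
      · rw [Nat.size_le, pow_succ]
        have := Nat.pow_le_pow_right (n := 2) (by norm_num) (Nat.le_add_right (Nat.size x) (Nat.size y))
        have := Nat.pow_le_pow_right (n := 2) (by norm_num) (Nat.le_add_left (Nat.size y) (Nat.size x))
        omega
      · exact hle _ (Nat.sub_le _ _)
      · rw [Nat.size_le, pow_succ, pow_add]
        have : x * y < 2 ^ Nat.size x * 2 ^ Nat.size y := Nat.mul_lt_mul'' hx hy
        omega
      · exact hle _ (Nat.div_le_self _ _)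
      · exact hle _ (Nat.mod_le _ _)
      · exact h01 _ (by split <;> omega)
      · exact h01 _ (by split <;> omega)
    nlinarith [Nat.zero_le (Nat.size M)]

theorem exists_cost_le (e : Expr) : ∃ c : ℕ, ∀ (σ : Mem) (M : ℕ), (∀ a, σ a ≤ M) →
    e.cost σ ≤ c * (Nat.size M + 1) := by
  induction e with
  | lit c => exact ⟨1 + Nat.size c, fun σ M _ => by
      simp only [Expr.cost]; nlinarith [Nat.zero_le (Nat.size c * Nat.size M)]⟩
  | deref a iha =>
    obtain ⟨c, hc⟩ := iha
    exact ⟨c + 1, fun σ M h => by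
      have := Nat.size_le_size (h (a.eval σ)); have := hc σ M h; simp only [Expr.cost]; nlinarith⟩
  | op o a b iha ihb =>
    obtain ⟨c, hc⟩ := iha
    obtain ⟨d, hd⟩ := ihb
    obtain ⟨s, hs⟩ := exists_eval_size_le (.op o a b)
    refine ⟨c + d + s + 1, fun σ M h => ?_⟩
    have h1 := hc σ M h
    have h2 := hd σ M h
    have h3 := hs σ M h
    simp only [Expr.cost, Expr.eval] at *
    nlinarith [Nat.zero_le (Nat.size M)]

/-- Every single step of `p` costs at most `κ` in a memory whose cells are bounded by `M`. -/
def Prog.CostLe (κ M : ℕ) : Prog → Prop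
  | .skip => 1 ≤ κ
  | .assign a e => ∀ σ : Mem, (∀ x, σ x ≤ M) → 1 + a.cost σ + e.cost σ ≤ κ
  | .rand a e => ∀ σ : Mem, (∀ x, σ x ≤ M) → 1 + a.cost σ + e.cost σ ≤ κ
  | .seq p q => p.CostLe κ M ∧ q.CostLe κ M
  | .ite e p q => (∀ σ : Mem, (∀ x, σ x ≤ M) → 1 + e.cost σ ≤ κ) ∧ p.CostLe κ M ∧ q.CostLe κ M
  | .loop e p => (∀ σ : Mem, (∀ x, σ x ≤ M) → 1 + e.cost σ ≤ κ) ∧ p.CostLe κ M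

theorem Prog.CostLe.mono {κ κ' M : ℕ} (h : κ ≤ κ') {p : Prog} (hp : p.CostLe κ M) :
    p.CostLe κ' M := by
  induction p with
  | skip => exact le_trans hp h
  | assign a e => exact fun σ hσ => (hp σ hσ).trans h
  | rand a e => exact fun σ hσ => (hp σ hσ).trans h
  | seq p q ihp ihq => exact ⟨ihp hp.1, ihq hp.2⟩
  | ite e p q ihp ihq => exact ⟨fun σ hσ => (hp.1 σ hσ).trans h, ihp hp.2.1, ihq hp.2.2⟩
  | loop e p ih => exact ⟨fun σ hσ => (hp.1 σ hσ).trans h, ih hp.2⟩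

theorem Prog.exists_costLe (p : Prog) : ∃ c : ℕ, ∀ M, p.CostLe (c * (Nat.size M + 1)) M := by
  induction p with
  | skip => exact ⟨1, fun M => by simp [Prog.CostLe]⟩
  | assign a e =>
    obtain ⟨c, hc⟩ := exists_cost_le a
    obtain ⟨d, hd⟩ := exists_cost_le e
    exact ⟨1 + c + d, fun M σ h => by nlinarith [hc σ M h, hd σ M h]⟩
  | rand a e =>
    obtain ⟨c, hc⟩ := exists_cost_le a
    obtain ⟨d, hd⟩ := exists_cost_le e
    exact ⟨1 + c + d, fun M σ h => by nlinarith [hc σ M h, hd σ M h]⟩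
  | seq p q ihp ihq =>
    obtain ⟨c, hc⟩ := ihp
    obtain ⟨d, hd⟩ := ihq
    exact ⟨c + d, fun M => ⟨(hc M).mono (Nat.mul_le_mul_right _ (by omega)),
      (hd M).mono (Nat.mul_le_mul_right _ (by omega))⟩⟩
  | ite e p q ihp ihq =>
    obtain ⟨b, hb⟩ := exists_cost_le e
    obtain ⟨c, hc⟩ := ihp
    obtain ⟨d, hd⟩ := ihq
    exact ⟨1 + b + c + d, fun M => ⟨fun σ h => by nlinarith [hb σ M h],
      (hc M).mono (Nat.mul_le_mul_right _ (by omega)),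
      (hd M).mono (Nat.mul_le_mul_right _ (by omega))⟩⟩
  | loop e p ih =>
    obtain ⟨b, hb⟩ := exists_cost_le e
    obtain ⟨c, hc⟩ := ih
    exact ⟨1 + b + c, fun M => ⟨fun σ h => by nlinarith [hb σ M h],
      (hc M).mono (Nat.mul_le_mul_right _ (by omega))⟩⟩

/-! ### A calculus of specifications -/

/-- Started on `σ`, a memory bounded by `M`, the program `p` makes at most `N` steps (of cost at
most `κ` each), the memory stays bounded by `M`, the final memory satisfies `Q`, and the expected
value of `f` at the final memory is at least `ρ`. -/
def Spec (κ M : ℕ) (p : Prog) (σ : Mem) (N : ℕ) (Q : Mem → Prop) (f : Mem → ℝ≥0∞)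
    (ρ : ℝ≥0∞) : Prop :=
  (∀ a, σ a ≤ M) → p.CostLe κ M → ∃ μ : PMF Outcome, Exec p σ μ ∧
    (∀ o ∈ μ.support, o.2 ≤ N * κ ∧ (∀ a, o.1 a ≤ M) ∧ Q o.1) ∧ ρ ≤ expect μ fun o => f o.1

namespace Spec

variable {κ M N N' : ℕ} {p q : Prog} {σ : Mem} {Q Q' : Mem → Prop} {f f' : Mem → ℝ≥0∞}
  {ρ ρ' : ℝ≥0∞} {a e : Expr}

theorem conseq (h : Spec κ M p σ N Q f ρ) (hN : N ≤ N')
    (hQ : ∀ τ, (∀ a, τ a ≤ M) → Q τ → Q' τ) (hf : ∀ τ, Q τ → f τ ≤ f' τ) (hρ : ρ' ≤ ρ) :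
    Spec κ M p σ N' Q' f' ρ' := by
  intro hσ hp
  obtain ⟨μ, h1, h2, h3⟩ := h hσ hp
  refine ⟨μ, h1, fun o ho => ⟨(h2 o ho).1.trans (Nat.mul_le_mul_right _ hN), (h2 o ho).2.1,
    hQ _ (h2 o ho).2.1 (h2 o ho).2.2⟩, hρ.trans (h3.trans (expect_mono _ fun o ho => hf _ (h2 o ho).2.2))⟩

/-- The postcondition holds for all outcomes, so a pointwise bound on it bounds the expectation.
Specifications with `0 0` carry no probabilistic information and serve for the deterministic parts.
-/
theorem of_sure (h : Spec κ M p σ N Q 0 0) (hf : ∀ τ, Q τ → ρ ≤ f τ) : Spec κ M p σ N Q f ρ := by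
  intro hσ hp
  obtain ⟨μ, h1, h2, -⟩ := h hσ hp
  exact ⟨μ, h1, h2, (expect_const μ ρ).symm.le.trans (expect_mono _ fun o ho => hf _ (h2 o ho).2.2)⟩

theorem skip (hQ : Q σ) (hf : ρ ≤ f σ) : Spec κ M .skip σ 1 Q f ρ := by
  intro hσ hp
  refine ⟨_, .skip σ, ?_, by rwa [expect_pure]⟩
  intro o ho
  obtain rfl := (PMF.mem_support_pure_iff _ _).1 ho
  exact ⟨by simpa [Prog.CostLe] using hp, hσ, hQ⟩

theorem assign (he : e.eval σ ≤ M) (hQ : Q (Function.update σ (a.eval σ) (e.eval σ)))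
    (hf : ρ ≤ f (Function.update σ (a.eval σ) (e.eval σ))) :
    Spec κ M (.assign a e) σ 1 Q f ρ := by
  intro hσ hp
  refine ⟨_, .assign a e σ, ?_, by rwa [expect_pure]⟩
  intro o ho
  obtain rfl := (PMF.mem_support_pure_iff _ _).1 ho
  refine ⟨by simpa using hp σ hσ, fun x => ?_, hQ⟩
  rcases eq_or_ne x (a.eval σ) with h | h <;> simp [h, he, hσ]

theorem rand (he : e.eval σ ≤ M)
    (hQ : ∀ i, i ≤ e.eval σ → Q (Function.update σ (a.eval σ) i))
    (hf : ρ ≤ (∑ i ∈ Finset.range (e.eval σ + 1), f (Function.update σ (a.eval σ) i)) /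
      ((e.eval σ : ℝ≥0∞) + 1)) :
    Spec κ M (.rand a e) σ 1 Q f ρ := by
  intro hσ hp
  refine ⟨_, .rand a e σ, ?_, ?_⟩
  · intro o ho
    obtain ⟨i, hi, rfl⟩ := (PMF.mem_support_map_iff _ _ _).1 ho
    -- The value drawn is a natural number, distributed as the image of the uniform law on `Fin`;
    -- exposing this map recovers the upper bound on it.
    replace hi : i ∈ (PMF.map (fun i : Fin (e.eval σ + 1) => (i : ℕ))
      (PMF.uniformOfFintype _)).support := hi
    obtain ⟨i', -, rfl⟩ := (PMF.mem_support_map_iff _ _ _).1 hi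
    have hi : (i' : ℕ) ≤ e.eval σ := by omega
    refine ⟨by simpa using hp σ hσ, fun x => ?_, hQ _ hi⟩
    rcases eq_or_ne x (a.eval σ) with h | h <;> simp [h, hi.trans he, hσ]
  · rw [expect_map]
    change ρ ≤ expect (PMF.map (fun i : Fin (e.eval σ + 1) => (i : ℕ))
      (PMF.uniformOfFintype _)) _
    rw [expect_map, expect_uniform, Fin.sum_univ_eq_sum_range
      (fun i => f (Function.update σ (a.eval σ) i))]
    exact hf

/-- The law of total expectation: `g` is the expectation that the second program guarantees from the
intermediate memory, and the first program is asked for a lower bound on the mean of `g`. -/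
theorem seq {g : Mem → ℝ≥0∞} (hp : Spec κ M p σ N Q g ρ)
    (hq : ∀ τ, (∀ a, τ a ≤ M) → Q τ → Spec κ M q τ N' Q' f (g τ)) :
    Spec κ M (.seq p q) σ (N + N') Q' f ρ := by
  intro hσ hc
  obtain ⟨μ, h1, h2, h3⟩ := hp hσ hc.1
  have key : ∀ o : Outcome, ∃ ν : PMF Outcome, o ∈ μ.support → Exec q o.1 ν ∧
      (∀ o' ∈ ν.support, o'.2 ≤ N' * κ ∧ (∀ a, o'.1 a ≤ M) ∧ Q' o'.1) ∧
      g o.1 ≤ expect ν fun o => f o.1 := by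
    intro o
    by_cases ho : o ∈ μ.support
    · obtain ⟨ν, hν⟩ := hq o.1 (h2 o ho).2.1 (h2 o ho).2.2 (h2 o ho).2.1 hc.2
      exact ⟨ν, fun _ => hν⟩
    · exact ⟨PMF.pure o, fun h => absurd h ho⟩
  choose ν hν using key
  refine ⟨_, .seq p q σ μ ν h1 fun o ho => (hν o ho).1, ?_, ?_⟩
  · intro o ho
    obtain ⟨o1, ho1, ho⟩ := (PMF.mem_support_bind_iff _ _ _).1 ho
    obtain ⟨o2, ho2, rfl⟩ := (PMF.mem_support_map_iff _ _ _).1 ho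
    obtain ⟨t2, b2, q2⟩ := (hν o1 ho1).2.1 o2 ho2
    refine ⟨?_, b2, q2⟩
    have := (h2 o1 ho1).1
    simp only [Outcome.addTime, add_mul]
    omega
  · rw [expect_bind]
    refine h3.trans (expect_mono _ fun o ho => ?_)
    rw [expect_map]
    exact (hν o ho).2.2

theorem seq_sure (hp : Spec κ M p σ N Q 0 0)
    (hq : ∀ τ, (∀ a, τ a ≤ M) → Q τ → Spec κ M q τ N' Q' f ρ) :
    Spec κ M (.seq p q) σ (N + N') Q' f ρ :=
  seq (g := fun _ => ρ) (hp.of_sure fun _ _ => le_rfl) hq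

theorem map_addTime {μ : PMF Outcome} {t : ℕ} (ht : t ≤ κ)
    (h2 : ∀ o ∈ μ.support, o.2 ≤ N * κ ∧ (∀ a, o.1 a ≤ M) ∧ Q o.1)
    (h3 : ρ ≤ expect μ fun o => f o.1) :
    (∀ o ∈ (μ.map (Outcome.addTime t)).support,
      o.2 ≤ (N + 1) * κ ∧ (∀ a, o.1 a ≤ M) ∧ Q o.1) ∧
    ρ ≤ expect (μ.map (Outcome.addTime t)) fun o => f o.1 := by
  refine ⟨fun o ho => ?_, by rw [expect_map]; exact h3⟩
  obtain ⟨o1, ho1, rfl⟩ := (PMF.mem_support_map_iff _ _ _).1 ho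
  obtain ⟨h, h'⟩ := h2 o1 ho1
  refine ⟨?_, h'⟩
  simp only [Outcome.addTime, add_mul]
  omega

theorem ite_true (he : e.eval σ ≠ 0) (h : Spec κ M p σ N Q f ρ) :
    Spec κ M (.ite e p q) σ (N + 1) Q f ρ := by
  intro hσ hp
  obtain ⟨μ, h1, h2, h3⟩ := h hσ hp.2.1
  exact ⟨_, .ite_true e p q σ μ he h1, map_addTime (hp.1 σ hσ) h2 h3⟩

theorem ite_false (he : e.eval σ = 0) (h : Spec κ M q σ N Q f ρ) :
    Spec κ M (.ite e p q) σ (N + 1) Q f ρ := by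
  intro hσ hp
  obtain ⟨μ, h1, h2, h3⟩ := h hσ hp.2.2
  exact ⟨_, .ite_false e p q σ μ he h1, map_addTime (hp.1 σ hσ) h2 h3⟩

theorem loop_true (he : e.eval σ ≠ 0) (h : Spec κ M (.seq p (.loop e p)) σ N Q f ρ) :
    Spec κ M (.loop e p) σ (N + 1) Q f ρ := by
  intro hσ hp
  obtain ⟨μ, h1, h2, h3⟩ := h hσ ⟨hp.2, hp⟩
  exact ⟨_, .loop_true e p σ μ he h1, map_addTime (hp.1 σ hσ) h2 h3⟩

theorem loop_false (he : e.eval σ = 0) (hQ : Q σ) (hf : ρ ≤ f σ) :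
    Spec κ M (.loop e p) σ 1 Q f ρ := by
  intro hσ hp
  refine ⟨_, .loop_false e p σ he, ?_, by rwa [expect_pure]⟩
  intro o ho
  obtain rfl := (PMF.mem_support_pure_iff _ _).1 ho
  exact ⟨by simpa using hp.1 σ hσ, hσ, hQ⟩

/-- A loop with an invariant `I` indexed by the number of remaining rounds and a lower bound `g`
for the expected value that is also indexed by it. -/
theorem loop_count {I : ℕ → Mem → Prop} {g : ℕ → Mem → ℝ≥0∞}
    (h0 : ∀ τ, (∀ a, τ a ≤ M) → I 0 τ → e.eval τ = 0)
    (hs : ∀ j τ, (∀ a, τ a ≤ M) → I (j + 1) τ →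
      e.eval τ ≠ 0 ∧ Spec κ M p τ N (I j) (g j) (g (j + 1) τ))
    (j : ℕ) (hσ : I j σ) :
    Spec κ M (.loop e p) σ (j * (N + 1) + 1) (I 0) (g 0) (g j σ) := by
  induction j generalizing σ with
  | zero => intro hb; exact (loop_false (h0 σ hb hσ) hσ le_rfl).conseq (by omega) (fun _ _ h => h) (fun _ _ => le_rfl) le_rfl hb
  | succ j ih =>
    intro hb
    obtain ⟨h1, h2⟩ := hs j σ hb hσ
    refine (loop_true h1 (seq h2 fun τ _ hτ => ih hτ)).conseq ?_ (fun _ _ h => h) (fun _ _ => le_rfl) le_rfl hb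
    rw [Nat.add_mul]; omega

theorem loop_count_sure {I : ℕ → Mem → Prop}
    (h0 : ∀ τ, (∀ a, τ a ≤ M) → I 0 τ → e.eval τ = 0)
    (hs : ∀ j τ, (∀ a, τ a ≤ M) → I (j + 1) τ → e.eval τ ≠ 0 ∧ Spec κ M p τ N (I j) 0 0)
    (j : ℕ) (hσ : I j σ) :
    Spec κ M (.loop e p) σ (j * (N + 1) + 1) (I 0) 0 0 :=
  loop_count (g := fun _ => 0) h0 hs j hσ

end Spec

end RandRAM

/-! ### The search program: memory layout and checking of assignments. -/

namespace KSat

open RandRAM Std.Sat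
open scoped ENNReal

/-! ### The code of a formula -/

/-- The code of a list of clauses. -/
def clauseCode {n : ℕ} (cs : List (CNF.Clause (Fin n))) : List ℕ :=
  cs.flatMap fun c => c.length :: c.map fun l => 2 * (l.1 : ℕ) + l.2.toNat

theorem clauseCode_append {n : ℕ} (cs ds : List (CNF.Clause (Fin n))) :
    clauseCode (cs ++ ds) = clauseCode cs ++ clauseCode ds := by simp [clauseCode]

theorem clauseCode_cons {n : ℕ} (c : CNF.Clause (Fin n)) (cs : List (CNF.Clause (Fin n))) :
    clauseCode (c :: cs) =
      c.length :: (c.map fun l => 2 * (l.1 : ℕ) + l.2.toNat) ++ clauseCode cs := by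
  simp [clauseCode]

theorem length_clauseCode_concat {n : ℕ} (cs : List (CNF.Clause (Fin n)))
    (c : CNF.Clause (Fin n)) :
    (clauseCode (cs ++ [c])).length = (clauseCode cs).length + c.length + 1 := by
  simp [clauseCode]; omega

theorem length_clauseCode_le {n k : ℕ} (cs : List (CNF.Clause (Fin n)))
    (h : ∀ c ∈ cs, c.length ≤ k) : (clauseCode cs).length ≤ (k + 1) * cs.length := by
  induction cs with
  | nil => simp [clauseCode]
  | cons c cs ih =>
    have h1 := h c (by simp)
    have h2 := ih fun d hd => h d (by simp [hd])
    rw [clauseCode_cons]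
    simp only [List.length_append, List.length_cons, List.length_map]
    rw [Nat.mul_add]; omega

section Input

variable {n k : ℕ} {F : Formula n}

theorem inputMem_zero : inputMem F 0 = n := rfl

theorem inputMem_one : inputMem F 1 = F.clauses.size := rfl

theorem inputMem_add_two (a : ℕ) : inputMem F (a + 2) = (clauseCode F.clauses.toList).getD a 0 :=
  rfl

/-- `p` is the address of the clause `c` in the input. -/
def IsAddr (F : Formula n) (p : ℕ) (c : CNF.Clause (Fin n)) : Prop :=
  ∃ cs ds, F.clauses.toList = cs ++ c :: ds ∧ p = (clauseCode cs).length + 2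

theorem IsAddr.mem {p : ℕ} {c : CNF.Clause (Fin n)} (h : IsAddr F p c) :
    c ∈ F.clauses := by
  obtain ⟨cs, ds, h, -⟩ := h
  rw [← Array.mem_toList_iff, h]; simp

theorem IsAddr.length {p : ℕ} {c : CNF.Clause (Fin n)} (h : IsAddr F p c) :
    inputMem F p = c.length := by
  obtain ⟨cs, ds, h, rfl⟩ := h
  rw [inputMem_add_two, h, clauseCode_append, clauseCode_cons]
  simp [List.getD_eq_getElem?_getD]

theorem IsAddr.literal {p : ℕ} {c : CNF.Clause (Fin n)} (h : IsAddr F p c) (i : ℕ)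
    (hi : i < c.length) : inputMem F (p + 1 + i) = 2 * ((c.get ⟨i, hi⟩).1 : ℕ) + (c.get ⟨i, hi⟩).2.toNat := by
  obtain ⟨cs, ds, h, rfl⟩ := h
  rw [show (clauseCode cs).length + 2 + 1 + i = ((clauseCode cs).length + (i + 1)) + 2 by omega,
    inputMem_add_two, h, clauseCode_append, clauseCode_cons]
  rw [List.getD_eq_getElem?_getD, List.getElem?_append_right (by omega)]
  simp [List.getElem?_append_left, hi]

theorem IsAddr.add_lt (hF : IsKCNF k F) {p : ℕ} {c : CNF.Clause (Fin n)} (h : IsAddr F p c) :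
    p + c.length < 2 + (k + 1) * F.clauses.size := by
  obtain ⟨cs, ds, h, rfl⟩ := h
  have h1 : (clauseCode F.clauses.toList).length ≤ _ :=
    length_clauseCode_le (k := k) F.clauses.toList fun c hc => hF c (Array.mem_toList_iff.1 hc)
  rw [Array.length_toList (xs := F.clauses)] at h1
  rw [h, clauseCode_append, clauseCode_cons] at h1
  simp at h1
  omega

theorem inputMem_eq_zero (hF : IsKCNF k F) {a : ℕ} (ha : 2 + (k + 1) * F.clauses.size ≤ a) :
    inputMem F a = 0 := by
  obtain ⟨a, rfl⟩ : ∃ a', a = a' + 2 := ⟨a - 2, by omega⟩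
  have h1 : (clauseCode F.clauses.toList).length ≤ _ :=
    length_clauseCode_le (k := k) F.clauses.toList fun c hc => hF c (Array.mem_toList_iff.1 hc)
  rw [Array.length_toList (xs := F.clauses)] at h1
  rw [inputMem_add_two, List.getD_eq_default _ _ (by omega)]

theorem inputMem_le (hF : IsKCNF k F) (a : ℕ) :
    inputMem F a ≤ k + 2 * n + F.clauses.size := by
  rcases a with _ | _ | a
  · rw [inputMem_zero]; omega
  · rw [inputMem_one]; omega
  · rw [inputMem_add_two]
    rcases lt_or_ge a (clauseCode F.clauses.toList).length with h | h
    · rw [List.getD_eq_getElem _ _ h]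
      have := List.getElem_mem h
      generalize (clauseCode F.clauses.toList)[a] = x at this
      simp only [clauseCode, List.mem_flatMap, List.mem_cons, List.mem_map] at this
      obtain ⟨c, hc, rfl | ⟨l, -, rfl⟩⟩ := this
      · have := hF c (Array.mem_toList_iff.1 hc); omega
      · have := l.1.2; have := Bool.toNat_le l.2; omega
    · rw [List.getD_eq_default _ _ h]; omega

end Input

/-! ### States of the algorithm -/

/-- The working memory of the algorithm: fourteen variables and three assignments (the reference
point, the current best partner of it, and the position of the walk). -/
@[ext]
structure State (n : ℕ) where
  num : ℕ
  cnt : ℕ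
  thr : ℕ
  idx : ℕ
  steps : ℕ
  ptr : ℕ
  left : ℕ
  sat : ℕ
  pos : ℕ
  bad : ℕ
  lit : ℕ
  rnd : ℕ
  dist : ℕ
  best : ℕ
  arr : Fin 3 → Fin n → Bool

namespace State

variable {n : ℕ}

/-- The variable with a given index. -/
def var (s : State n) : ℕ → ℕ
  | 0 => s.num
  | 1 => s.cnt
  | 2 => s.thr
  | 3 => s.idx
  | 4 => s.steps
  | 5 => s.ptr
  | 6 => s.left
  | 7 => s.sat
  | 8 => s.pos
  | 9 => s.bad
  | 10 => s.lit
  | 11 => s.rnd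
  | 12 => s.dist
  | 13 => s.best
  | _ => 0

/-- Changing the variable with a given index. -/
def set (s : State n) (c x : ℕ) : State n :=
  match c with
  | 0 => { s with num := x }
  | 1 => { s with cnt := x }
  | 2 => { s with thr := x }
  | 3 => { s with idx := x }
  | 4 => { s with steps := x }
  | 5 => { s with ptr := x }
  | 6 => { s with left := x }
  | 7 => { s with sat := x }
  | 8 => { s with pos := x }
  | 9 => { s with bad := x }
  | 10 => { s with lit := x }
  | 11 => { s with rnd := x }
  | 12 => { s with dist := x }
  | 13 => { s with best := x }
  | _ => s

/-- Changing one bit of one of the assignments. -/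
def setBit (s : State n) (t : Fin 3) (i : Fin n) (x : Bool) : State n :=
  { s with arr := Function.update s.arr t (Function.update (s.arr t) i x) }

theorem var_set (s : State n) {c : ℕ} (hc : c < 14) (x d : ℕ) :
    (s.set c x).var d = if d = c then x else s.var d := by
  interval_cases c <;> (rcases d with _ | _ | _ | _ | _ | _ | _ | _ | _ | _ | _ | _ | _ | _ | d) <;>
    simp [set, var]

theorem arr_set (s : State n) (c x : ℕ) : (s.set c x).arr = s.arr := by
  unfold set; split <;> rfl

theorem var_setBit (s : State n) (t : Fin 3) (i : Fin n) (x : Bool) :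
    (s.setBit t i x).var = s.var := by
  funext d
  unfold var; split <;> rfl

end State

section Layout

variable {n : ℕ} (k : ℕ) (F : Formula n)

/-- The address of the first variable. -/
def base : ℕ := 2 + (k + 1) * F.clauses.size + 2 * n

/-- The memory that holds the input and the state. -/
def State.mem (s : State n) : Mem := fun a =>
  if a < base k F then inputMem F a
  else if a < base k F + 16 then s.var (a - base k F)
  else if h : a - (base k F + 16) < 3 * n then
    (s.arr ⟨(a - (base k F + 16)) / n, Nat.div_lt_of_lt_mul (by rwa [mul_comm])⟩
      ⟨(a - (base k F + 16)) % n, Nat.mod_lt _ (by omega)⟩).toNat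
  else 0

variable {k F}

namespace State

theorem mem_of_lt (s : State n) {a : ℕ} (h : a < base k F) : s.mem k F a = inputMem F a := by
  simp [mem, h]

theorem mem_var (s : State n) {c : ℕ} (h : c < 16) : s.mem k F (base k F + c) = s.var c := by
  simp [mem, h]

theorem mem_arr' (s : State n) {q : ℕ} (h : q < 3 * n) : s.mem k F (base k F + 16 + q) =
    (s.arr ⟨q / n, Nat.div_lt_of_lt_mul (by rwa [mul_comm])⟩
      ⟨q % n, Nat.mod_lt _ (by omega)⟩).toNat := by
  have h1 : ¬ base k F + 16 + q < base k F := by omega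
  have h2 : ¬ base k F + 16 + q < base k F + 16 := by omega
  simp [mem, h1, h2, h]

theorem arr_index_lt (t : Fin 3) (i : Fin n) : (t : ℕ) * n + i < 3 * n := by
  have ht := t.2
  have hi := i.2
  nlinarith

theorem arr_index_div (t : Fin 3) (i : Fin n) : ((t : ℕ) * n + i) / n = t := by
  have hi := i.2
  rw [mul_comm, Nat.mul_add_div (by omega), Nat.div_eq_of_lt hi, add_zero]

theorem arr_index_mod (t : Fin 3) (i : Fin n) : ((t : ℕ) * n + i) % n = i := by
  rw [mul_comm, Nat.mul_add_mod, Nat.mod_eq_of_lt i.2]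

theorem mem_arr (s : State n) (t : Fin 3) (i : Fin n) :
    s.mem k F (base k F + 16 + (t * n + i)) = (s.arr t i).toNat := by
  rw [mem_arr' s (arr_index_lt t i)]
  congr
  · exact arr_index_div t i
  · exact arr_index_mod t i

theorem update_var (s : State n) {c : ℕ} (hc : c < 14) (x : ℕ) :
    Function.update (s.mem k F) (base k F + c) x = (s.set c x).mem k F := by
  funext a
  rcases eq_or_ne a (base k F + c) with rfl | h
  · rw [Function.update_self, mem_var _ (by omega), var_set _ hc, if_pos rfl]
  · rw [Function.update_of_ne h]
    simp only [mem, arr_set, var_set _ hc]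
    have : ∀ h : ¬ a < base k F, a - base k F ≠ c := fun _ => by omega
    split_ifs <;> simp_all

theorem update_arr (s : State n) (t : Fin 3) (i : Fin n) (x : Bool) :
    Function.update (s.mem k F) (base k F + 16 + (t * n + i)) x.toNat =
      (s.setBit t i x).mem k F := by
  funext a
  rcases eq_or_ne a (base k F + 16 + (t * n + i)) with rfl | h
  · rw [Function.update_self, mem_arr]
    simp [setBit]
  · rw [Function.update_of_ne h]
    simp only [mem, var_setBit]
    split_ifs with h1 h2 h3
    · rfl
    · rfl
    · congr 1
      simp only [setBit]
      by_cases ht : (⟨(a - (base k F + 16)) / n, Nat.div_lt_of_lt_mul (by rwa [mul_comm])⟩ : Fin 3) = t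
      · rw [ht, Function.update_self, Function.update_of_ne]
        intro hi
        apply h
        rw [← ht, ← hi]
        simp only
        have := Nat.div_add_mod' (a - (base k F + 16)) n
        omega
      · rw [Function.update_of_ne ht]
    · rfl

/-- Reading a state from a memory. -/
def read (k : ℕ) (F : Formula n) (σ : Mem) : State n where
  num := σ (base k F + 0)
  cnt := σ (base k F + 1)
  thr := σ (base k F + 2)
  idx := σ (base k F + 3)
  steps := σ (base k F + 4)
  ptr := σ (base k F + 5)
  left := σ (base k F + 6)
  sat := σ (base k F + 7)
  pos := σ (base k F + 8)
  bad := σ (base k F + 9)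
  lit := σ (base k F + 10)
  rnd := σ (base k F + 11)
  dist := σ (base k F + 12)
  best := σ (base k F + 13)
  arr := fun t i => σ (base k F + 16 + (t * n + i)) != 0

/-- Since a state can be recovered from its memory, payoffs that are functions of states become
functions of memories, and the calculus for memories transfers to states. -/
theorem read_mem (s : State n) : read k F (s.mem k F) = s := by
  ext
  case arr t i => simp only [read, mem_arr]; cases s.arr t i <;> simp
  all_goals exact mem_var s (by norm_num)

/-- The state with all variables zero. -/
def init (n : ℕ) : State n :=
  ⟨0, 0, 0, 0, 0, 0, 0, 0, 0, 0, 0, 0, 0, 0, fun _ _ => false⟩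

/-- The code of a k-CNF formula ends below `2 + (k + 1) * m`, hence below `base`, and everything
after it is zero; no initialisation is needed. -/
theorem mem_init (hF : IsKCNF k F) : (init n).mem k F = inputMem F := by
  funext a
  unfold mem
  split_ifs with h1 h2 h3
  · rfl
  · rw [inputMem_eq_zero hF (by unfold base at h1; omega)]
    unfold var init; split <;> rfl
  · rw [inputMem_eq_zero hF (by unfold base at h1; omega)]; rfl
  · rw [inputMem_eq_zero hF (by unfold base at h1; omega)]

end State

/-! ### Expressions -/

/-- Addition of expressions. -/
abbrev eadd (a b : Expr) : Expr := .op .add a b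

/-- The content of a cell with a fixed address. -/
abbrev cell (a : ℕ) : Expr := .deref (.lit a)

/-- The address of the first variable. -/
def baseE (k : ℕ) : Expr :=
  eadd (eadd (.lit 2) (.op .mul (.lit (k + 1)) (cell 1))) (.op .mul (.lit 2) (cell 0))

/-- The address of a variable. -/
def varAddr (k c : ℕ) : Expr := eadd (baseE k) (.lit c)

/-- The value of a variable. -/
def varE (k c : ℕ) : Expr := .deref (varAddr k c)

/-- The address of a bit of one of the assignments. -/
def arrAddr (k t : ℕ) (i : Expr) : Expr :=
  eadd (eadd (baseE k) (.lit 16)) (eadd (.op .mul (.lit t) (cell 0)) i)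

variable (s : State n)

theorem mem_zero : s.mem k F 0 = n := by
  rw [s.mem_of_lt (by unfold base; omega), inputMem_zero]

theorem mem_one : s.mem k F 1 = F.clauses.size := by
  rw [s.mem_of_lt (by unfold base; omega), inputMem_one]

@[simp] theorem eval_lit (c : ℕ) (σ : Mem) : (Expr.lit c).eval σ = c := rfl

@[simp] theorem eval_deref (a : Expr) (σ : Mem) : (Expr.deref a).eval σ = σ (a.eval σ) := rfl

@[simp] theorem eval_add (a b : Expr) (σ : Mem) :
    (Expr.op .add a b).eval σ = a.eval σ + b.eval σ := rfl

@[simp] theorem eval_sub (a b : Expr) (σ : Mem) :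
    (Expr.op .sub a b).eval σ = a.eval σ - b.eval σ := rfl

@[simp] theorem eval_mul (a b : Expr) (σ : Mem) :
    (Expr.op .mul a b).eval σ = a.eval σ * b.eval σ := rfl

@[simp] theorem eval_div (a b : Expr) (σ : Mem) :
    (Expr.op .div a b).eval σ = a.eval σ / b.eval σ := rfl

@[simp] theorem eval_mod (a b : Expr) (σ : Mem) :
    (Expr.op .mod a b).eval σ = a.eval σ % b.eval σ := rfl

@[simp] theorem eval_lt (a b : Expr) (σ : Mem) :
    (Expr.op .lt a b).eval σ = if a.eval σ < b.eval σ then 1 else 0 := rfl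

@[simp] theorem eval_eq (a b : Expr) (σ : Mem) :
    (Expr.op .eq a b).eval σ = if a.eval σ = b.eval σ then 1 else 0 := rfl

@[simp] theorem eval_cell_zero : (s.mem k F) 0 = n := mem_zero s

@[simp] theorem eval_cell_one : (s.mem k F) 1 = F.clauses.size := mem_one s

@[simp] theorem eval_baseE : (baseE k).eval (s.mem k F) = base k F := by
  simp [baseE, base]

@[simp] theorem eval_varAddr (c : ℕ) : (varAddr k c).eval (s.mem k F) = base k F + c := by
  simp [varAddr]

theorem eval_varE {c : ℕ} (hc : c < 16) : (varE k c).eval (s.mem k F) = s.var c := by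
  simp [varE, State.mem_var, hc]

@[simp] theorem eval_arrAddr (t : ℕ) (i : Expr) : (arrAddr k t i).eval (s.mem k F) =
    base k F + 16 + (t * n + i.eval (s.mem k F)) := by
  simp [arrAddr]

end Layout

end KSat

namespace KSat

open RandRAM Std.Sat
open scoped ENNReal

/-! ### Specifications in terms of states -/

/-- A specification that refers to states instead of memories. -/
def StateSpec (κ M k : ℕ) {n : ℕ} (F : Formula n) (p : Prog) (s : State n) (N : ℕ)
    (Q : State n → Prop) (f : State n → ℝ≥0∞) (ρ : ℝ≥0∞) : Prop :=
  Spec κ M p (s.mem k F) N (fun τ => ∃ s' : State n, τ = s'.mem k F ∧ Q s')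
    (fun τ => f (State.read k F τ)) ρ

namespace StateSpec

variable {κ M k n N N' : ℕ} {F : Formula n} {p q : Prog} {s : State n} {Q Q' : State n → Prop}
  {f f' : State n → ℝ≥0∞} {ρ ρ' : ℝ≥0∞} {a e : Expr} {c : ℕ}

theorem conseq (h : StateSpec κ M k F p s N Q f ρ) (hN : N ≤ N') (hQ : ∀ s', Q s' → Q' s')
    (hf : ∀ s', Q s' → f s' ≤ f' s') (hρ : ρ' ≤ ρ) : StateSpec κ M k F p s N' Q' f' ρ' := by
  refine Spec.conseq h hN ?_ ?_ hρ
  · rintro τ - ⟨s', rfl, h'⟩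
    exact ⟨s', rfl, hQ _ h'⟩
  · rintro τ ⟨s', rfl, h'⟩
    rw [State.read_mem]
    exact hf _ h'

theorem steps_le (h : StateSpec κ M k F p s N Q f ρ) (hN : N ≤ N') :
    StateSpec κ M k F p s N' Q f ρ :=
  h.conseq hN (fun _ h => h) (fun _ _ => le_rfl) le_rfl

theorem of_sure (h : StateSpec κ M k F p s N Q 0 0) (hf : ∀ s', Q s' → ρ ≤ f s') :
    StateSpec κ M k F p s N Q f ρ := by
  refine Spec.of_sure h ?_
  rintro τ ⟨s', rfl, h'⟩
  rw [State.read_mem]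
  exact hf _ h'

theorem sure (h : StateSpec κ M k F p s N Q f ρ) : StateSpec κ M k F p s N Q 0 0 := by
  intro h1 h2
  obtain ⟨μ, h3, h4, -⟩ := h h1 h2
  exact ⟨μ, h3, h4, zero_le⟩

theorem skip (hQ : Q s) (hf : ρ ≤ f s) : StateSpec κ M k F .skip s 1 Q f ρ :=
  Spec.skip ⟨s, rfl, hQ⟩ (by rwa [State.read_mem])

theorem seq {g : State n → ℝ≥0∞} (hp : StateSpec κ M k F p s N Q g ρ)
    (hq : ∀ s', Q s' → StateSpec κ M k F q s' N' Q' f (g s')) :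
    StateSpec κ M k F (.seq p q) s (N + N') Q' f ρ := by
  refine Spec.seq hp ?_
  rintro τ - ⟨s', rfl, h'⟩
  rw [State.read_mem]
  exact hq _ h'

theorem seq_sure (hp : StateSpec κ M k F p s N Q 0 0)
    (hq : ∀ s', Q s' → StateSpec κ M k F q s' N' Q' f ρ) :
    StateSpec κ M k F (.seq p q) s (N + N') Q' f ρ :=
  seq (g := fun _ => ρ) (hp.of_sure fun _ _ => le_rfl) hq

theorem ite_true (he : e.eval (s.mem k F) ≠ 0) (h : StateSpec κ M k F p s N Q f ρ) :
    StateSpec κ M k F (.ite e p q) s (N + 1) Q f ρ := Spec.ite_true he h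

theorem ite_false (he : e.eval (s.mem k F) = 0) (h : StateSpec κ M k F q s N Q f ρ) :
    StateSpec κ M k F (.ite e p q) s (N + 1) Q f ρ := Spec.ite_false he h

theorem loop_count {I : ℕ → State n → Prop} {g : ℕ → State n → ℝ≥0∞}
    (h0 : ∀ s, I 0 s → e.eval (s.mem k F) = 0)
    (hs : ∀ j s, I (j + 1) s → e.eval (s.mem k F) ≠ 0 ∧
      StateSpec κ M k F p s N (I j) (g j) (g (j + 1) s))
    (j : ℕ) (hσ : I j s) :
    StateSpec κ M k F (.loop e p) s (j * (N + 1) + 1) (I 0) (g 0) (g j s) := by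
  have := Spec.loop_count (κ := κ) (M := M) (N := N) (e := e) (p := p) (σ := s.mem k F)
    (I := fun j τ => ∃ s' : State n, τ = s'.mem k F ∧ I j s')
    (g := fun j τ => g j (State.read k F τ)) ?_ ?_ j ⟨s, rfl, hσ⟩
  · rw [State.read_mem] at this
    exact this
  · rintro τ - ⟨s', rfl, h'⟩
    exact h0 _ h'
  · rintro j τ - ⟨s', rfl, h'⟩
    rw [State.read_mem]
    exact hs _ _ h'

theorem loop_count_sure {I : ℕ → State n → Prop}
    (h0 : ∀ s, I 0 s → e.eval (s.mem k F) = 0)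
    (hs : ∀ j s, I (j + 1) s → e.eval (s.mem k F) ≠ 0 ∧ StateSpec κ M k F p s N (I j) 0 0)
    (j : ℕ) (hσ : I j s) :
    StateSpec κ M k F (.loop e p) s (j * (N + 1) + 1) (I 0) 0 0 :=
  loop_count (g := fun _ => 0) h0 hs j hσ

theorem loop_true (he : e.eval (s.mem k F) ≠ 0)
    (h : StateSpec κ M k F (.seq p (.loop e p)) s N Q f ρ) :
    StateSpec κ M k F (.loop e p) s (N + 1) Q f ρ := Spec.loop_true he h

/-- A specification presupposes a bounded memory, so this bound is available for the variables. It
is what shows that a decremented counter still respects M. -/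
theorem of_var_le (h : (∀ d, d < 14 → s.var d ≤ M) → StateSpec κ M k F p s N Q f ρ) :
    StateSpec κ M k F p s N Q f ρ := by
  intro hb
  refine h (fun d hd => ?_) hb
  rw [← State.mem_var (k := k) (F := F) s (by omega : d < 16)]
  exact hb _

theorem set (c v : ℕ) (hv : e.eval (s.mem k F) = v) (he : (∀ d, d < 14 → s.var d ≤ M) → v ≤ M)
    (hQ : Q (s.set c v)) (hf : ρ ≤ f (s.set c v)) (hc : c < 14 := by norm_num) :
    StateSpec κ M k F (.assign (varAddr k c) e) s 1 Q f ρ := by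
  refine of_var_le fun hb => ?_
  have hu := State.update_var (k := k) (F := F) s hc (e.eval (s.mem k F))
  subst hv
  refine Spec.assign (he hb) ?_ ?_
  · rw [eval_varAddr, hu]
    exact ⟨_, rfl, hQ⟩
  · rwa [eval_varAddr, hu, State.read_mem]

theorem set_seq (c v : ℕ) (hv : e.eval (s.mem k F) = v)
    (he : (∀ d, d < 14 → s.var d ≤ M) → v ≤ M)
    (h : StateSpec κ M k F q (s.set c v) N Q f ρ) (hc : c < 14 := by norm_num) :
    StateSpec κ M k F (.seq (.assign (varAddr k c) e) q) s (1 + N) Q f ρ :=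
  seq_sure (Q := fun s' => s' = s.set c v)
    (set c v hv he rfl le_rfl hc) (by rintro _ rfl; exact h)

theorem rand {v : ℕ} (hc : c < 14) (hv : e.eval (s.mem k F) = v)
    (he : (∀ d, d < 14 → s.var d ≤ M) → v ≤ M)
    (hQ : ∀ i ≤ v, Q (s.set c i))
    (hf : ρ ≤ (∑ i ∈ Finset.range (v + 1), f (s.set c i)) / ((v : ℝ≥0∞) + 1)) :
    StateSpec κ M k F (.rand (varAddr k c) e) s 1 Q f ρ := by
  refine of_var_le fun hb => ?_
  have hu := State.update_var (k := k) (F := F) s hc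
  subst hv
  refine Spec.rand (he hb) (fun i hi => ?_) ?_
  · rw [eval_varAddr, hu]
    exact ⟨_, rfl, hQ i hi⟩
  · simpa only [eval_varAddr, hu, State.read_mem] using hf

theorem setBit {t : Fin 3} {i : Fin n} {b : Bool} {tn : ℕ} {a : Expr} (hM : 1 ≤ M) (ht : tn = t)
    (ha : a.eval (s.mem k F) = i) (he : e.eval (s.mem k F) = b.toNat)
    (hQ : Q (s.setBit t i b)) (hf : ρ ≤ f (s.setBit t i b)) :
    StateSpec κ M k F (.assign (arrAddr k tn a) e) s 1 Q f ρ := by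
  subst ht
  have hu := State.update_arr (k := k) (F := F) s t i b
  refine Spec.assign ?_ ?_ ?_
  · rw [he]; exact (Bool.toNat_le _).trans hM
  · rw [eval_arrAddr, ha, he, hu]
    exact ⟨_, rfl, hQ⟩
  · rwa [eval_arrAddr, ha, he, hu, State.read_mem]

end StateSpec

/-! ### Checking an assignment -/

/-- One round of the loop over the literals of a clause. -/
def literalProg (k : ℕ) : Prog :=
  .seq (.assign (varAddr k 10) (.deref (eadd (varE k 5) (varE k 8)))) <|
  .seq (.assign (varAddr k 7) (eadd (varE k 7)
    (.op .eq (.deref (arrAddr k 2 (.op .div (varE k 10) (.lit 2))))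
      (.op .mod (varE k 10) (.lit 2))))) <|
  .assign (varAddr k 8) (.op .sub (varE k 8) (.lit 1))

/-- One round of the loop over the clauses. -/
def clauseProg (k : ℕ) : Prog :=
  .seq (.assign (varAddr k 7) (.lit 0)) <|
  .seq (.assign (varAddr k 8) (.deref (varE k 5))) <|
  .seq (.loop (varE k 8) (literalProg k)) <|
  .seq (.ite (varE k 7) .skip (.assign (varAddr k 9) (varE k 5))) <|
  .seq (.assign (varAddr k 5) (eadd (eadd (varE k 5) (.deref (varE k 5))) (.lit 1))) <|
  .assign (varAddr k 6) (.op .sub (varE k 6) (.lit 1))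

/-- Finding an unsatisfied clause. -/
def checkProg (k : ℕ) : Prog :=
  .seq (.assign (varAddr k 5) (.lit 2)) <|
  .seq (.assign (varAddr k 6) (cell 1)) <|
  .seq (.assign (varAddr k 9) (.lit 0)) <|
  .loop (varE k 6) (clauseProg k)

section Check

variable {κ M k n : ℕ} {F : Formula n}

theorem IsAddr.mem_ptr (hF : IsKCNF k F) {p : ℕ} {c : CNF.Clause (Fin n)} (h : IsAddr F p c)
    (s : State n) : s.mem k F p = c.length := by
  rw [s.mem_of_lt (by have := h.add_lt hF; unfold base; omega), h.length]

theorem IsAddr.mem_literal (hF : IsKCNF k F) {p : ℕ} {c : CNF.Clause (Fin n)} (h : IsAddr F p c)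
    (s : State n) (i : ℕ) (hi : i < c.length) :
    s.mem k F (p + 1 + i) = 2 * ((c.get ⟨i, hi⟩).1 : ℕ) + (c.get ⟨i, hi⟩).2.toNat := by
  rw [s.mem_of_lt (by have := h.add_lt hF; unfold base; omega), h.literal]

theorem eval_clause_drop (y : Fin n → Bool) (c : CNF.Clause (Fin n)) {i : ℕ}
    (hi : i < c.length) : CNF.Clause.eval y (c.drop i) =
      (y (c.get ⟨i, hi⟩).1 == (c.get ⟨i, hi⟩).2 || CNF.Clause.eval y (c.drop (i + 1))) := by
  rw [List.drop_eq_getElem_cons hi, CNF.Clause.eval_cons]; rfl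

theorem literals_spec (hF : IsKCNF k F) (hM : base k F + 1 ≤ M) {s : State n}
    {c : CNF.Clause (Fin n)} (hc : IsAddr F s.ptr c) (hs : s.sat = 0) (hpos : s.pos = c.length) :
    StateSpec κ M k F (.loop (varE k 8) (literalProg k)) s (c.length * 4 + 1)
      (fun s' => ∃ t l, s' = { s with sat := t, pos := 0, lit := l } ∧
        (t = 0 ↔ CNF.Clause.eval (s.arr 2) c = false)) 0 0 := by
  have hlt := hc.add_lt hF
  have key := StateSpec.loop_count_sure (κ := κ) (M := M) (k := k) (F := F) (s := s) (N := 3)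
    (e := varE k 8) (p := literalProg k)
    -- The literals are read from the last to the first: with `j` rounds left, exactly those of
    -- `c.drop j` have been inspected. The inequality `t + j ≤ c.length` keeps the counter of true
    -- literals below the memory bound.
    (I := fun j s' => ∃ t l, s' = { s with sat := t, pos := j, lit := l } ∧
      t + j ≤ c.length ∧ (t = 0 ↔ CNF.Clause.eval (s.arr 2) (c.drop j) = false)) ?_ ?_ c.length ?_
  · refine key.conseq le_rfl ?_ (fun _ _ => le_rfl) le_rfl
    rintro s' ⟨t, l, rfl, -, h⟩
    exact ⟨t, l, rfl, by simpa using h⟩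
  · rintro s' ⟨t, l, rfl, -, h⟩
    simp [eval_varE, State.var]
  · rintro j s' ⟨t, l, rfl, hj, h⟩
    refine ⟨by simp [eval_varE, State.var], ?_⟩
    have hj' : j < c.length := by omega
    have hmem := fun s : State n => hc.mem_literal hF s j hj'
    rw [eval_clause_drop _ _ (by omega : j < c.length)] at *
    set y := c.get ⟨j, hj'⟩ with hy
    have hy1 := y.1.2
    have hy2 := Bool.toNat_le y.2
    have e1 : (2 * (y.1 : ℕ) + y.2.toNat) / 2 = y.1 := by omega
    have e2 : (2 * (y.1 : ℕ) + y.2.toNat) % 2 = y.2.toNat := by omega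
    have e3 : ∀ a b : Bool, (a.toNat = b.toNat) = (a = b) := by decide
    have harr := fun s : State n => s.mem_arr (k := k) (F := F) 2 y.1
    simp only [Fin.val_two] at harr
    refine StateSpec.steps_le (N := 1 + (1 + 1)) ?_ (by omega)
    refine StateSpec.set_seq 10 (2 * y.1 + y.2.toNat) ?_ (fun _ => ?_) ?_
    · simp only [eval_deref, eval_add, eval_varE, State.var, Nat.reduceLT]
      rw [show s.ptr + (j + 1) = s.ptr + 1 + j by ring, hmem]
    · unfold base at hM; omega
    refine StateSpec.set_seq 7 (t + if s.arr 2 y.1 = y.2 then 1 else 0) ?_ (fun _ => ?_) ?_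
    · simp only [eval_deref, eval_add, eval_varE, State.var, Nat.reduceLT, eval_eq, eval_arrAddr,
        eval_div, eval_mod, eval_lit, e1, e2, harr, e3, State.set]
    · unfold base at hM; split_ifs <;> omega
    refine StateSpec.set 8 j ?_ (fun _ => ?_) ?_ le_rfl
    · simp only [eval_sub, eval_varE, State.var, Nat.reduceLT, eval_lit, State.set]; omega
    · unfold base at hM; omega
    refine ⟨t + if s.arr 2 y.1 = y.2 then 1 else 0, _, rfl, by split_ifs <;> omega, ?_⟩
    by_cases hyy : s.arr 2 y.1 = y.2
    · simp [hyy]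
    · simp [hyy, h]
  · refine ⟨0, s.lit, ?_, by simp, by simp⟩
    rw [← hs, ← hpos]

theorem clause_spec (hF : IsKCNF k F) (hM : base k F + 1 ≤ M) {s : State n}
    {c : CNF.Clause (Fin n)} (hc : IsAddr F s.ptr c) :
    StateSpec κ M k F (clauseProg k) s (4 * k + 7)
      (fun s' => ∃ t l, s' = { s with
        ptr := s.ptr + c.length + 1, left := s.left - 1, sat := t, pos := 0, lit := l,
        bad := if CNF.Clause.eval (s.arr 2) c = true then s.bad else s.ptr }) 0 0 := by
  have hlt := hc.add_lt hF
  have hk : c.length ≤ k := hF c hc.mem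
  have hmem := hc.mem_ptr hF
  have hM' : s.ptr + c.length + 1 ≤ M := by unfold base at hM; omega
  refine StateSpec.steps_le (N := 1 + (1 + ((c.length * 4 + 1) + (2 + (1 + 1))))) ?_ (by omega)
  refine StateSpec.set_seq 7 0 rfl (fun _ => by omega) ?_
  have ev : ∀ (s' : State n), s'.ptr = s.ptr →
      (Expr.deref (varE k 5)).eval (s'.mem k F) = c.length := by
    intro s' h
    simp only [eval_deref, eval_varE, State.var, Nat.reduceLT, h, hmem]
  refine StateSpec.set_seq 8 c.length (ev _ rfl) (fun _ => by omega) ?_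
  simp only [State.set]
  refine StateSpec.seq_sure (literals_spec hF hM hc rfl rfl) ?_
  rintro _ ⟨t, l, rfl, ht⟩
  simp only at ht ⊢
  refine StateSpec.seq_sure (Q := fun s' => s' = { s with
        sat := t, pos := 0, lit := l,
        bad := if CNF.Clause.eval (s.arr 2) c = true then s.bad else s.ptr }) ?_ ?_
  · by_cases h : t = 0
    · have h' := ht.1 h
      refine StateSpec.ite_false (by simpa [eval_varE, State.var] using h)
        (StateSpec.set 9 s.ptr ?_ (fun _ => by omega) ?_ le_rfl)
      · simp [eval_varE, State.var]
      · simp [State.set, h']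
    · have h' : CNF.Clause.eval (s.arr 2) c = true := by
        by_contra h''; exact h (ht.2 (by simpa using h''))
      refine StateSpec.ite_true (by simpa [eval_varE, State.var] using h)
        (StateSpec.skip ?_ le_rfl)
      simp [h']
  · rintro _ rfl
    refine StateSpec.set_seq 5 (s.ptr + c.length + 1) ?_ (fun _ => hM') ?_
    · simp only [eval_add, ev, eval_varE, State.var, Nat.reduceLT, eval_lit]
    refine StateSpec.set 6 (s.left - 1) ?_ (fun hb => ?_) ?_ le_rfl
    · simp only [eval_sub, eval_varE, State.var, Nat.reduceLT, eval_lit, State.set]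
    · have := hb 6 (by norm_num)
      simp only [State.var, State.set] at this
      omega
    · exact ⟨t, l, rfl⟩

/-- The number of steps of a check. -/
def checkSteps (k m : ℕ) : ℕ := m * (4 * k + 8) + 4

/-- The variable `bad` is both a flag and a pointer. Addresses of clauses are at least 2, so the
value 0 is free to mean that all clauses seen so far are true; otherwise the last false clause is
remembered. -/
theorem check_spec (hF : IsKCNF k F) (hM : base k F + 1 ≤ M) (s : State n) :
    StateSpec κ M k F (checkProg k) s (checkSteps k F.clauses.size)
      (fun s' => ∃ p t j l u, s' = { s with
        ptr := p, left := 0, sat := t, pos := j, lit := l, bad := u } ∧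
        (u = 0 → s.arr 2 ∈ solutions F) ∧
        (u ≠ 0 → ∃ c, IsAddr F u c ∧ CNF.Clause.eval (s.arr 2) c = false)) 0 0 := by
  have hm : F.clauses.toList.length = F.clauses.size := Array.length_toList
  refine StateSpec.steps_le (N := 1 + (1 + (1 + (F.clauses.size * (4 * k + 7 + 1) + 1)))) ?_
    (by unfold checkSteps; ring_nf; omega)
  refine StateSpec.set_seq 5 2 rfl (fun _ => by unfold base at hM; omega) ?_
  refine StateSpec.set_seq 6 F.clauses.size (by simp) (fun _ => ?_) ?_
  · unfold base at hM; nlinarith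
  refine StateSpec.set_seq 9 0 rfl (fun _ => by omega) ?_
  refine (StateSpec.loop_count_sure (N := 4 * k + 7)
    (I := fun j s' => ∃ p t q l u cs ds, s' = { s with
      ptr := p, left := j, sat := t, pos := q, lit := l, bad := u } ∧
      F.clauses.toList = cs ++ ds ∧ ds.length = j ∧ p = (clauseCode cs).length + 2 ∧
      (u = 0 → ∀ c ∈ cs, CNF.Clause.eval (s.arr 2) c = true) ∧
      (u ≠ 0 → ∃ c, IsAddr F u c ∧ CNF.Clause.eval (s.arr 2) c = false)) ?_ ?_
      F.clauses.size ?_).conseq le_rfl ?_ (fun _ _ => le_rfl) le_rfl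
  · rintro s' ⟨p, t, q, l, u, cs, ds, rfl, -⟩
    simp [eval_varE, State.var]
  · rintro j s' ⟨p, t, q, l, u, cs, ds, rfl, hcs, hj, hp, h1, h2⟩
    refine ⟨by simp [eval_varE, State.var], ?_⟩
    obtain _ | ⟨c, ds⟩ := ds
    · simp at hj
    have hc : IsAddr F p c := ⟨cs, ds, hcs, hp⟩
    refine (clause_spec hF hM (by exact hc)).conseq le_rfl ?_ (fun _ _ => le_rfl) le_rfl
    rintro s' ⟨t', l', rfl⟩
    refine ⟨_, _, _, _, _, cs ++ [c], ds, rfl, by simp [hcs], by simpa using hj, ?_, ?_, ?_⟩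
    · rw [length_clauseCode_concat]; simp only; omega
    · simp only
      split_ifs with hcc
      · intro hu d hd
        rcases List.mem_append.1 hd with hd | hd
        · exact h1 hu d hd
        · simp only [List.mem_singleton] at hd
          rwa [hd]
      · omega
    · simp only
      split_ifs with hcc
      · exact h2
      · exact fun _ => ⟨c, hc, by simpa using hcc⟩
  · exact ⟨_, _, _, _, _, [], F.clauses.toList, rfl, rfl, hm, by simp [clauseCode]; rfl,
      by simp, by simp⟩
  · rintro s' ⟨p, t, q, l, u, cs, ds, rfl, hcs, hj, hp, h1, h2⟩
    refine ⟨_, _, _, _, _, rfl, fun hu => ?_, h2⟩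
    obtain rfl := List.length_eq_zero_iff.1 hj
    rw [List.append_nil] at hcs
    simp only [solutions, Finset.mem_filter, Finset.mem_univ, true_and, CNF.eval,
      Array.all_eq_true_iff_forall_mem]
    intro c hc
    exact h1 hu c (hcs ▸ Array.mem_toList_iff.2 hc)

end Check

end KSat

/-! ### Schöning's walk and its comparison with a biased walk on ℕ. -/

namespace KSat

open RandRAM Std.Sat
open scoped ENNReal

/-! ### The hitting probabilities of the biased walk -/

/-- The probability that a walk on `ℕ` that steps down with probability `1 / k` and up otherwise
reaches `0` from `d` within `T` steps. -/
noncomputable def hit (k : ℕ) : ℕ → ℕ → ℝ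
  | _, 0 => 1
  | 0, _ + 1 => 0
  | T + 1, d + 1 => 1 / k * hit k T d + (1 - 1 / k) * hit k T (d + 2)

theorem hit_zero (k T : ℕ) : hit k T 0 = 1 := by cases T <;> rfl

theorem hit_zero_succ (k d : ℕ) : hit k 0 (d + 1) = 0 := rfl

theorem hit_succ (k T d : ℕ) :
    hit k (T + 1) (d + 1) = 1 / k * hit k T d + (1 - 1 / k) * hit k T (d + 2) := rfl

theorem one_div_cast_le_one (k : ℕ) : 1 / (k : ℝ) ≤ 1 := by
  rcases Nat.eq_zero_or_pos k with rfl | h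
  · simp
  · rw [div_le_one (by positivity)]; exact_mod_cast h

theorem hit_mem_Icc (k T d : ℕ) : hit k T d ∈ Set.Icc (0 : ℝ) 1 := by
  induction T generalizing d with
  | zero => cases d <;> simp [hit_zero, hit_zero_succ]
  | succ T ih =>
    cases d with
    | zero => simp [hit_zero]
    | succ d =>
      have h0 : 0 ≤ 1 / (k : ℝ) := by positivity
      have h1 := one_div_cast_le_one k
      obtain ⟨a1, a2⟩ := ih d
      obtain ⟨b1, b2⟩ := ih (d + 2)
      rw [hit_succ]
      constructor
      · exact add_nonneg (mul_nonneg h0 a1) (mul_nonneg (by linarith) b1)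
      · nlinarith

theorem hit_succ_le (k T d : ℕ) : hit k T (d + 1) ≤ hit k T d := by
  induction T generalizing d with
  | zero => cases d <;> simp [hit_zero, hit_zero_succ]
  | succ T ih =>
    cases d with
    | zero => rw [hit_zero]; exact (hit_mem_Icc k _ _).2
    | succ d =>
      have h0 : 0 ≤ 1 / (k : ℝ) := by positivity
      have h1 : 0 ≤ 1 - 1 / (k : ℝ) := by linarith [one_div_cast_le_one k]
      rw [hit_succ, hit_succ]
      exact add_le_add (mul_le_mul_of_nonneg_left (ih d) h0)
        (mul_le_mul_of_nonneg_left (ih (d + 2)) h1)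

/-! ### The random walk -/

/-- Changing one bit of an assignment. -/
def flip {n : ℕ} (y : Fin n → Bool) (i : Fin n) : Fin n → Bool := Function.update y i (!y i)

theorem hammingDist_flip_of_ne {n : ℕ} {y w : Fin n → Bool} {i : Fin n} (h : y i ≠ w i) :
    hammingDist (flip y i) w + 1 = hammingDist y w := by
  have h1 : (!y i) = w i := by revert h; cases y i <;> cases w i <;> simp
  have : Finset.univ.filter (fun j => y j ≠ w j) =
      insert i (Finset.univ.filter fun j => flip y i j ≠ w j) := by
    ext j
    rcases eq_or_ne j i with rfl | hj
    · simp [h]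
    · rw [Finset.mem_insert, Finset.mem_filter, Finset.mem_filter, flip,
        Function.update_of_ne hj]
      simp [hj]
  rw [hammingDist, hammingDist, this, Finset.card_insert_of_notMem (by simp [flip, h1])]

theorem hammingDist_flip_of_eq {n : ℕ} {y w : Fin n → Bool} {i : Fin n} (h : y i = w i) :
    hammingDist (flip y i) w = hammingDist y w + 1 := by
  have h1 : flip (flip y i) i = y := by simp [flip]
  have := hammingDist_flip_of_ne (y := flip y i) (w := w) (i := i) (by simp [flip, h])
  rw [h1] at this
  exact this.symm

theorem hammingDist_flip_le {n : ℕ} (y v : Fin n → Bool) (i : Fin n) :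
    hammingDist y v ≤ hammingDist (flip y i) v + 1 := by
  by_cases h : y i = v i
  · rw [hammingDist_flip_of_eq h]; omega
  · rw [hammingDist_flip_of_ne h]

/-- Flipping a random literal of an unsatisfied clause is at least as good as a step of the biased
walk. -/
theorem hit_le_average {n k T : ℕ} {c : CNF.Clause (Fin n)} (hk : c.length ≤ k)
    {y w : Fin n → Bool} (hy : CNF.Clause.eval y c = false) (hw : CNF.Clause.eval w c = true) :
    hit k (T + 1) (hammingDist y w) ≤
      (∑ i : Fin c.length, hit k T (hammingDist (flip y (c.get i).1) w)) / c.length := by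
  obtain ⟨l, hl, hlw⟩ : ∃ l ∈ c, w l.1 = l.2 := by
    simpa [CNF.Clause.eval] using hw
  have hyl : ∀ l ∈ c, y l.1 ≠ l.2 := by
    simpa [CNF.Clause.eval] using hy
  obtain ⟨i, hi⟩ := List.mem_iff_get.1 hl
  have hpos : 0 < c.length := by have := i.2; omega
  obtain ⟨d, hd⟩ : ∃ d, hammingDist y w = d + 1 := by
    refine Nat.exists_eq_succ_of_ne_zero ?_
    rw [Ne, hammingDist_eq_zero]
    rintro rfl
    exact hyl l hl hlw
  -- A flip raises the distance by at most one, and hitting probabilities decrease with the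
  -- distance. One literal, true at `w` and false at `y`, is certain to lower it.
  have hbound : ∀ j : Fin c.length, hit k T (d + 2) ≤ hit k T (hammingDist (flip y (c.get j).1) w) := by
    intro j
    by_cases h : y (c.get j).1 = w (c.get j).1
    · rw [hammingDist_flip_of_eq h, hd]
    · have := hammingDist_flip_of_ne h
      rw [hd] at this
      rw [Nat.add_right_cancel this]
      exact (hit_succ_le _ _ _).trans (hit_succ_le _ _ _)
  have hgood : hit k T (hammingDist (flip y (c.get i).1) w) = hit k T d := by
    have := hammingDist_flip_of_ne (y := y) (w := w) (i := (c.get i).1)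
      (by rw [hi, hlw]; exact hyl l hl)
    rw [hd] at this
    rw [Nat.add_right_cancel this]
  have hsum : hit k T d + (c.length - 1 : ℝ) * hit k T (d + 2) ≤
      ∑ i : Fin c.length, hit k T (hammingDist (flip y (c.get i).1) w) := by
    rw [← Finset.add_sum_erase _ _ (Finset.mem_univ i), hgood]
    gcongr
    refine le_trans (le_of_eq ?_) (Finset.card_nsmul_le_sum _ _ _ fun j _ => hbound j)
    rw [Finset.card_erase_of_mem (Finset.mem_univ i), Finset.card_univ, Fintype.card_fin,
      nsmul_eq_mul, Nat.cast_sub (by omega), Nat.cast_one]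
  have hl0 : (0 : ℝ) < c.length := by exact_mod_cast hpos
  have hlk : (c.length : ℝ) ≤ k := by exact_mod_cast hk
  have hinv : 1 / (k : ℝ) ≤ 1 / c.length := one_div_le_one_div_of_le hl0 hlk
  have hle : hit k T (d + 2) ≤ hit k T d := (hit_succ_le _ _ _).trans (hit_succ_le _ _ _)
  -- Clauses may be shorter than `k`. Since 1/|c| ≥ 1/k, this only shifts weight from `hit k T (d +
  -- 2)` to the larger value `hit k T d`.
  rw [hd, hit_succ, le_div_iff₀ hl0]
  refine le_trans ?_ hsum
  have h1 : 1 ≤ c.length * (1 / (c.length : ℝ)) := by rw [mul_one_div_cancel hl0.ne']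
  have h2 : c.length * (1 / (k : ℝ)) ≤ 1 := by
    rw [mul_one_div, div_le_one (hl0.trans_le hlk)]; exact hlk
  nlinarith [mul_nonneg (sub_nonneg.2 h2) (sub_nonneg.2 hle)]

/-- Flipping a random literal of the clause that was found. -/
def flipProg (k : ℕ) : Prog :=
  .ite (.deref (varE k 9))
    (.seq (.rand (varAddr k 11) (.op .sub (.deref (varE k 9)) (.lit 1))) <|
    .seq (.assign (varAddr k 10)
      (.op .div (.deref (eadd (eadd (varE k 9) (.lit 1)) (varE k 11))) (.lit 2))) <|
    .assign (arrAddr k 2 (varE k 10))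
      (.op .sub (.lit 1) (.deref (arrAddr k 2 (varE k 10)))))
    .skip

/-- One step of the walk. -/
def stepProg (k : ℕ) : Prog :=
  .seq (.assign (varAddr k 4) (.op .sub (varE k 4) (.lit 1))) <|
  .seq (checkProg k) (.ite (varE k 9) (flipProg k) .skip)

/-- The walk. -/
def walkProg (k : ℕ) : Prog :=
  .seq (.assign (varAddr k 4) (eadd (.op .mul (.lit 4) (cell 0)) (.lit 4))) <|
  .loop (varE k 4) (stepProg k)

section Walk

variable {κ M k n : ℕ} {F : Formula n}

theorem flip_spec (hF : IsKCNF k F) (hM : base k F + 1 ≤ M) {s : State n}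
    {c : CNF.Clause (Fin n)} (hc : IsAddr F s.bad c) (hne : c ≠ [])
    (g : (Fin n → Bool) → ℝ≥0∞) :
    StateSpec κ M k F (flipProg k) s 4
      (fun s' => ∃ r l y, s' = { s with rnd := r, lit := l, arr := Function.update s.arr 2 y })
      (fun s' => g (s'.arr 2))
      ((∑ i : Fin c.length, g (flip (s.arr 2) (c.get i).1)) / c.length) := by
  have hlt := hc.add_lt hF
  have hlen : 0 < c.length := List.length_pos_iff.2 hne
  obtain ⟨v, hv⟩ : ∃ v, c.length = v + 1 := ⟨c.length - 1, by omega⟩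
  have hptr := hc.mem_ptr hF
  have ev : (Expr.deref (varE k 9)).eval (s.mem k F) = c.length := by
    simp [eval_varE, State.var, hptr]
  refine StateSpec.ite_true (N := 1 + (1 + 1)) (by rw [ev]; omega) ?_
  refine StateSpec.seq (Q := fun s' => ∃ r < c.length, s' = { s with rnd := r })
    (g := fun s' => if h : s'.rnd < c.length then g (flip (s.arr 2) (c.get ⟨s'.rnd, h⟩).1) else 0)
    (StateSpec.rand (v := v) (by norm_num) ?_ ?_ ?_ ?_) ?_
  · rw [eval_sub, ev, hv]; rfl
  · intro _; unfold base at hM; omega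
  · intro i hi; exact ⟨i, by omega, rfl⟩
  · refine le_of_eq ?_
    rw [show ((v : ℝ≥0∞) + 1) = (c.length : ℝ≥0∞) by rw [hv]; push_cast; rfl, ← hv,
      Finset.sum_range]
    congr 1
    refine Finset.sum_congr rfl fun i _ => ?_
    simp only [State.set]
    rw [dif_pos i.2]
  · rintro s' ⟨r, hr, rfl⟩
    have hlit := fun s => hc.mem_literal hF s r hr
    simp only [dif_pos hr]
    set y := c.get ⟨r, hr⟩ with hy
    have hy1 := y.1.2
    have hy2 := Bool.toNat_le y.2
    have e1 : (2 * (y.1 : ℕ) + y.2.toNat) / 2 = y.1 := by omega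
    have harr := fun s : State n => s.mem_arr (k := k) (F := F) 2 y.1
    simp only [Fin.val_two] at harr
    refine StateSpec.set_seq 10 y.1 ?_ (fun _ => ?_) ?_
    · simp [eval_varE, State.var, hlit, e1]
    · unfold base at hM; omega
    refine StateSpec.setBit (t := 2) (i := y.1) (b := !s.arr 2 y.1) (by omega) rfl ?_ ?_ ?_ ?_
    · simp [eval_varE, State.var, State.set]
    · simp only [eval_sub, eval_lit, eval_deref, eval_arrAddr, eval_varE, State.var, State.set,
        Nat.reduceLT, harr]
      cases s.arr 2 y.1 <;> rfl
    · exact ⟨_, _, _, rfl⟩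
    · simp [State.setBit, State.set, flip]

/-- The parts of the state that a single attempt does not touch. -/
def Keep (s s' : State n) : Prop :=
  s'.num = s.num ∧ s'.cnt = s.cnt ∧ s'.best = s.best ∧ s'.arr 0 = s.arr 0 ∧ s'.arr 1 = s.arr 1

theorem Keep.trans {s s' s'' : State n} (h : Keep s s') (h' : Keep s' s'') : Keep s s'' :=
  ⟨h'.1.trans h.1, h'.2.1.trans h.2.1, h'.2.2.1.trans h.2.2.1, h'.2.2.2.1.trans h.2.2.2.1,
    h'.2.2.2.2.trans h.2.2.2.2⟩

/-- The number of rounds of a step of the walk. -/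
def stepSteps (k m : ℕ) : ℕ := checkSteps k m + 6

theorem step_spec (hF : IsKCNF k F) (hM : base k F + 1 ≤ M) {s : State n}
    {g : (Fin n → Bool) → ℝ≥0∞} {ρ : ℝ≥0∞} (h1 : s.arr 2 ∈ solutions F → ρ ≤ g (s.arr 2))
    (h2 : ∀ c ∈ F.clauses, CNF.Clause.eval (s.arr 2) c = false →
      (c = [] → ρ ≤ g (s.arr 2)) ∧
      (c ≠ [] → ρ ≤ (∑ i : Fin c.length, g (flip (s.arr 2) (c.get i).1)) / c.length)) :
    StateSpec κ M k F (stepProg k) s (stepSteps k F.clauses.size)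
      (fun s' => Keep s s' ∧ s'.steps = s.steps - 1 ∧
        (s.arr 2 ∈ solutions F → s'.arr 2 = s.arr 2))
      (fun s' => g (s'.arr 2)) ρ := by
  refine StateSpec.steps_le (N := 1 + (checkSteps k F.clauses.size + 5)) ?_
    (by unfold stepSteps; omega)
  refine StateSpec.set_seq 4 (s.steps - 1) (by simp [eval_varE, State.var]) (fun hb => ?_) ?_
  · have := hb 4 (by norm_num)
    simp only [State.var] at this
    omega
  refine StateSpec.seq_sure (check_spec hF hM _) ?_
  rintro _ ⟨p, t, j, l, u, rfl, hu1, hu2⟩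
  simp only [State.set] at hu1 hu2 ⊢
  have ev : ∀ s' : State n, (varE k 9).eval (s'.mem k F) = s'.bad := by
    intro s'; simp [eval_varE, State.var]
  by_cases hu : u = 0
  · have hsol := hu1 hu
    refine (StateSpec.ite_false (N := 1) (by rw [ev]; exact hu)
      (StateSpec.skip ?_ ?_)).steps_le (by omega)
    · exact ⟨⟨rfl, rfl, rfl, rfl, rfl⟩, rfl, fun _ => rfl⟩
    · exact h1 hsol
  · obtain ⟨c, hc, hcy⟩ := hu2 hu
    have hns : s.arr 2 ∉ solutions F := by
      simp only [solutions, Finset.mem_filter, Finset.mem_univ, true_and, CNF.eval,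
        Array.all_eq_true_iff_forall_mem]
      intro h
      rw [h c hc.mem] at hcy
      exact absurd hcy (by simp)
    refine StateSpec.ite_true (N := 4) (by rw [ev]; exact hu) ?_
    obtain ⟨h3, h4⟩ := h2 c hc.mem hcy
    by_cases hne : c = []
    · refine (StateSpec.ite_false (N := 1) ?_ (StateSpec.skip ?_ ?_)).steps_le (by omega)
      · rw [eval_deref, ev]; simp only; rw [hc.mem_ptr hF, hne]; rfl
      · exact ⟨⟨rfl, rfl, rfl, rfl, rfl⟩, rfl, fun _ => rfl⟩
      · exact h3 hne
    · refine (flip_spec hF hM (s := { s with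
        steps := s.steps - 1, ptr := p, left := 0, sat := t, pos := j, lit := l, bad := u })
        hc hne g).conseq le_rfl ?_ (fun _ _ => le_rfl) (h4 hne)
      rintro _ ⟨r, l', y, rfl⟩
      refine ⟨⟨rfl, rfl, rfl, ?_, ?_⟩, rfl, fun h => absurd h hns⟩ <;> simp

/-- Solutions are absorbing: the check finds no false clause there and the step does nothing. A
solution reached early is thus still present when the walk stops. -/
theorem walk_sure (hF : IsKCNF k F) (hM : base k F + 1 ≤ M) (s : State n) :
    StateSpec κ M k F (.loop (varE k 4) (stepProg k)) s
      (s.steps * (stepSteps k F.clauses.size + 1) + 1)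
      (fun s' => Keep s s' ∧ (s.arr 2 ∈ solutions F → s'.arr 2 = s.arr 2)) 0 0 := by
  refine (StateSpec.loop_count_sure (N := stepSteps k F.clauses.size)
    (I := fun j s' => Keep s s' ∧ s'.steps = j ∧ (s.arr 2 ∈ solutions F → s'.arr 2 = s.arr 2))
    ?_ ?_ s.steps ?_).conseq le_rfl ?_ (fun _ _ => le_rfl) le_rfl
  · rintro s' ⟨-, h, -⟩
    simp [eval_varE, State.var, h]
  · rintro j s' ⟨h1, h2, h3⟩
    refine ⟨by simp [eval_varE, State.var, h2], ?_⟩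
    refine (step_spec hF hM (g := 0) (ρ := 0) (by simp) (by simp)).conseq le_rfl ?_
      (fun _ _ => le_rfl) le_rfl
    rintro s'' ⟨h4, h5, h6⟩
    exact ⟨h1.trans h4, by omega, fun h => (h6 (by rw [h3 h]; exact h)).trans (h3 h)⟩
  · exact ⟨⟨rfl, rfl, rfl, rfl, rfl⟩, rfl, fun _ => rfl⟩
  · exact fun s' h => ⟨h.1, h.2.2⟩

open Classical in
/-- The indicator of the states in which the walk rests at a good solution. -/
noncomputable def success (F : Formula n) (good : (Fin n → Bool) → Prop) (s : State n) : ℝ≥0∞ :=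
  if s.arr 2 ∈ solutions F ∧ good (s.arr 2) then 1 else 0

/-- Induction on the number `j` of steps the machine still makes, with a budget `T ≤ j` of steps
that the analysis uses. Resting at any solution counts as success if it is good, and every solution
within the remaining budget is good. A flip changes distances by at most one while the budget drops
by one, so this hypothesis is inherited. The solution `w` serves only to bound the probability of
reaching some solution in time. -/
theorem walk_loop_spec (hF : IsKCNF k F) (hM : base k F + 1 ≤ M) {w : Fin n → Bool}
    (hw : w ∈ solutions F) (good : (Fin n → Bool) → Prop) (j T : ℕ) (s : State n)
    (hj : s.steps = j) (hT : T ≤ j)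
    (hgood : ∀ v ∈ solutions F, hammingDist (s.arr 2) v ≤ T → good v) :
    StateSpec κ M k F (.loop (varE k 4) (stepProg k)) s
      (j * (stepSteps k F.clauses.size + 1) + 1) (Keep s) (success F good)
      (ENNReal.ofReal (hit k T (hammingDist (s.arr 2) w))) := by
  induction j generalizing T s with
  | zero =>
    obtain rfl : T = 0 := by omega
    have := walk_sure (κ := κ) hF hM s
    rw [hj] at this
    refine (this.of_sure (f := success F good) (ρ := ENNReal.ofReal _) fun s' hs' => ?_).conseq
      le_rfl (fun s' hs' => hs'.1) (fun _ _ => le_rfl) le_rfl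
    rcases Nat.eq_zero_or_pos (hammingDist (s.arr 2) w) with h | h
    · rw [hammingDist_eq_zero] at h
      have h' := hs'.2 (h ▸ hw)
      rw [success, if_pos ⟨by rw [h', h]; exact hw, hgood _ (by rw [h', h]; exact hw) (by simp [h'])⟩]
      exact ENNReal.ofReal_le_one.2 (hit_mem_Icc _ _ _).2
    · obtain ⟨d, hd⟩ := Nat.exists_eq_succ_of_ne_zero h.ne'
      rw [hd, hit_zero_succ]; simp
  | succ j ih =>
    by_cases hsol : s.arr 2 ∈ solutions F
    · have := walk_sure (κ := κ) hF hM s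
      rw [hj] at this
      refine (this.of_sure (f := success F good) (ρ := ENNReal.ofReal _) fun s' hs' => ?_).conseq
        le_rfl (fun s' hs' => hs'.1) (fun _ _ => le_rfl) le_rfl
      have h' := hs'.2 hsol
      rw [success, h', if_pos ⟨hsol, hgood _ hsol (by simp)⟩]
      exact ENNReal.ofReal_le_one.2 (hit_mem_Icc _ _ _).2
    · rcases Nat.eq_zero_or_pos T with rfl | hT0
      · have := walk_sure (κ := κ) hF hM s
        rw [hj] at this
        refine (this.of_sure (f := success F good) (ρ := ENNReal.ofReal _) fun s' hs' => ?_).conseq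
          le_rfl (fun s' hs' => hs'.1) (fun _ _ => le_rfl) le_rfl
        obtain ⟨d, hd⟩ := Nat.exists_eq_succ_of_ne_zero
          (n := hammingDist (s.arr 2) w) (by rw [Ne, hammingDist_eq_zero]; rintro h; exact hsol (h ▸ hw))
        rw [hd, hit_zero_succ]; simp
      obtain ⟨T, rfl⟩ := Nat.exists_eq_succ_of_ne_zero hT0.ne'
      classical
      -- The bound handed to the next step has to be a function of the position, so the hypothesis
      -- on nearby solutions enters as an indicator.
      obtain ⟨G, hG⟩ : ∃ G : (Fin n → Bool) → ℝ≥0∞, ∀ y, G y =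
          if ∀ v ∈ solutions F, hammingDist y v ≤ T → good v
          then ENNReal.ofReal (hit k T (hammingDist y w)) else 0 := ⟨_, fun _ => rfl⟩
      have hstep := step_spec (κ := κ) hF hM (s := s) (g := G)
        (ρ := ENNReal.ofReal (hit k (T + 1) (hammingDist (s.arr 2) w))) (fun h => absurd h hsol) ?_
      · have hnext : ∀ s', Keep s s' ∧ s'.steps = s.steps - 1 ∧
            (s.arr 2 ∈ solutions F → s'.arr 2 = s.arr 2) →
            StateSpec κ M k F (.loop (varE k 4) (stepProg k)) s'
              (j * (stepSteps k F.clauses.size + 1) + 1) (Keep s) (success F good)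
              (G (s'.arr 2)) := by
          rintro s' ⟨h1, h2, -⟩
          rw [hG]
          split_ifs with h
          · exact (ih T s' (by omega) (by omega) h).conseq le_rfl (fun _ h => h1.trans h)
              (fun _ _ => le_rfl) le_rfl
          · have := walk_sure (κ := κ) hF hM s'
            rw [show s'.steps = j by omega] at this
            exact (this.of_sure (f := success F good) (ρ := 0) fun _ _ => zero_le).conseq
              le_rfl (fun s' hs' => h1.trans hs'.1) (fun _ _ => le_rfl) le_rfl
        have hseq := StateSpec.seq (g := fun s' => G (s'.arr 2)) hstep hnext
        exact (StateSpec.loop_true (by simp [eval_varE, State.var, hj]) hseq).steps_le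
          (by rw [Nat.succ_mul]; omega)
      · intro c hc hcy
        have hcw : CNF.Clause.eval w c = true := by
          simp only [solutions, Finset.mem_filter, Finset.mem_univ, true_and, CNF.eval,
            Array.all_eq_true_iff_forall_mem] at hw
          exact hw c hc
        refine ⟨fun h => by simp [h] at hcw, fun hne => ?_⟩
        have hlen : 0 < c.length := List.length_pos_iff.2 hne
        refine (ENNReal.ofReal_le_ofReal (hit_le_average (hF c hc) hcy hcw)).trans ?_
        rw [ENNReal.ofReal_div_of_pos (by exact_mod_cast hlen), ENNReal.ofReal_natCast,
          ENNReal.ofReal_sum_of_nonneg fun i _ => (hit_mem_Icc _ _ _).1]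
        gcongr with i
        rw [hG, if_pos]
        intro v hv hvy
        exact hgood v hv ((hammingDist_flip_le _ _ (c.get i).1).trans (by omega))

end Walk

end KSat

namespace KSat

open RandRAM Std.Sat
open scoped ENNReal

/-! ### Random perturbations -/

/-- The probability that a bit of the perturbation of `z` with flip probability `t / D` has a given
value. -/
noncomputable def bitWeight (D t : ℕ) (z b : Bool) : ℝ≥0∞ :=
  if b = z then ((D - t : ℕ) : ℝ≥0∞) / D else (t : ℝ≥0∞) / D

/-- The expected value of `G` at the perturbation of `z` with flip probability `t / D`. -/
noncomputable def perturbed {n : ℕ} (D t : ℕ) (z : Fin n → Bool) (G : (Fin n → Bool) → ℝ≥0∞) :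
    ℝ≥0∞ :=
  ∑ y : Fin n → Bool, G y * ∏ i, bitWeight D t (z i) (y i)

/-- The expected value of `G` when the bits from `j` on are still to be perturbed. -/
noncomputable def partiallyPerturbed {n : ℕ} (D t : ℕ) (z : Fin n → Bool)
    (G : (Fin n → Bool) → ℝ≥0∞) (j : ℕ) (x : Fin n → Bool) : ℝ≥0∞ :=
  ∑ y : Fin n → Bool, G y * ∏ i : Fin n,
    if (i : ℕ) < j then (if y i = x i then 1 else 0) else bitWeight D t (z i) (y i)

theorem partiallyPerturbed_zero {n : ℕ} (D t : ℕ) (z : Fin n → Bool)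
    (G : (Fin n → Bool) → ℝ≥0∞) (x : Fin n → Bool) :
    partiallyPerturbed D t z G 0 x = perturbed D t z G := by
  simp [partiallyPerturbed, perturbed]

theorem partiallyPerturbed_top {n : ℕ} (D t : ℕ) (z : Fin n → Bool)
    (G : (Fin n → Bool) → ℝ≥0∞) (x : Fin n → Bool) :
    partiallyPerturbed D t z G n x = G x := by
  rw [partiallyPerturbed, Finset.sum_eq_single x]
  · simp
  · intro y _ hy
    obtain ⟨i, hi⟩ := Function.ne_iff.1 hy
    rw [Finset.prod_eq_zero (Finset.mem_univ i) (by simp [hi]), mul_zero]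
  · simp

/-- Conditioning on the value of bit `i`. This is the recursion that the sampling loop follows, from
`perturbed` at the start to `G x` at the end. -/
theorem partiallyPerturbed_step {n : ℕ} (D t : ℕ) (z : Fin n → Bool)
    (G : (Fin n → Bool) → ℝ≥0∞) (i : Fin n) (x : Fin n → Bool) :
    partiallyPerturbed D t z G i x =
      ((t : ℝ≥0∞) / D) * partiallyPerturbed D t z G (i + 1) (Function.update x i (!z i)) +
      (((D - t : ℕ) : ℝ≥0∞) / D) * partiallyPerturbed D t z G (i + 1) (Function.update x i (z i)) := by
  simp only [partiallyPerturbed, Finset.mul_sum, ← Finset.sum_add_distrib]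
  refine Finset.sum_congr rfl fun y _ => ?_
  have key : ∀ (j : ℕ) (x' : Fin n → Bool), (∀ l, l ≠ i → ((l : ℕ) < j ↔ (l : ℕ) < i)) →
      (∀ l, l ≠ i → x' l = x l) →
      (∏ l : Fin n, if (l : ℕ) < j then (if y l = x' l then (1 : ℝ≥0∞) else 0)
        else bitWeight D t (z l) (y l)) =
      (if (i : ℕ) < j then (if y i = x' i then 1 else 0) else bitWeight D t (z i) (y i)) *
      ∏ l ∈ Finset.univ.erase i, if (l : ℕ) < i then (if y l = x l then 1 else 0)
        else bitWeight D t (z l) (y l) := by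
    intro j x' h1 h2
    rw [← Finset.mul_prod_erase _ _ (Finset.mem_univ i)]
    congr 1
    refine Finset.prod_congr rfl fun l hl => ?_
    have hl' := Finset.ne_of_mem_erase hl
    simp only [h1 l hl', h2 l hl']
  have hne : ∀ l : Fin n, l ≠ i → ((l : ℕ) < i + 1 ↔ (l : ℕ) < i) := by
    intro l hl
    have : (l : ℕ) ≠ i := fun h => hl (Fin.ext h)
    omega
  rw [key _ _ (fun _ _ => Iff.rfl) fun _ _ => rfl,
    key _ _ hne fun l hl => Function.update_of_ne hl _ _,
    key _ _ hne fun l hl => Function.update_of_ne hl _ _]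
  generalize (∏ l ∈ Finset.univ.erase i, if (l : ℕ) < i then (if y l = x l then (1 : ℝ≥0∞) else 0)
        else bitWeight D t (z l) (y l)) = R
  simp only [lt_irrefl, if_false, Nat.lt_succ_self, if_true, Function.update_self, bitWeight]
  by_cases h : y i = z i
  · simp [h]; ring
  · have h' : y i = !z i := by revert h; cases y i <;> cases z i <;> simp
    simp [h']; ring

/-- Running through the indices of the variables. -/
def forProg (k : ℕ) (p : Prog) : Prog :=
  .seq (.assign (varAddr k 3) (.lit 0)) <|
  .loop (.op .lt (varE k 3) (cell 0)) (.seq p (.assign (varAddr k 3) (eadd (varE k 3) (.lit 1))))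

/-- Choosing one bit of the starting point of the walk. -/
def bitProg (k D : ℕ) : Prog :=
  .seq (.rand (varAddr k 11) (.lit (D - 1))) <|
  .assign (arrAddr k 2 (varE k 3))
    (.op .mod (eadd (.deref (arrAddr k 0 (varE k 3))) (.op .lt (varE k 11) (varE k 2))) (.lit 2))

/-- Choosing the starting point of the walk. -/
def sampleProg (k D a b : ℕ) : Prog :=
  .seq (.rand (varAddr k 2) (.lit 1)) <|
  .seq (.assign (varAddr k 2) (eadd (.lit a) (.op .mul (.lit b) (varE k 2)))) <|
  forProg k (bitProg k D)

/-- One attempt to find a good solution. -/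
def attemptProg (k D a b : ℕ) : Prog :=
  .seq (sampleProg k D a b) (.seq (walkProg k) (checkProg k))

section Attempt

variable {κ M k n : ℕ} {F : Formula n}

theorem for_spec (hM : base k F + 1 ≤ M) {p : Prog} {s : State n} {N : ℕ}
    (I : ℕ → State n → Prop) (g : ℕ → State n → ℝ≥0∞) (h0 : I 0 { s with idx := 0 })
    (hg : ∀ j s' x, g j { s' with idx := x } = g j s')
    (hs : ∀ (i : Fin n) s', s'.idx = (i : ℕ) → I i s' →
      StateSpec κ M k F p s' N (fun s'' => s''.idx = (i : ℕ) ∧ I (i + 1) { s'' with idx := i + 1 })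
        (g (i + 1)) (g i s')) :
    StateSpec κ M k F (forProg k p) s (n * (N + 2) + 2) (fun s' => s'.idx = n ∧ I n s') (g n)
      (g 0 s) := by
  have hn : n + 1 ≤ M := by unfold base at hM; omega
  refine StateSpec.steps_le (N := 1 + (n * ((N + 1) + 1) + 1)) ?_ (by ring_nf; omega)
  refine StateSpec.set_seq 3 0 rfl (fun _ => by omega) ?_
  have key := StateSpec.loop_count (κ := κ) (M := M) (k := k) (F := F) (N := N + 1) (s := s.set 3 0)
    (e := .op .lt (varE k 3) (cell 0))
    (p := .seq p (.assign (varAddr k 3) (eadd (varE k 3) (.lit 1))))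
    (I := fun j s' => s'.idx + j = n ∧ I (n - j) s') (g := fun j s' => g (n - j) s') ?_ ?_ n ?_
  · refine key.conseq le_rfl ?_ (fun s' _ => by simp) ?_
    · rintro s' ⟨h1, h2⟩; exact ⟨by omega, by simpa using h2⟩
    · simp only [Nat.sub_self]; exact (hg 0 s 0).ge
  · rintro s' ⟨h1, -⟩
    simp [eval_varE, State.var]; omega
  · rintro j s' ⟨h1, h2⟩
    refine ⟨by simp [eval_varE, State.var]; omega, ?_⟩
    have hi : n - (j + 1) < n := by omega
    have hj : n - (j + 1) + 1 = n - j := by omega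
    have := hs ⟨n - (j + 1), hi⟩ s' (by show s'.idx = n - (j + 1); omega) h2
    simp only [hj] at this
    refine StateSpec.seq this ?_
    rintro s'' ⟨h3, h4⟩
    refine StateSpec.set 3 (n - j) ?_ (fun _ => by omega) ?_ ?_
    · simp [eval_varE, State.var]; omega
    · exact ⟨by simp only [State.set]; omega, h4⟩
    · exact (hg _ _ _).ge
  · exact ⟨by simp [State.set], by rw [Nat.sub_self]; exact h0⟩

theorem for_sure (hM : base k F + 1 ≤ M) {p : Prog} {s : State n} {N : ℕ}
    (I : ℕ → State n → Prop) (h0 : I 0 { s with idx := 0 })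
    (hs : ∀ (i : Fin n) s', s'.idx = (i : ℕ) → I i s' →
      StateSpec κ M k F p s' N (fun s'' => s''.idx = (i : ℕ) ∧ I (i + 1) { s'' with idx := i + 1 })
        0 0) :
    StateSpec κ M k F (forProg k p) s (n * (N + 2) + 2) (fun s' => s'.idx = n ∧ I n s') 0 0 :=
  for_spec hM I (fun _ _ => 0) h0 (fun _ _ _ => rfl) hs

theorem sample_for_spec (hM : base k F + 1 ≤ M) {D : ℕ} (hD : 1 ≤ D) (hDM : D ≤ M) {s : State n}
    (ht : s.thr ≤ D) (G : (Fin n → Bool) → ℝ≥0∞) :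
    StateSpec κ M k F (forProg k (bitProg k D)) s (n * 4 + 2) (Keep s) (fun s' => G (s'.arr 2))
      (perturbed D s.thr (s.arr 0) G) := by
  have hD1 : ((D - 1 : ℕ) : ℝ≥0∞) + 1 = D := by
    rw [← Nat.cast_add_one]; congr 1; omega
  refine (for_spec (N := 2) hM (fun _ s' => Keep s s' ∧ s'.thr = s.thr)
    (fun j s' => partiallyPerturbed D s.thr (s.arr 0) G j (s'.arr 2))
    ⟨⟨rfl, rfl, rfl, rfl, rfl⟩, rfl⟩ (fun _ _ _ => rfl) ?_).conseq le_rfl (fun s' h => h.2.1)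
    (fun s' _ => (partiallyPerturbed_top _ _ _ _ _).le) (partiallyPerturbed_zero _ _ _ _ _).ge
  rintro i s' hi ⟨hk, hthr⟩
  refine StateSpec.seq (N := 1) (N' := 1) (Q := fun s'' => ∃ r < D, s'' = { s' with rnd := r })
    (g := fun s'' => partiallyPerturbed D s.thr (s.arr 0) G (i + 1)
      (Function.update (s'.arr 2) i (if s''.rnd < s.thr then !s.arr 0 i else s.arr 0 i)))
    (StateSpec.rand (v := D - 1) (by norm_num) rfl (fun _ => by omega)
      (fun r hr => ⟨r, by omega, rfl⟩) ?_) ?_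
  · rw [hD1, partiallyPerturbed_step, show D - 1 + 1 = D by omega]
    simp only [State.set, apply_ite (Function.update (s'.arr 2) i),
      apply_ite (partiallyPerturbed D s.thr (s.arr 0) G (i + 1))]
    rw [Finset.sum_ite]
    simp only [Finset.sum_const, nsmul_eq_mul]
    have c1 : ((Finset.range D).filter fun r => r < s.thr) = Finset.range s.thr := by
      ext r; simp; omega
    have c2 : ((Finset.range D).filter fun r => ¬ r < s.thr).card = D - s.thr := by
      have := Finset.card_filter_add_card_filter_not (s := Finset.range D) (fun r => r < s.thr)
      rw [c1, Finset.card_range, Finset.card_range] at this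
      omega
    rw [c1, c2, Finset.card_range, ENNReal.add_div]
    simp only [ENNReal.div_eq_inv_mul]
    refine le_of_eq ?_
    ring
  · rintro s'' ⟨r, hr, rfl⟩
    have harr := fun s : State n => s.mem_arr (k := k) (F := F) 0 i
    simp only [Fin.val_zero] at harr
    refine StateSpec.setBit (t := 2) (i := i) (b := if r < s.thr then !s.arr 0 i else s.arr 0 i)
      (by omega) rfl (by simp [eval_varE, State.var, hi]) ?_ ?_ ?_
    -- Adding the comparison bit modulo 2 flips the bit of the reference point exactly when `r` is
    -- below the threshold.
    · simp only [eval_mod, eval_add, eval_deref, eval_arrAddr, eval_varE, State.var, Nat.reduceLT,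
        hi, harr, eval_lt, eval_lit, hthr, hk.2.2.2.1]
      split_ifs <;> cases s.arr 0 i <;> rfl
    · refine ⟨hi, ⟨⟨hk.1, hk.2.1, hk.2.2.1, ?_, ?_⟩, hthr⟩⟩
      · simpa [State.setBit] using hk.2.2.2.1
      · simpa [State.setBit] using hk.2.2.2.2
    · simp [State.setBit]

/-- The average over the two modes of perturbation. -/
noncomputable def mixture {n : ℕ} (D a b : ℕ) (z : Fin n → Bool) (G : (Fin n → Bool) → ℝ≥0∞) :
    ℝ≥0∞ :=
  (perturbed D a z G + perturbed D (a + b) z G) / 2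

theorem sample_spec (hM : base k F + 1 ≤ M) {D a b : ℕ} (hD : 1 ≤ D) (hDM : D ≤ M)
    (hab : a + b ≤ D) (s : State n) (G : (Fin n → Bool) → ℝ≥0∞) :
    StateSpec κ M k F (sampleProg k D a b) s (n * 4 + 4) (Keep s) (fun s' => G (s'.arr 2))
      (mixture D a b (s.arr 0) G) := by
  refine StateSpec.steps_le (N := 1 + (1 + (n * 4 + 2))) ?_ (by omega)
  refine StateSpec.seq (Q := fun s' => ∃ r ≤ 1, s' = { s with thr := r })
    (g := fun s' => perturbed D (a + b * s'.thr) (s.arr 0) G)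
    (StateSpec.rand (v := 1) (by norm_num) rfl (fun _ => by omega)
      (fun r hr => ⟨r, hr, rfl⟩) ?_) ?_
  · simp [show Finset.range 2 = {0, 1} from rfl, State.set, mixture, one_add_one_eq_two]
  · rintro s' ⟨r, hr, rfl⟩
    have hb : a + b * r ≤ D := by nlinarith
    exact StateSpec.set_seq 2 (a + b * r) (by simp [eval_varE, State.var]) (fun _ => by omega)
      ((sample_for_spec hM hD hDM hb G).conseq le_rfl (fun _ h => h) (fun _ _ => le_rfl) le_rfl)

/-- The number of steps of an attempt. -/
def attemptSteps (k n m : ℕ) : ℕ :=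
  (n * 4 + 4) + ((1 + ((4 * n + 4) * (stepSteps k m + 1) + 1)) + checkSteps k m)

theorem check_keep_spec (hF : IsKCNF k F) (hM : base k F + 1 ≤ M) (s : State n)
    (good : (Fin n → Bool) → Prop) :
    StateSpec κ M k F (checkProg k) s (checkSteps k F.clauses.size)
      (fun s' => Keep s s' ∧ (s'.bad = 0 ↔ s'.arr 2 ∈ solutions F)) (success F good)
      (success F good s) := by
  refine ((check_spec hF hM s).of_sure (f := success F good) ?_).conseq le_rfl ?_
    (fun _ _ => le_rfl) le_rfl
  · rintro _ ⟨p, t, j, l, u, rfl, -⟩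
    rfl
  · rintro _ ⟨p, t, j, l, u, rfl, h1, h2⟩
    refine ⟨⟨rfl, rfl, rfl, rfl, rfl⟩, h1, fun h => ?_⟩
    by_contra hu
    obtain ⟨c, hc, hcy⟩ := h2 hu
    simp only [solutions, Finset.mem_filter, Finset.mem_univ, true_and, CNF.eval,
      Array.all_eq_true_iff_forall_mem] at h
    rw [h c hc.mem] at hcy
    exact absurd hcy (by simp)

theorem attempt_of_walk (hF : IsKCNF k F) (hM : base k F + 1 ≤ M) (hM' : 4 * n + 4 ≤ M) {D a b : ℕ}
    (hD : 1 ≤ D) (hDM : D ≤ M) (hab : a + b ≤ D) (s : State n) (good : (Fin n → Bool) → Prop)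
    (G : (Fin n → Bool) → ℝ≥0∞)
    (hG : ∀ s' : State n, Keep s s' → s'.steps = 4 * n + 4 →
      StateSpec κ M k F (.loop (varE k 4) (stepProg k)) s'
      ((4 * n + 4) * (stepSteps k F.clauses.size + 1) + 1) (Keep s') (success F good)
      (G (s'.arr 2))) :
    StateSpec κ M k F (attemptProg k D a b) s (attemptSteps k n F.clauses.size)
      (fun s' => Keep s s' ∧ (s'.bad = 0 ↔ s'.arr 2 ∈ solutions F)) (success F good)
      (mixture D a b (s.arr 0) G) := by
  refine StateSpec.seq (sample_spec hM hD hDM hab s G) fun s' hs' => ?_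
  refine StateSpec.seq (Q := Keep s) (g := success F good) ?_ fun s'' hs'' =>
    (check_keep_spec hF hM s'' good).conseq le_rfl (fun _ h => ⟨hs''.trans h.1, h.2⟩)
      (fun _ _ => le_rfl) le_rfl
  refine StateSpec.set_seq 4 (4 * n + 4) (by simp) (fun _ => hM') ?_
  exact (hG { s' with steps := 4 * n + 4 } hs' rfl).conseq le_rfl
    (fun _ h => hs'.trans h) (fun _ _ => le_rfl) le_rfl

theorem attempt_sure (hF : IsKCNF k F) (hM : base k F + 1 ≤ M)
    (hM' : 4 * n + 4 ≤ M) {D a b : ℕ}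
    (hD : 1 ≤ D) (hDM : D ≤ M) (hab : a + b ≤ D) (s : State n) :
    StateSpec κ M k F (attemptProg k D a b) s (attemptSteps k n F.clauses.size)
      (fun s' => Keep s s' ∧ (s'.bad = 0 ↔ s'.arr 2 ∈ solutions F)) 0 0 := by
  refine (attempt_of_walk hF hM hM' hD hDM hab s (fun _ => True) 0 fun s' _ hs' => ?_).sure
  have := walk_sure (κ := κ) hF hM s'
  rw [hs'] at this
  exact (this.of_sure (f := success F fun _ => True) (ρ := 0) fun _ _ => zero_le).conseq
    le_rfl (fun s' hs' => hs'.1) (fun _ _ => le_rfl) le_rfl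

/-- `G` is a lower bound, justified by the walk, for the probability to find a good solution. -/
def WalkBound (k : ℕ) (F : Formula n) (good : (Fin n → Bool) → Prop)
    (G : (Fin n → Bool) → ℝ) : Prop :=
  ∃ w ∈ solutions F, ∀ y, G y ≤ 0 ∨ ∃ T ≤ 4 * n + 4,
    (∀ v ∈ solutions F, hammingDist y v ≤ T → good v) ∧ G y ≤ hit k T (hammingDist y w)

theorem attempt_spec (hF : IsKCNF k F) (hM : base k F + 1 ≤ M)
    (hM' : 4 * n + 4 ≤ M) {D a b : ℕ}
    (hD : 1 ≤ D) (hDM : D ≤ M) (hab : a + b ≤ D) (s : State n) {good : (Fin n → Bool) → Prop}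
    {G : (Fin n → Bool) → ℝ} (hG : WalkBound k F good G) :
    StateSpec κ M k F (attemptProg k D a b) s (attemptSteps k n F.clauses.size)
      (fun s' => Keep s s' ∧ (s'.bad = 0 ↔ s'.arr 2 ∈ solutions F)) (success F good)
      (mixture D a b (s.arr 0) fun y => ENNReal.ofReal (G y)) := by
  refine attempt_of_walk hF hM hM' hD hDM hab s good _ fun s' _ hs' => ?_
  obtain ⟨w, hw, hG⟩ := hG
  rcases hG (s'.arr 2) with h | ⟨T, hT, h1, h2⟩
  · have := walk_sure (κ := κ) hF hM s'
    rw [hs'] at this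
    exact (this.of_sure (f := success F good) (ρ := ENNReal.ofReal _) fun _ _ => by
      rw [ENNReal.ofReal_of_nonpos h]; exact zero_le).conseq
      le_rfl (fun s' hs' => hs'.1) (fun _ _ => le_rfl) le_rfl
  · exact (walk_loop_spec hF hM hw good (4 * n + 4) T s' hs' hT h1).conseq le_rfl
      (fun _ h => h) (fun _ _ => le_rfl) (ENNReal.ofReal_le_ofReal h2)

end Attempt

end KSat

namespace RandRAM

open scoped ENNReal

theorem expect_affine {α : Type*} (μ : PMF α) (c d : ℝ≥0∞) (f : α → ℝ≥0∞) :
    expect μ (fun a => c + d * f a) = c + d * expect μ f := by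
  have h : ∀ a, μ a * (c + d * f a) = μ a * c + d * (μ a * f a) := fun a => by ring
  simp only [expect, h, ENNReal.tsum_add, ENNReal.tsum_mul_left, ENNReal.tsum_mul_right,
    μ.tsum_coe, one_mul]

theorem Spec.affine {κ M N : ℕ} {p : Prog} {σ : Mem} {Q : Mem → Prop} {f : Mem → ℝ≥0∞}
    {ρ : ℝ≥0∞} (h : Spec κ M p σ N Q f ρ) (c d : ℝ≥0∞) :
    Spec κ M p σ N Q (fun τ => c + d * f τ) (c + d * ρ) := by
  intro h1 h2
  obtain ⟨μ, h3, h4, h5⟩ := h h1 h2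
  refine ⟨μ, h3, h4, ?_⟩
  rw [expect_affine]
  gcongr

end RandRAM

namespace KSat

open RandRAM Std.Sat
open scoped ENNReal

/-! ### Repeated attempts -/

/-- Copying one assignment to another one. -/
def copyProg (k dst src : ℕ) : Prog :=
  forProg k (.assign (arrAddr k dst (varE k 3)) (.deref (arrAddr k src (varE k 3))))

/-- Computing the distance of the walk from the reference point. -/
def distProg (k : ℕ) : Prog :=
  .seq (.assign (varAddr k 12) (.lit 0)) <|
  forProg k (.assign (varAddr k 12) (eadd (varE k 12) (.op .sub (.lit 1)
    (.op .eq (.deref (arrAddr k 0 (varE k 3))) (.deref (arrAddr k 2 (varE k 3)))))))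

/-- The update after an attempt to find a first solution. -/
def firstUpdate (k : ℕ) : Prog := .ite (varE k 9) .skip (copyProg k 0 2)

/-- The update after an attempt to find a far solution. -/
def farUpdate (k : ℕ) : Prog :=
  .ite (varE k 9) .skip <|
  .seq (distProg k) <|
  .ite (.op .lt (varE k 12) (varE k 13)) .skip <|
  .seq (copyProg k 1 2) (.assign (varAddr k 13) (varE k 12))

/-- One round. -/
def roundProg (k D a b : ℕ) (upd : Prog) : Prog :=
  .seq (.assign (varAddr k 1) (.op .sub (varE k 1) (.lit 1))) <|
  .seq (attemptProg k D a b) upd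

/-- The rounds of one phase. -/
def phaseProg (k D a b : ℕ) (upd : Prog) : Prog :=
  .seq (.assign (varAddr k 1) (varE k 0)) (.loop (varE k 1) (roundProg k D a b upd))

section Phase

variable {κ M k n : ℕ} {F : Formula n}

theorem copy_spec (hM : base k F + 1 ≤ M) (s : State n) (dst src : Fin 3) (hne : dst ≠ src) :
    StateSpec κ M k F (copyProg k dst src) s (n * 3 + 2)
      (fun s' => s' = { s with idx := n, arr := Function.update s.arr dst (s.arr src) }) 0 0 := by
  refine (for_sure (N := 1) hM (fun j s' => s' = { s with
    idx := s'.idx,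
    arr := Function.update s.arr dst fun i => if (i : ℕ) < j then s.arr src i else s.arr dst i })
    ?_ ?_).conseq le_rfl ?_ (fun _ _ => le_rfl) le_rfl
  · simp
  · rintro i s' hi hs'
    have h1 := fun s : State n => s.mem_arr (k := k) (F := F) src i
    have h2 : s'.arr src i = s.arr src i := by rw [hs']; dsimp only; rw [Function.update_of_ne hne.symm]
    refine StateSpec.setBit (t := dst) (i := i) (b := s.arr src i) (by omega) rfl
      (by simp [eval_varE, State.var, hi]) (by simp [eval_varE, State.var, hi, h1, h2])
      ⟨hi, ?_⟩ le_rfl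
    rw [hs']
    simp only [State.setBit, State.mk.injEq, true_and]
    rw [Function.update_self, Function.update_idem]
    congr 1
    funext j
    rcases eq_or_ne j i with rfl | hj
    · simp
    · rw [Function.update_of_ne hj]
      have : (j : ℕ) ≠ i := fun h => hj (Fin.ext h)
      congr 1
      exact propext (by omega)
  · rintro s' ⟨h1, h2⟩
    rw [h2, h1]
    simp

theorem dist_spec (hM : base k F + 1 ≤ M) (s : State n) :
    StateSpec κ M k F (distProg k) s (n * 3 + 3)
      (fun s' => s' = { s with idx := n, dist := hammingDist (s.arr 0) (s.arr 2) }) 0 0 := by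
  refine StateSpec.steps_le (N := 1 + (n * (1 + 2) + 2)) ?_ (by omega)
  refine StateSpec.set_seq 12 0 rfl (fun _ => by omega) ?_
  refine (for_sure (N := 1) hM (fun j s' => s' = { s with
    idx := s'.idx,
    dist := (Finset.univ.filter fun i : Fin n => (i : ℕ) < j ∧ s.arr 0 i ≠ s.arr 2 i).card })
    ?_ ?_).conseq le_rfl ?_ (fun _ _ => le_rfl) le_rfl
  · simp [State.set]
  · rintro i s' hi hs'
    have h1 := fun s : State n => s.mem_arr (k := k) (F := F) 0 i
    have h2 := fun s : State n => s.mem_arr (k := k) (F := F) 2 i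
    simp only [Fin.val_zero, Fin.val_two] at h1 h2
    have e3 : ∀ a b : Bool, (a.toNat = b.toNat) = (a = b) := by decide
    have hcard : (Finset.univ.filter fun j : Fin n =>
          (j : ℕ) < i + 1 ∧ s.arr 0 j ≠ s.arr 2 j).card =
        (Finset.univ.filter fun j : Fin n => (j : ℕ) < i ∧ s.arr 0 j ≠ s.arr 2 j).card +
        (1 - if s.arr 0 i = s.arr 2 i then 1 else 0) := by
      by_cases h : s.arr 0 i = s.arr 2 i
      · rw [if_pos h, Nat.sub_self, add_zero]
        congr 1
        ext j
        simp only [Finset.mem_filter, Finset.mem_univ, true_and]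
        constructor
        · rintro ⟨h1, h2⟩
          have : (j : ℕ) ≠ i := fun h' => h2 (by rw [Fin.ext h']; exact h)
          exact ⟨by omega, h2⟩
        · rintro ⟨h1, h2⟩
          exact ⟨by omega, h2⟩
      · rw [if_neg h, Nat.sub_zero, ← Finset.card_insert_of_notMem (a := i) (by simp)]
        congr 1
        ext j
        simp only [Finset.mem_filter, Finset.mem_univ, true_and, Finset.mem_insert]
        constructor
        · rintro ⟨h1, h2⟩
          by_cases h' : (j : ℕ) = i
          · exact Or.inl (Fin.ext h')
          · exact Or.inr ⟨by omega, h2⟩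
        · rintro (rfl | ⟨h1, h2⟩)
          · exact ⟨by omega, h⟩
          · exact ⟨by omega, h2⟩
    refine StateSpec.set 12 (Finset.univ.filter fun j : Fin n =>
          (j : ℕ) < i + 1 ∧ s.arr 0 j ≠ s.arr 2 j).card ?_ (fun _ => ?_) ⟨hi, ?_⟩ le_rfl
    · rw [hcard]
      simp only [eval_add, eval_sub, eval_eq, eval_varE, State.var, Nat.reduceLT, eval_deref,
        eval_lit, eval_arrAddr, hi, h1, h2, e3]
      rw [hs']
    · refine (Finset.card_le_univ _).trans ?_
      rw [Fintype.card_fin]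
      unfold base at hM; omega
    · rw [hs']; rfl
  · rintro s' ⟨h1, h2⟩
    rw [h2, h1]
    simp [hammingDist]

open Classical in
/-- The indicator function of a set of states. -/
noncomputable def ind (P : State n → Prop) (s : State n) : ℝ≥0∞ := if P s then 1 else 0

theorem ind_le_one (P : State n → Prop) (s : State n) : ind P s ≤ 1 := by
  unfold ind; split_ifs <;> simp

theorem StateSpec.affine {N : ℕ} {p : Prog} {s : State n} {Q : State n → Prop}
    {f : State n → ℝ≥0∞} {ρ : ℝ≥0∞} (h : StateSpec κ M k F p s N Q f ρ) (c d : ℝ≥0∞) :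
    StateSpec κ M k F p s N Q (fun τ => c + d * f τ) (c + d * ρ) :=
  Spec.affine h c d

/-- Independent repetitions of an attempt that succeeds with probability at least `p`. -/
theorem amplify {body : Prog} {N : ℕ} {Inv Goal : State n → Prop} {p : ℝ} (hp0 : 0 ≤ p)
    (hp1 : p ≤ 1)
    (hbody : ∀ s, s.cnt ≠ 0 → Inv s → StateSpec κ M k F body s N
      (fun s' => Inv s' ∧ s'.cnt = s.cnt - 1 ∧ (Goal s → Goal s')) (ind Goal) (ENNReal.ofReal p))
    (s : State n) (hs : Inv s) :
    StateSpec κ M k F (.loop (varE k 1) body) s (s.cnt * (N + 1) + 1) Inv (ind Goal)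
      (ENNReal.ofReal (1 - (1 - p) ^ s.cnt)) := by
  classical
  have hpow : ∀ j : ℕ, (1 - p) ^ j ∈ Set.Icc (0 : ℝ) 1 := fun j =>
    ⟨pow_nonneg (by linarith) _, pow_le_one₀ (by linarith) (by linarith)⟩
  refine (StateSpec.loop_count (N := N) (I := fun j s' => s'.cnt = j ∧ Inv s')
    (g := fun j s' => if Goal s' then 1 else ENNReal.ofReal (1 - (1 - p) ^ j)) ?_ ?_
    s.cnt ⟨rfl, hs⟩).conseq le_rfl (fun _ h => h.2) ?_ ?_
  · rintro s' ⟨h, -⟩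
    simp [eval_varE, State.var, h]
  · rintro j s' ⟨h1, h2⟩
    refine ⟨by simp [eval_varE, State.var, h1], ?_⟩
    have hb := hbody s' (by omega) h2
    by_cases hg : Goal s'
    · simp only [hg, if_true]
      refine (hb.sure.of_sure (f := fun s' => if Goal s' then 1 else _) (ρ := 1)
        fun s'' h => ?_).conseq le_rfl (fun s'' h => ⟨by omega, h.1⟩) (fun _ _ => le_rfl) le_rfl
      rw [if_pos (h.2.2 hg)]
    · simp only [hg, if_false]
      obtain ⟨q0, q1⟩ := hpow j
      -- With q = (1-p)^j, the value that is 1 on the goal and 1-q off it equals (1-q) + q·`ind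
      -- Goal`. One round therefore guarantees 1-q+qp = 1-(1-p)^(j+1).
      refine (hb.affine (ENNReal.ofReal (1 - (1 - p) ^ j)) (ENNReal.ofReal ((1 - p) ^ j))).conseq
        le_rfl (fun s'' h => ⟨by omega, h.1⟩) (fun s'' _ => ?_) ?_
      · unfold ind
        split_ifs
        · rw [mul_one, ← ENNReal.ofReal_add (by linarith) q0]
          simp
        · simp
      · rw [← ENNReal.ofReal_mul q0, ← ENNReal.ofReal_add (by linarith) (mul_nonneg q0 hp0)]
        apply ENNReal.ofReal_le_ofReal
        rw [pow_succ]
        linarith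
  · rintro s' -
    simp [ind]
  · split_ifs
    · exact ENNReal.ofReal_le_one.2 (by linarith [(hpow s.cnt).1])
    · exact le_rfl

/-- The number of steps of a round. -/
def roundSteps (k n m : ℕ) : ℕ := attemptSteps k n m + (n * 6 + 10)

theorem firstUpdate_spec (hM : base k F + 1 ≤ M) {s : State n}
    (hs : s.bad = 0 ↔ s.arr 2 ∈ solutions F) :
    StateSpec κ M k F (firstUpdate k) s (n * 6 + 9)
      (fun s' => s'.num = s.num ∧ s'.cnt = s.cnt ∧ (s.arr 0 ∈ solutions F → s'.arr 0 ∈ solutions F) ∧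
        (s.arr 2 ∈ solutions F → s'.arr 0 ∈ solutions F)) 0 0 := by
  by_cases hb : s.bad = 0
  · refine (StateSpec.ite_false (by simp [eval_varE, State.var, hb])
      (copy_spec hM s 0 2 (by decide))).conseq (by omega) ?_ (fun _ _ => le_rfl) le_rfl
    rintro s' rfl
    have := hs.1 hb
    exact ⟨rfl, rfl, fun _ => by simpa, fun _ => by simpa⟩
  · refine (StateSpec.ite_true (N := 1) (by simp [eval_varE, State.var, hb])
      (StateSpec.skip ?_ le_rfl)).steps_le (by omega)
    exact ⟨rfl, rfl, id, fun h => absurd (hs.2 h) hb⟩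

theorem farUpdate_spec (hM : base k F + 1 ≤ M) {s : State n}
    (hs : s.bad = 0 ↔ s.arr 2 ∈ solutions F) :
    StateSpec κ M k F (farUpdate k) s (n * 6 + 9)
      (fun s' => s'.num = s.num ∧ s'.cnt = s.cnt ∧ s'.arr 0 = s.arr 0 ∧
        ((s'.arr 1 = s.arr 1 ∧ s'.best = s.best ∧
          (s.arr 2 ∈ solutions F → hammingDist (s.arr 0) (s.arr 2) < s.best)) ∨
        (s'.arr 1 = s.arr 2 ∧ s'.best = hammingDist (s.arr 0) (s.arr 2) ∧
          s.arr 2 ∈ solutions F ∧ s.best ≤ hammingDist (s.arr 0) (s.arr 2)))) 0 0 := by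
  have hd : hammingDist (s.arr 0) (s.arr 2) ≤ M := by
    refine hammingDist_le_card_fintype.trans ?_
    rw [Fintype.card_fin]
    unfold base at hM; omega
  by_cases hb : s.bad = 0
  · refine (StateSpec.ite_false (N := n * 3 + 3 + (n * 3 + 2 + 1 + 1))
      (by simp [eval_varE, State.var, hb]) (StateSpec.seq_sure (dist_spec hM s) ?_)).steps_le
      (by omega)
    rintro s' rfl
    by_cases hlt : hammingDist (s.arr 0) (s.arr 2) < s.best
    · refine (StateSpec.ite_true (N := 1) (by simp [eval_varE, State.var, hlt])
        (StateSpec.skip ?_ le_rfl)).steps_le (by omega)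
      exact ⟨rfl, rfl, rfl, Or.inl ⟨rfl, rfl, fun _ => hlt⟩⟩
    · refine StateSpec.ite_false (N := n * 3 + 2 + 1) (by simpa [eval_varE, State.var] using hlt)
        (StateSpec.seq_sure (copy_spec hM _ 1 2 (by decide)) ?_)
      rintro s' rfl
      refine StateSpec.set 13 (hammingDist (s.arr 0) (s.arr 2)) (by simp [eval_varE, State.var])
        (fun _ => hd) ?_ le_rfl
      refine ⟨rfl, rfl, ?_, Or.inr ⟨?_, rfl, hs.1 hb, not_lt.1 hlt⟩⟩
      · simp [State.set]
      · simp [State.set]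
  · refine (StateSpec.ite_true (N := 1) (by simp [eval_varE, State.var, hb])
      (StateSpec.skip ?_ le_rfl)).steps_le (by omega)
    exact ⟨rfl, rfl, rfl, Or.inl ⟨rfl, rfl, fun h => absurd (hs.2 h) hb⟩⟩

/-- Conditions on the memory bound and the sampling parameters. -/
structure Params (k M : ℕ) (F : Formula n) (D a b : ℕ) : Prop where
  base_le : base k F + 1 ≤ M
  steps_le : 4 * n + 4 ≤ M
  one_le : 1 ≤ D
  den_le : D ≤ M
  thr_le : a + b ≤ D

theorem round_of_attempt {D a b : ℕ} {upd : Prog} {s : State n}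
    {Q' : State n → Prop} {f g : State n → ℝ≥0∞} {ρ : ℝ≥0∞}
    (ha : StateSpec κ M k F (attemptProg k D a b) { s with cnt := s.cnt - 1 }
      (attemptSteps k n F.clauses.size) (fun s' => Keep { s with cnt := s.cnt - 1 } s' ∧
        (s'.bad = 0 ↔ s'.arr 2 ∈ solutions F)) g ρ)
    (hu : ∀ s', Keep { s with cnt := s.cnt - 1 } s' ∧ (s'.bad = 0 ↔ s'.arr 2 ∈ solutions F) →
      StateSpec κ M k F upd s' (n * 6 + 9) Q' f (g s')) :
    StateSpec κ M k F (roundProg k D a b upd) s (roundSteps k n F.clauses.size) Q' f ρ := by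
  refine StateSpec.steps_le (N := 1 + (attemptSteps k n F.clauses.size + (n * 6 + 9))) ?_
    (by unfold roundSteps; omega)
  refine StateSpec.set_seq 1 (s.cnt - 1) (by simp [eval_varE, State.var]) (fun hb => ?_)
    (StateSpec.seq ha hu)
  have := hb 1 (by norm_num)
  simp only [State.var] at this
  omega

theorem firstRound_sure (hF : IsKCNF k F) {D a b : ℕ} (hP : Params k M F D a b) (s : State n) :
    StateSpec κ M k F (roundProg k D a b (firstUpdate k)) s (roundSteps k n F.clauses.size)
      (fun s' => s'.num = s.num ∧ s'.cnt = s.cnt - 1 ∧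
        (s.arr 0 ∈ solutions F → s'.arr 0 ∈ solutions F)) 0 0 := by
  refine round_of_attempt (attempt_sure hF hP.base_le hP.steps_le hP.one_le hP.den_le hP.thr_le _)
    fun s' h => (firstUpdate_spec hP.base_le h.2).conseq le_rfl ?_ (fun _ _ => le_rfl) le_rfl
  rintro s'' ⟨h1, h2, h3, -⟩
  exact ⟨h1.trans h.1.1, h2.trans h.1.2.1, fun h' => h3 (by rw [h.1.2.2.2.1]; exact h')⟩

theorem firstRound_spec (hF : IsKCNF k F) {D a b : ℕ} (hP : Params k M F D a b) (s : State n)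
    {good : (Fin n → Bool) → Prop} {G : (Fin n → Bool) → ℝ} (hG : WalkBound k F good G) {p : ℝ}
    (hp : ENNReal.ofReal p ≤ mixture D a b (s.arr 0) fun y => ENNReal.ofReal (G y)) :
    StateSpec κ M k F (roundProg k D a b (firstUpdate k)) s (roundSteps k n F.clauses.size)
      (fun s' => s'.num = s.num ∧ s'.cnt = s.cnt - 1 ∧
        (s.arr 0 ∈ solutions F → s'.arr 0 ∈ solutions F))
      (ind fun s' => s'.arr 0 ∈ solutions F) (ENNReal.ofReal p) := by
  refine round_of_attempt ((attempt_spec hF hP.base_le hP.steps_le hP.one_le hP.den_le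
    hP.thr_le { s with cnt := s.cnt - 1 } hG).conseq le_rfl (fun _ h => h) (fun _ _ => le_rfl) hp)
    fun s' h => ((firstUpdate_spec hP.base_le h.2).of_sure
      (f := ind fun s' => s'.arr 0 ∈ solutions F) (ρ := success F good s') ?_).conseq le_rfl ?_
      (fun _ _ => le_rfl) le_rfl
  · rintro s'' ⟨-, -, -, h4⟩
    unfold success ind
    split_ifs with h5 h6
    · exact le_rfl
    · exact absurd (h4 h5.1) h6
    · exact zero_le
    · exact le_rfl
  rintro s'' ⟨h1, h2, h3, -⟩
  exact ⟨h1.trans h.1.1, h2.trans h.1.2.1, fun h' => h3 (by rw [h.1.2.2.2.1]; exact h')⟩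

/-- The invariant of the second phase. -/
def FarInv (F : Formula n) (z : Fin n → Bool) (s : State n) : Prop :=
  s.arr 0 = z ∧ s.arr 1 ∈ solutions F ∧ s.best = hammingDist z (s.arr 1)

/-- The recorded distance never decreases and, after each round, dominates the distance of the
solution just found, whether or not that solution was kept. -/
theorem farUpdate_inv {z : Fin n → Bool} {s s' : State n} (hs : FarInv F z s)
    {s₁ : State n} (hk : Keep { s with cnt := s.cnt - 1 } s₁)
    (h : s'.num = s₁.num ∧ s'.cnt = s₁.cnt ∧ s'.arr 0 = s₁.arr 0 ∧
        ((s'.arr 1 = s₁.arr 1 ∧ s'.best = s₁.best ∧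
          (s₁.arr 2 ∈ solutions F → hammingDist (s₁.arr 0) (s₁.arr 2) < s₁.best)) ∨
        (s'.arr 1 = s₁.arr 2 ∧ s'.best = hammingDist (s₁.arr 0) (s₁.arr 2) ∧
          s₁.arr 2 ∈ solutions F ∧ s₁.best ≤ hammingDist (s₁.arr 0) (s₁.arr 2)))) :
    FarInv F z s' ∧ s'.cnt = s.cnt - 1 ∧ s.best ≤ s'.best ∧
      (s₁.arr 2 ∈ solutions F → hammingDist z (s₁.arr 2) ≤ s'.best) := by
  obtain ⟨i1, i2, i3⟩ := hs
  obtain ⟨k1, k2, k3, k4, k5⟩ := hk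
  simp only at k1 k2 k3 k4 k5
  obtain ⟨-, h2, h3, ⟨h4, h5, h6⟩ | ⟨h4, h5, h6, h7⟩⟩ := h
  · refine ⟨⟨by rw [h3, k4, i1], by rw [h4, k5]; exact i2, by rw [h5, k3, i3, h4, k5]⟩,
      by rw [h2, k2], by rw [h5, k3], fun h => ?_⟩
    have := h6 h
    rw [k4, i1] at this
    rw [h5]; exact this.le
  · rw [k4, i1] at h5 h7
    refine ⟨⟨by rw [h3, k4, i1], by rw [h4]; exact h6, by rw [h5, h4]⟩, by rw [h2, k2], by omega,
      fun _ => h5.ge⟩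

theorem farRound_sure (hF : IsKCNF k F) {D a b : ℕ} (hP : Params k M F D a b) (s : State n) :
    StateSpec κ M k F (roundProg k D a b (farUpdate k)) s (roundSteps k n F.clauses.size)
      (fun s' => s'.cnt = s.cnt - 1) 0 0 := by
  refine round_of_attempt (attempt_sure hF hP.base_le hP.steps_le hP.one_le hP.den_le hP.thr_le _)
    fun s' h => (farUpdate_spec hP.base_le h.2).conseq le_rfl ?_ (fun _ _ => le_rfl) le_rfl
  rintro s'' ⟨-, h2, -⟩
  exact h2.trans h.1.2.1

theorem farRound_spec (hF : IsKCNF k F) {D a b : ℕ} (hP : Params k M F D a b) (s : State n)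
    {z : Fin n → Bool} (hs : FarInv F z s) {g : ℝ} {G : (Fin n → Bool) → ℝ}
    (hG : WalkBound k F (fun v => g ≤ hammingDist z v) G) {p : ℝ}
    (hp : ENNReal.ofReal p ≤ mixture D a b z fun y => ENNReal.ofReal (G y)) :
    StateSpec κ M k F (roundProg k D a b (farUpdate k)) s (roundSteps k n F.clauses.size)
      (fun s' => FarInv F z s' ∧ s'.cnt = s.cnt - 1 ∧ (g ≤ s.best → g ≤ s'.best))
      (ind fun s' => g ≤ s'.best) (ENNReal.ofReal p) := by
  rw [← hs.1] at hp
  refine round_of_attempt ((attempt_spec hF hP.base_le hP.steps_le hP.one_le hP.den_le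
    hP.thr_le { s with cnt := s.cnt - 1 } hG).conseq le_rfl (fun _ h => h) (fun _ _ => le_rfl) hp)
    fun s' h => ((farUpdate_spec hP.base_le h.2).of_sure
      (f := ind fun s' => g ≤ s'.best) (ρ := success F (fun v => g ≤ hammingDist z v) s') ?_).conseq
      le_rfl ?_ (fun _ _ => le_rfl) le_rfl
  · intro s'' h'
    obtain ⟨-, -, -, h4⟩ := farUpdate_inv hs h.1 h'
    unfold success ind
    split_ifs with h5 h6
    · exact le_rfl
    · exact absurd (h5.2.trans (by exact_mod_cast h4 h5.1)) h6
    · exact zero_le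
    · exact le_rfl
  · intro s'' h'
    obtain ⟨h1, h2, h3, -⟩ := farUpdate_inv hs h.1 h'
    exact ⟨h1, h2, fun h => h.trans (by exact_mod_cast h3)⟩

/-- The number of steps of a phase with `N` rounds. -/
def phaseSteps (k n m N : ℕ) : ℕ := N * (roundSteps k n m + 1) + 2

theorem phase_of_loop {D a b N : ℕ} {upd : Prog} {s : State n} {Q : State n → Prop}
    {f : State n → ℝ≥0∞} {ρ : ℝ≥0∞} (hN : N ≤ M) (hs : s.num = N)
    (h : StateSpec κ M k F (.loop (varE k 1) (roundProg k D a b upd)) { s with cnt := N }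
      (N * (roundSteps k n F.clauses.size + 1) + 1) Q f ρ) :
    StateSpec κ M k F (phaseProg k D a b upd) s (phaseSteps k n F.clauses.size N) Q f ρ := by
  refine StateSpec.steps_le (N := 1 + (N * (roundSteps k n F.clauses.size + 1) + 1)) ?_
    (by unfold phaseSteps; omega)
  exact StateSpec.set_seq 1 N (by simp [eval_varE, State.var, hs]) (fun _ => hN) h

theorem firstPhase_sure (hF : IsKCNF k F) {D a b N : ℕ} (hP : Params k M F D a b) (hN : N ≤ M)
    {s : State n} (hs : s.num = N) :
    StateSpec κ M k F (phaseProg k D a b (firstUpdate k)) s (phaseSteps k n F.clauses.size N)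
      (fun s' => s'.num = N) 0 0 := by
  refine phase_of_loop hN hs ?_
  refine (StateSpec.loop_count_sure (N := roundSteps k n F.clauses.size) (s := { s with cnt := N })
    (I := fun j s' => s'.cnt = j ∧ s'.num = N) ?_ ?_ N ⟨rfl, hs⟩).conseq le_rfl
    (fun _ h => h.2) (fun _ _ => le_rfl) le_rfl
  · rintro s' ⟨h, -⟩
    simp [eval_varE, State.var, h]
  · rintro j s' ⟨h1, h2⟩
    refine ⟨by simp [eval_varE, State.var, h1], (firstRound_sure hF hP s').conseq le_rfl ?_
      (fun _ _ => le_rfl) le_rfl⟩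
    rintro s'' ⟨h3, h4, -⟩
    exact ⟨by omega, by omega⟩

theorem farPhase_sure (hF : IsKCNF k F) {D a b N : ℕ} (hP : Params k M F D a b) (hN : N ≤ M)
    {s : State n} (hs : s.num = N) :
    StateSpec κ M k F (phaseProg k D a b (farUpdate k)) s (phaseSteps k n F.clauses.size N)
      (fun _ => True) 0 0 := by
  refine phase_of_loop hN hs ?_
  refine (StateSpec.loop_count_sure (N := roundSteps k n F.clauses.size) (s := { s with cnt := N })
    (I := fun j s' => s'.cnt = j) ?_ ?_ N rfl).conseq le_rfl
    (fun _ _ => trivial) (fun _ _ => le_rfl) le_rfl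
  · rintro s' h
    simp [eval_varE, State.var, h]
  · rintro j s' h1
    refine ⟨by simp [eval_varE, State.var, h1], (farRound_sure hF hP s').conseq le_rfl ?_
      (fun _ _ => le_rfl) le_rfl⟩
    rintro s'' h3
    omega

/-- Each solution found overwrites the reference point, so the bound for one attempt is needed for
every `z`. Which solutions are good is immaterial here, since any solution ends the phase
successfully. -/
theorem firstPhase_spec (hF : IsKCNF k F) {D a b N : ℕ} (hP : Params k M F D a b) (hN : N ≤ M)
    {s : State n} (hs : s.num = N) {p : ℝ} (hp0 : 0 ≤ p) (hp1 : p ≤ 1)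
    (h : ∀ z, ∃ good G, WalkBound k F good G ∧
      ENNReal.ofReal p ≤ mixture D a b z fun y => ENNReal.ofReal (G y)) :
    StateSpec κ M k F (phaseProg k D a b (firstUpdate k)) s (phaseSteps k n F.clauses.size N)
      (fun s' => s'.num = N) (ind fun s' => s'.arr 0 ∈ solutions F)
      (ENNReal.ofReal (1 - (1 - p) ^ N)) := by
  refine phase_of_loop hN hs ?_
  refine amplify (Inv := fun s' => s'.num = N) hp0 hp1 (fun s' _ hs' => ?_) { s with cnt := N } hs
  obtain ⟨good, G, hG, hz⟩ := h (s'.arr 0)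
  refine (firstRound_spec hF hP s' hG hz).conseq le_rfl ?_ (fun _ _ => le_rfl) le_rfl
  rintro s'' ⟨h1, h2, h3⟩
  exact ⟨by omega, h2, h3⟩

theorem farPhase_spec (hF : IsKCNF k F) {D a b N : ℕ} (hP : Params k M F D a b) (hN : N ≤ M)
    {s : State n} (hs : s.num = N) {p : ℝ} (hp0 : 0 ≤ p) (hp1 : p ≤ 1) {z : Fin n → Bool}
    (hz : FarInv F z s) {g : ℝ} {G : (Fin n → Bool) → ℝ}
    (hG : WalkBound k F (fun v => g ≤ hammingDist z v) G)
    (hp : ENNReal.ofReal p ≤ mixture D a b z fun y => ENNReal.ofReal (G y)) :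
    StateSpec κ M k F (phaseProg k D a b (farUpdate k)) s (phaseSteps k n F.clauses.size N)
      (FarInv F z) (ind fun s' => g ≤ s'.best) (ENNReal.ofReal (1 - (1 - p) ^ N)) :=
  phase_of_loop hN hs <| amplify (Inv := FarInv F z) hp0 hp1
    (fun s' _ hs' => farRound_spec hF hP s' hs' hG hp) { s with cnt := N } hz

end Phase

end KSat

namespace KSat

open RandRAM Std.Sat
open scoped ENNReal

/-! ### The output -/

/-- Writing the first two output cells. -/
def writeProg (x y : ℕ) : Prog := .seq (.assign (.lit 0) (.lit x)) (.assign (.lit 1) (.lit y))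

/-- Writing the output; the cells `0` and `1`, from which all addresses are computed, are
overwritten last. -/
def outputProg (k : ℕ) : Prog :=
  .seq (.assign (varAddr k 3) (.lit 2)) <|
  .seq (.loop (.op .lt (varE k 3) (.op .mul (.lit 2) (cell 0)))
    (.seq (.assign (varE k 3) (.deref (arrAddr k 0 (varE k 3))))
      (.assign (varAddr k 3) (eadd (varE k 3) (.lit 1))))) <|
  .ite (.deref (arrAddr k 0 (.lit 0)))
    (.ite (.deref (arrAddr k 0 (.lit 1))) (writeProg 1 1) (writeProg 1 0))
    (.ite (.deref (arrAddr k 0 (.lit 1))) (writeProg 0 1) (writeProg 0 0))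

section Output

variable {κ M k n : ℕ} {F : Formula n}

/-- The memory after the output cells `2, …, i - 1` have been written. -/
def outMem (k : ℕ) (F : Formula n) (s : State n) (i : ℕ) : Mem := fun a =>
  if 2 ≤ a ∧ a < i then s.mem k F (base k F + 16 + a)
  else if a = base k F + 3 then i else s.mem k F a

theorem write_spec (hM : 1 ≤ M) {x y : ℕ} (hx : x ≤ 1) (hy : y ≤ 1) (σ : Mem) :
    Spec κ M (writeProg x y) σ 2
      (fun τ => τ = Function.update (Function.update σ 0 x) 1 y) 0 0 :=
  Spec.seq_sure (N := 1) (N' := 1) (Q := fun τ => τ = Function.update σ 0 x)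
    (Spec.assign (hx.trans hM) rfl le_rfl)
    (by rintro τ - rfl; exact Spec.assign (hy.trans hM) rfl le_rfl)

/-- The `2 * n` output cells lie below `base`, so the output overwrites parts of the input but none
of the working variables or assignments. All addresses depend only on the cells 0 and 1. Their final
values are held in the branch taken rather than in memory, and so they can be written at the end. -/
theorem output_spec (hM : base k F + 1 ≤ M) (s : State n) :
    Spec κ M (outputProg k) (s.mem k F) (n * 6 + 6)
      (fun τ => readAssignment n 0 τ = s.arr 0 ∧ readAssignment n n τ = s.arr 1) 0 0 := by
  have hb : 2 + 2 * n ≤ base k F := by unfold base; omega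
  have hbase : ∀ i, i ≤ 2 * n + 2 → (baseE k).eval (outMem k F s i) = base k F := by
    intro i hi
    simp [baseE, base, outMem]
  have hidx : ∀ i, i ≤ 2 * n + 2 → (varE k 3).eval (outMem k F s i) = i := by
    intro i hi
    have h0 : ¬ base k F + 3 < i := by omega
    simp [varE, varAddr, hbase i hi, outMem, h0]
  have hcell : ∀ i, i ≤ 2 * n + 2 → outMem k F s i 0 = n := by
    intro i hi
    simp [outMem]
  have harr : ∀ i e, i ≤ 2 * n + 2 → (Expr.deref (arrAddr k 0 e)).eval (outMem k F s i) =
      s.mem k F (base k F + 16 + e.eval (outMem k F s i)) := by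
    intro i e hi
    have h0 : ¬ base k F + 16 + e.eval (outMem k F s i) < i := by omega
    have h1 : ¬ base k F + 16 + e.eval (outMem k F s i) = base k F + 3 := by omega
    simp only [arrAddr, eval_deref, eval_add, hbase i hi, eval_lit, eval_mul, zero_mul, zero_add]
    rw [outMem, if_neg (by omega), if_neg h1]
  have hbit : ∀ q, s.mem k F (base k F + 16 + q) ≤ 1 := by
    intro q
    unfold State.mem
    rw [if_neg (by omega), if_neg (by omega)]
    split_ifs
    · exact Bool.toNat_le _
    · omega
  -- The maximum accounts for `n = 0`, where the index starts beyond the end of the output area.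
  refine Spec.conseq (N := 1 + ((max 2 (2 * n) - 2) * (2 + 1) + 1 + 4)) (Q := _) (f := 0) (ρ := 0) ?_
    (by omega) (fun _ _ h => h) (fun _ _ => le_rfl) le_rfl
  refine Spec.seq_sure (Q := fun τ => τ = outMem k F s 2)
    (Spec.assign (by simp; omega) ?_ le_rfl) ?_
  · funext a
    rw [eval_varAddr, eval_lit]
    rcases eq_or_ne a (base k F + 3) with rfl | h
    · simp [outMem]
    · rw [Function.update_of_ne h, outMem, if_neg (by omega), if_neg h]
  rintro _ - rfl
  refine Spec.seq_sure (Q := fun τ => τ = outMem k F s (max 2 (2 * n))) ?_ ?_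
  · refine (Spec.loop_count_sure (N := 2)
      (I := fun j τ => ∃ i, τ = outMem k F s i ∧ 2 ≤ i ∧ i + j = max 2 (2 * n)) ?_ ?_
      (max 2 (2 * n) - 2) ⟨2, rfl, le_rfl, by omega⟩).conseq le_rfl ?_ (fun _ _ => le_rfl) le_rfl
    · rintro τ - ⟨i, rfl, h2, hi⟩
      simp [hidx i (by omega), hcell i (by omega)]; omega
    · rintro j τ - ⟨i, rfl, h2, hi⟩
      refine ⟨by simp [hidx i (by omega), hcell i (by omega)]; omega, ?_⟩
      refine Spec.seq_sure (N := 1) (N' := 1)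
        (Q := fun τ => τ = Function.update (outMem k F s i) i (s.mem k F (base k F + 16 + i)))
        (Spec.assign ?_ ?_ le_rfl) ?_
      · rw [harr i _ (by omega)]
        exact (hbit _).trans (by omega)
      · rw [harr i _ (by omega), hidx i (by omega)]
      · rintro _ - rfl
        have hb' : (baseE k).eval (Function.update (outMem k F s i) i
            (s.mem k F (base k F + 16 + i))) = base k F := by
          rw [← hbase i (by omega)]
          simp [baseE, Function.update_of_ne (show (0 : ℕ) ≠ i by omega),
            Function.update_of_ne (show (1 : ℕ) ≠ i by omega)]
        have hi' : (varE k 3).eval (Function.update (outMem k F s i) i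
            (s.mem k F (base k F + 16 + i))) = i := by
          simp only [varE, varAddr, eval_deref, eval_add, hb', eval_lit]
          rw [Function.update_of_ne (by omega), outMem, if_neg (by omega), if_pos rfl]
        refine Spec.assign ?_ ⟨i + 1, ?_, by omega, by omega⟩ le_rfl
        · rw [eval_add, hi', eval_lit]; omega
        · rw [eval_add, hi', varAddr, eval_add, hb', eval_lit, eval_lit]
          funext a
          rcases eq_or_ne a (base k F + 3) with rfl | h
          · rw [Function.update_self, outMem, if_neg (by omega), if_pos rfl]
          · rw [Function.update_of_ne h]
            rcases eq_or_ne a i with rfl | h'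
            · rw [Function.update_self, outMem, if_pos (by omega)]
            · rw [Function.update_of_ne h', outMem, outMem]
              simp only [h, if_false]
              congr 1
              exact propext (by omega)
    · rintro τ - ⟨i, rfl, h2, hi⟩
      rw [add_zero] at hi
      rw [hi]
  rintro _ - rfl
  set top := max 2 (2 * n) with htop
  have hfin : ∀ τ : Mem, (∀ a, a < 2 * n → (τ a ≠ 0 ↔ s.mem k F (base k F + 16 + a) ≠ 0)) →
      readAssignment n 0 τ = s.arr 0 ∧ readAssignment n n τ = s.arr 1 := by
    intro τ hτ
    constructor <;> funext i
    · have h1 := hτ (0 * n + i) (by omega)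
      have h2 := s.mem_arr (k := k) (F := F) 0 i
      simp only [Fin.val_zero] at h2
      rw [h2] at h1
      simp only [readAssignment]
      rw [show 0 + (i : ℕ) = 0 * n + i by ring]
      cases h : s.arr 0 i <;> simp [h] at h1 ⊢ <;> exact h1
    · have h1 := hτ (1 * n + i) (by omega)
      have h2 := s.mem_arr (k := k) (F := F) 1 i
      simp only [Fin.val_one] at h2
      rw [h2] at h1
      simp only [readAssignment]
      rw [show n + (i : ℕ) = 1 * n + i by ring]
      cases h : s.arr 1 i <;> simp [h] at h1 ⊢ <;> exact h1
  have hout : ∀ x y, (x ≠ 0 ↔ s.mem k F (base k F + 16 + 0) ≠ 0) →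
      (y ≠ 0 ↔ s.mem k F (base k F + 16 + 1) ≠ 0) →
      ∀ τ, τ = Function.update (Function.update (outMem k F s top) 0 x) 1 y →
      readAssignment n 0 τ = s.arr 0 ∧ readAssignment n n τ = s.arr 1 := by
    rintro x y hx hy τ rfl
    refine hfin _ fun a ha => ?_
    rcases a with _ | _ | a
    · simpa using hx
    · simpa using hy
    · rw [Function.update_of_ne (by omega), Function.update_of_ne (by omega), outMem,
        if_pos (by omega)]
  have e0 := harr top (.lit 0) (by omega)
  have e1 := harr top (.lit 1) (by omega)
  rw [eval_lit] at e0 e1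
  have hw : ∀ x y, x ≤ 1 → y ≤ 1 → (x ≠ 0 ↔ s.mem k F (base k F + 16 + 0) ≠ 0) →
      (y ≠ 0 ↔ s.mem k F (base k F + 16 + 1) ≠ 0) →
      Spec κ M (writeProg x y) (outMem k F s top) 2
      (fun τ => readAssignment n 0 τ = s.arr 0 ∧ readAssignment n n τ = s.arr 1) 0 0 :=
    fun x y hx hy hx' hy' => (write_spec (by omega) hx hy _).conseq le_rfl
      (fun τ _ h => hout x y hx' hy' τ h) (fun _ _ => le_rfl) le_rfl
  by_cases h0 : s.mem k F (base k F + 16 + 0) = 0 <;>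
  by_cases h1 : s.mem k F (base k F + 16 + 1) = 0
  · exact Spec.ite_false (by rw [e0, h0]) (Spec.ite_false (by rw [e1, h1])
      (hw 0 0 (by omega) (by omega) (by simp [h0]) (by simp [h1])))
  · exact Spec.ite_false (by rw [e0, h0]) (Spec.ite_true (by rw [e1]; exact h1)
      (hw 0 1 (by omega) (by omega) (by simp [h0]) (by simp [h1])))
  · exact Spec.ite_true (by rw [e0]; exact h0) (Spec.ite_false (by rw [e1, h1])
      (hw 1 0 (by omega) (by omega) (by simp [h0]) (by simp [h1])))
  · exact Spec.ite_true (by rw [e0]; exact h0) (Spec.ite_true (by rw [e1]; exact h1)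
      (hw 1 1 (by omega) (by omega) (by simp [h0]) (by simp [h1])))

end Output

/-! ### The complete algorithm -/

/-- The expression `(n + 1) ^ e`. -/
def powE : ℕ → Expr
  | 0 => .lit 1
  | e + 1 => .op .mul (powE e) (eadd (cell 0) (.lit 1))

/-- The number of rounds of each phase. -/
def rounds (u v e n : ℕ) : ℕ := (u ^ n / v ^ n + 1) * (n + 1) ^ e

/-- Computing the number of rounds. -/
def initProg (k u v e : ℕ) : Prog :=
  .seq (.assign (varAddr k 11) (.lit 1)) <|
  .seq (.assign (varAddr k 12) (.lit 1)) <|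
  .seq (forProg k (.seq (.assign (varAddr k 11) (.op .mul (varE k 11) (.lit u)))
    (.assign (varAddr k 12) (.op .mul (varE k 12) (.lit v))))) <|
  .assign (varAddr k 0) (.op .mul (eadd (.op .div (varE k 11) (varE k 12)) (.lit 1)) (powE e))

/-- The search for two solutions. -/
def searchProg (k D a b u v e : ℕ) : Prog :=
  .seq (initProg k u v e) <|
  .seq (phaseProg k D a b (firstUpdate k)) <|
  .seq (copyProg k 1 0) <|
  .seq (.assign (varAddr k 13) (.lit 0)) (phaseProg k D a b (farUpdate k))

/-- The whole algorithm. -/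
def mainProg (k D a b u v e : ℕ) : Prog := .seq (searchProg k D a b u v e) (outputProg k)

section Main

variable {κ M k n : ℕ} {F : Formula n}

theorem eval_powE (e : ℕ) (s : State n) : (powE e).eval (s.mem k F) = (n + 1) ^ e := by
  induction e with
  | zero => rfl
  | succ e ih => simp [powE, ih, pow_succ]

theorem init_spec (hM : base k F + 1 ≤ M) {u v e : ℕ} (hu : 1 ≤ u) (hv : 1 ≤ v) (huM : u ^ n ≤ M)
    (hvM : v ^ n ≤ M) (hN : rounds u v e n ≤ M) (s : State n) :
    StateSpec κ M k F (initProg k u v e) s (n * 4 + 5)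
      (fun s' => s'.num = rounds u v e n ∧ s'.arr = s.arr) 0 0 := by
  refine StateSpec.steps_le (N := 1 + (1 + ((n * (2 + 2) + 2) + 1))) ?_ (by omega)
  refine StateSpec.set_seq 11 1 rfl (fun _ => by omega) ?_
  refine StateSpec.set_seq 12 1 rfl (fun _ => by omega) ?_
  refine StateSpec.seq_sure (for_sure (N := 2) hM
    (fun j s' => s'.rnd = u ^ j ∧ s'.dist = v ^ j ∧ s'.arr = s.arr) ?_ ?_) ?_
  · exact ⟨rfl, rfl, rfl⟩
  · rintro i s' hi ⟨h1, h2, h3⟩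
    refine StateSpec.steps_le (N := 1 + 1) ?_ le_rfl
    refine StateSpec.set_seq 11 (u ^ ((i : ℕ) + 1)) ?_ (fun _ => ?_) ?_
    · simp [eval_varE, State.var, h1, pow_succ]
    · exact (Nat.pow_le_pow_right hu (by omega)).trans huM
    refine StateSpec.set 12 (v ^ ((i : ℕ) + 1)) ?_ (fun _ => ?_) ?_ le_rfl
    · simp [eval_varE, State.var, h2, pow_succ, State.set]
    · exact (Nat.pow_le_pow_right hv (by omega)).trans hvM
    · exact ⟨hi, rfl, rfl, h3⟩
  · rintro s' ⟨-, h1, h2, h3⟩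
    refine StateSpec.set 0 (rounds u v e n) ?_ (fun _ => hN) ⟨rfl, h3⟩ le_rfl
    simp [eval_varE, State.var, h1, h2, eval_powE, rounds]

/-- The number of steps of the search. -/
def searchSteps (k n m N : ℕ) : ℕ :=
  (n * 4 + 5) + (phaseSteps k n m N + ((n * 3 + 2) + (1 + phaseSteps k n m N)))

theorem search_sure (hF : IsKCNF k F) {D a b u v e : ℕ} (hP : Params k M F D a b)
    (hu : 1 ≤ u) (hv : 1 ≤ v) (huM : u ^ n ≤ M) (hvM : v ^ n ≤ M) (hN : rounds u v e n ≤ M)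
    (s : State n) :
    StateSpec κ M k F (searchProg k D a b u v e) s
      (searchSteps k n F.clauses.size (rounds u v e n)) (fun _ => True) 0 0 := by
  refine StateSpec.seq_sure (init_spec hP.base_le hu hv huM hvM hN s) ?_
  rintro s₁ ⟨h1, -⟩
  refine StateSpec.seq_sure (firstPhase_sure hF hP hN h1) fun s₂ h2 => ?_
  refine StateSpec.seq_sure (copy_spec hP.base_le s₂ 1 0 (by decide)) ?_
  rintro s₃ rfl
  refine StateSpec.set_seq 13 0 rfl (fun _ => by omega) ?_
  exact farPhase_sure hF hP hN h2

/-- Triangle inequality through `z` for a pair of solutions realising the diameter. This is the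
source of the factor 1/2 in the approximation ratio. -/
theorem exists_far_solution (hsol : (solutions F).Nonempty) (z : Fin n → Bool) :
    ∃ w ∈ solutions F, diam F ≤ 2 * hammingDist z w := by
  obtain ⟨p, hp, hpd⟩ := Finset.exists_mem_eq_sup (solutions F ×ˢ solutions F)
    (hsol.product hsol) fun p => hammingDist p.1 p.2
  rw [Finset.mem_product] at hp
  have hd : diam F = hammingDist p.1 p.2 := hpd
  have ht := hammingDist_triangle_right p.1 p.2 z
  rw [hammingDist_comm p.1 z, hammingDist_comm p.2 z] at ht
  rcases le_total (hammingDist z p.1) (hammingDist z p.2) with h | h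
  · exact ⟨p.2, hp.2, by omega⟩
  · exact ⟨p.1, hp.1, by omega⟩

/-- Each attempt finds with probability at least `p`, whatever the reference point is, a solution
that is far from it, up to a relative loss `δ`. -/
def AttemptBound (k : ℕ) (F : Formula n) (D a b : ℕ) (δ p : ℝ) : Prop :=
  ∀ z, ∀ w ∈ solutions F, ∃ G,
    WalkBound k F (fun v => (1 - δ) * hammingDist z w ≤ hammingDist z v) G ∧
    ENNReal.ofReal p ≤ mixture D a b z fun y => ENNReal.ofReal (G y)

theorem search_spec (hF : IsKCNF k F) {D a b u v e : ℕ} (hP : Params k M F D a b)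
    (hu : 1 ≤ u) (hv : 1 ≤ v) (huM : u ^ n ≤ M) (hvM : v ^ n ≤ M) (hN : rounds u v e n ≤ M)
    (s : State n) (hsol : (solutions F).Nonempty) {δ p : ℝ} (hp0 : 0 ≤ p) (hp1 : p ≤ 1)
    (h : AttemptBound k F D a b δ p) :
    StateSpec κ M k F (searchProg k D a b u v e) s
      (searchSteps k n F.clauses.size (rounds u v e n)) (fun _ => True)
      (ind fun s' => s'.arr 0 ∈ solutions F ∧ s'.arr 1 ∈ solutions F ∧
        1 / 2 * (1 - δ) * (diam F : ℝ) ≤ hammingDist (s'.arr 0) (s'.arr 1))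
      (ENNReal.ofReal ((1 - (1 - p) ^ rounds u v e n) ^ 2)) := by
  classical
  set N := rounds u v e n with hNdef
  have hq : 0 ≤ 1 - (1 - p) ^ N := by
    have := pow_le_one₀ (n := N) (by linarith : 0 ≤ 1 - p) (by linarith)
    linarith
  refine StateSpec.seq_sure (init_spec hP.base_le hu hv huM hvM hN s) ?_
  rintro s₁ ⟨h1, -⟩
  obtain ⟨w₀, hw₀⟩ := hsol
  have hfirst := firstPhase_spec (κ := κ) hF hP hN h1 hp0 hp1 fun z => by
    obtain ⟨G, hG⟩ := h z w₀ hw₀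
    exact ⟨_, G, hG⟩
  -- The payoff of the first phase is scaled by the guarantee of the second one, so that the
  -- sequence rule yields the product of the two bounds.
  have haff := (hfirst.affine 0 (ENNReal.ofReal (1 - (1 - p) ^ N))).conseq le_rfl (fun _ h => h)
    (fun _ _ => le_rfl) (ρ' := ENNReal.ofReal ((1 - (1 - p) ^ N) ^ 2))
    (by rw [zero_add, ← ENNReal.ofReal_mul hq, sq])
  refine StateSpec.seq haff fun s₂ h2 => ?_
  by_cases hz : s₂.arr 0 ∈ solutions F
  · refine StateSpec.seq_sure (copy_spec hP.base_le s₂ 1 0 (by decide)) ?_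
    rintro s₃ rfl
    refine StateSpec.set_seq 13 0 rfl (fun _ => by omega) ?_
    obtain ⟨w, hw, hd⟩ := exists_far_solution ⟨w₀, hw₀⟩ (s₂.arr 0)
    obtain ⟨G, hG, hmix⟩ := h (s₂.arr 0) w hw
    refine (farPhase_spec (z := s₂.arr 0) hF hP hN (by exact h2) hp0 hp1 ?_ hG hmix).conseq le_rfl
      (fun _ _ => trivial) ?_ ?_
    · exact ⟨by simp [State.set], by simpa [State.set] using hz, by simp [State.set]⟩
    · rintro s₄ ⟨i1, i2, i3⟩
      unfold ind
      split_ifs with g1 g2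
      · exact le_rfl
      · refine absurd ⟨by rw [i1]; exact hz, i2, ?_⟩ g2
        rw [i1, ← i3]
        -- For δ > 1 the required distance is not positive, and nothing has to be shown.
        rcases le_total 0 (1 - δ) with h' | h'
        · have hd' : (diam F : ℝ) ≤ 2 * hammingDist (s₂.arr 0) w := by exact_mod_cast hd
          nlinarith [mul_le_mul_of_nonneg_left hd' h']
        · have hdn : (0 : ℝ) ≤ diam F := Nat.cast_nonneg _
          have hbn : (0 : ℝ) ≤ s₄.best := Nat.cast_nonneg _
          nlinarith [mul_nonneg (neg_nonneg.2 h') hdn]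
      · exact zero_le
      · exact le_rfl
    · rw [zero_add]
      exact mul_le_of_le_one_right zero_le (ind_le_one _ _)
  · have : ind (fun s' : State n => s'.arr 0 ∈ solutions F) s₂ = 0 := by simp [ind, hz]
    rw [this, mul_zero, add_zero]
    refine StateSpec.of_sure ?_ fun _ _ => zero_le
    refine StateSpec.seq_sure (copy_spec hP.base_le s₂ 1 0 (by decide)) ?_
    rintro s₃ rfl
    refine StateSpec.set_seq 13 0 rfl (fun _ => by omega) ?_
    exact farPhase_sure hF hP hN h2

/-- The number of steps of the algorithm. -/
def mainSteps (k n m N : ℕ) : ℕ := searchSteps k n m N + (n * 6 + 6)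

theorem main_sure (hF : IsKCNF k F) {D a b u v e : ℕ} (hP : Params k M F D a b)
    (hu : 1 ≤ u) (hv : 1 ≤ v) (huM : u ^ n ≤ M) (hvM : v ^ n ≤ M) (hN : rounds u v e n ≤ M) :
    Spec κ M (mainProg k D a b u v e) (inputMem F)
      (mainSteps k n F.clauses.size (rounds u v e n)) (fun _ => True) 0 0 := by
  rw [← State.mem_init hF]
  refine Spec.seq_sure (search_sure hF hP hu hv huM hvM hN _) ?_
  rintro τ - ⟨s, rfl, -⟩
  exact (output_spec hP.base_le s).conseq le_rfl (fun _ _ _ => trivial) (fun _ _ => le_rfl) le_rfl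

open Classical in
theorem main_spec (hF : IsKCNF k F) {D a b u v e : ℕ} (hP : Params k M F D a b)
    (hu : 1 ≤ u) (hv : 1 ≤ v) (huM : u ^ n ≤ M) (hvM : v ^ n ≤ M) (hN : rounds u v e n ≤ M)
    (hsol : (solutions F).Nonempty) {δ p : ℝ} (hp0 : 0 ≤ p) (hp1 : p ≤ 1)
    (h : AttemptBound k F D a b δ p) :
    Spec κ M (mainProg k D a b u v e) (inputMem F)
      (mainSteps k n F.clauses.size (rounds u v e n)) (fun _ => True)
      (fun τ => if GoodOutput (1 / 2 * (1 - δ)) F τ then 1 else 0)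
      (ENNReal.ofReal ((1 - (1 - p) ^ rounds u v e n) ^ 2)) := by
  rw [← State.mem_init hF]
  refine Spec.seq (search_spec hF hP hu hv huM hvM hN _ hsol hp0 hp1 h) ?_
  rintro τ - ⟨s, rfl, -⟩
  rw [State.read_mem]
  refine Spec.conseq (Spec.of_sure (output_spec hP.base_le s) ?_) le_rfl (fun _ _ _ => trivial)
    (fun _ _ => le_rfl) (le_refl (ind _ s))
  rintro τ ⟨h1, h2⟩
  unfold ind GoodOutput
  rw [h1, h2]

end Main

end KSat

namespace KSat

open RandRAM Std.Sat
open scoped ENNReal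

/-! ### Running time and error of the algorithm -/

theorem mainSteps_le (k n m N : ℕ) (hN : 1 ≤ N) :
    mainSteps k n m N ≤ (40 * k + 240) * (n + m + 1) ^ 2 * N := by
  obtain ⟨X, hX⟩ : ∃ X, X = n + m + 1 := ⟨_, rfl⟩
  have hn : n + 1 ≤ X := by omega
  have hm : m ≤ X := by omega
  have hX1 : X ≤ X ^ 2 := by nlinarith
  have h1 : checkSteps k m ≤ (4 * k + 12) * X := by
    unfold checkSteps; nlinarith [Nat.mul_le_mul_right (4 * k + 8) hm]
  have h2 : stepSteps k m + 1 ≤ (4 * k + 19) * X := by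
    unfold stepSteps; nlinarith
  have h3 : (4 * n + 4) * (stepSteps k m + 1) ≤ (16 * k + 76) * X ^ 2 := by
    calc (4 * n + 4) * (stepSteps k m + 1) ≤ (4 * X) * ((4 * k + 19) * X) :=
          Nat.mul_le_mul (by omega) h2
      _ = _ := by ring
  have h1' : (4 * k + 12) * X ≤ (4 * k + 12) * X ^ 2 := Nat.mul_le_mul_left _ hX1
  have h4 : roundSteps k n m + 1 ≤ (20 * k + 108) * X ^ 2 := by
    unfold roundSteps attemptSteps
    nlinarith
  have h5 : phaseSteps k n m N ≤ (20 * k + 110) * X ^ 2 * N := by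
    unfold phaseSteps
    have := Nat.mul_le_mul_left N h4
    have h6 : 1 ≤ X ^ 2 * N := Nat.mul_pos (by omega) hN
    nlinarith
  have h6 : X ≤ X ^ 2 * N := hX1.trans (Nat.le_mul_of_pos_right _ hN)
  unfold mainSteps searchSteps
  rw [← hX]
  nlinarith

theorem le_rounds (u v e n : ℕ) (hv : 1 ≤ v) :
    ((u : ℝ) / v) ^ n * ((n : ℝ) + 1) ^ e ≤ rounds u v e n := by
  have h : ((u : ℝ) / v) ^ n ≤ ((u ^ n / v ^ n : ℕ) : ℝ) + 1 := by
    rw [div_pow, div_le_iff₀ (by positivity)]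
    have := Nat.lt_div_mul_add (a := u ^ n) (b := v ^ n) (by positivity)
    have h' : u ^ n ≤ (u ^ n / v ^ n + 1) * v ^ n := by rw [Nat.add_mul, one_mul]; omega
    exact_mod_cast h'
  unfold rounds
  push_cast
  gcongr

theorem rounds_le (u v e n : ℕ) (hv : 1 ≤ v) (hu : v ≤ u) :
    (rounds u v e n : ℝ) ≤ 2 * ((u : ℝ) / v) ^ n * ((n : ℝ) + 1) ^ e := by
  have hv' : (0 : ℝ) < v := by exact_mod_cast hv
  have h1 : 1 ≤ ((u : ℝ) / v) ^ n :=
    one_le_pow₀ ((one_le_div hv').2 (by exact_mod_cast hu))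
  have h2 : ((u ^ n / v ^ n : ℕ) : ℝ) ≤ ((u : ℝ) / v) ^ n := by
    rw [div_pow]
    exact_mod_cast Nat.cast_div_le (α := ℝ) (m := u ^ n) (n := v ^ n)
  unfold rounds
  push_cast
  gcongr
  linarith

/-- The bound for the memory cells during a run. -/
theorem exists_memory_bound (k D u v e : ℕ) (hv : 1 ≤ v) (hu : v ≤ u) : ∃ L : ℕ, ∀ (n : ℕ)
    (F : Formula n), ∀ M, M = 2 ^ (L * (n + F.clauses.size + 1)) →
      base k F + 1 ≤ M ∧ 4 * n + 4 ≤ M ∧ D ≤ M ∧ u ^ n ≤ M ∧ v ^ n ≤ M ∧ rounds u v e n ≤ M ∧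
      k + 2 * n + F.clauses.size + 1 ≤ M := by
  refine ⟨k + 10 + D + u + e, fun n F M hM => ?_⟩
  obtain ⟨X, hX⟩ : ∃ X, X = n + F.clauses.size + 1 := ⟨_, rfl⟩
  rw [← hX] at hM
  have hle : ∀ x, x ≤ (k + 10 + D + u + e) * X → 2 ^ x ≤ M := fun x hx =>
    hM ▸ Nat.pow_le_pow_right (by norm_num) hx
  have hlin : (k + 10) * X ≤ M := by
    refine le_trans ?_ (hle ((k + 10) + X) (by nlinarith [Nat.zero_le (k * (X - 1)), show 1 ≤ X by omega]))
    rw [pow_add]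
    exact Nat.mul_le_mul Nat.lt_two_pow_self.le Nat.lt_two_pow_self.le
  have hX1 : 1 ≤ X := by omega
  have hnX : n ≤ X := by omega
  have hun : u ^ n ≤ 2 ^ (u * n) := by
    rw [pow_mul]; exact Nat.pow_le_pow_left Nat.lt_two_pow_self.le _
  have hun' : u * n ≤ u * X := Nat.mul_le_mul_left _ hnX
  have huM : u ^ n ≤ M := hun.trans (hle _ (by nlinarith))
  refine ⟨?_, ?_, ?_, huM, ?_, ?_, ?_⟩
  · refine le_trans ?_ hlin
    unfold base
    have := Nat.mul_le_mul_left k (show F.clauses.size ≤ X by omega)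
    nlinarith
  · exact le_trans (by nlinarith) hlin
  · exact Nat.lt_two_pow_self.le.trans (hle D (by nlinarith))
  · exact (Nat.pow_le_pow_left hu n).trans huM
  · have h1 : u ^ n / v ^ n + 1 ≤ 2 ^ (u * n + 1) := by
      have : u ^ n / v ^ n ≤ u ^ n := Nat.div_le_self _ _
      have h2 : 1 ≤ 2 ^ (u * n) := Nat.one_le_two_pow
      rw [pow_succ]; omega
    have h2 : (n + 1) ^ e ≤ 2 ^ (n * e) := by
      rw [pow_mul]; exact Nat.pow_le_pow_left Nat.lt_two_pow_self _
    unfold rounds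
    refine (Nat.mul_le_mul h1 h2).trans ?_
    rw [← pow_add]
    refine hle _ ?_
    have := Nat.mul_le_mul_right e hnX
    nlinarith
  · exact le_trans (by nlinarith) hlin

/-- The number of rounds has one more factor n+1 than 1/p, so (1-p)^N ≤ exp(-pN) ≤ exp(-(n+1)) for
each phase; squaring the guarantee costs at most twice this error. -/
theorem error_bound {u v e n : ℕ} (hv : 1 ≤ v) (hu : v ≤ u) {p : ℝ}
    (hp : p = 1 / (((u : ℝ) / v) ^ n * ((n : ℝ) + 1) ^ e)) :
    0 ≤ p ∧ p ≤ 1 ∧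
      1 - 2 * Real.exp (-((n : ℝ) + 1)) ≤ (1 - (1 - p) ^ rounds u v (e + 1) n) ^ 2 := by
  have hv' : (0 : ℝ) < v := by exact_mod_cast hv
  have h1 : 1 ≤ ((u : ℝ) / v) ^ n :=
    one_le_pow₀ ((one_le_div hv').2 (by exact_mod_cast hu))
  have hn1 : (1 : ℝ) ≤ (n : ℝ) + 1 := by linarith [Nat.cast_nonneg (α := ℝ) n]
  have h2 : 1 ≤ ((n : ℝ) + 1) ^ e := one_le_pow₀ hn1
  have h3 : 1 ≤ ((u : ℝ) / v) ^ n * ((n : ℝ) + 1) ^ e := one_le_mul_of_one_le_of_one_le h1 h2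
  have hp0 : 0 ≤ p := by rw [hp]; positivity
  have hp1 : p ≤ 1 := by rw [hp, div_le_one (by linarith)]; exact h3
  refine ⟨hp0, hp1, ?_⟩
  have h4 : (n : ℝ) + 1 ≤ p * rounds u v (e + 1) n := by
    have := mul_le_mul_of_nonneg_left (le_rounds u v (e + 1) n hv) hp0
    refine le_trans (le_of_eq ?_) this
    rw [hp, pow_succ]
    field_simp
  have h5 : (1 - p) ^ rounds u v (e + 1) n ≤ Real.exp (-((n : ℝ) + 1)) := by
    calc (1 - p) ^ rounds u v (e + 1) n ≤ (Real.exp (-p)) ^ rounds u v (e + 1) n :=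
          pow_le_pow_left₀ (by linarith) (by linarith [Real.add_one_le_exp (-p)]) _
      _ = Real.exp (rounds u v (e + 1) n * (-p)) := (Real.exp_nat_mul _ _).symm
      _ ≤ _ := Real.exp_le_exp.2 (by linarith)
  nlinarith [sq_nonneg ((1 - p) ^ rounds u v (e + 1) n)]

/-- The analysis of the algorithm: if an attempt succeeds with probability at least `(u / v) ^ -n`
up to a polynomial factor, and `(u / v) ^ n` is at most `T n` up to a polynomial factor, then the
diameter is approximable in time `O*(T)`. -/
theorem hasDiamAlgorithm_of_attemptBound {k : ℕ} {δ : ℝ} {u v D a b : ℕ} (hv : 1 ≤ v) (hu : v ≤ u)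
    (hD : 1 ≤ D) (hab : a + b ≤ D) (e n₀ C d : ℕ) {T : ℕ → ℝ}
    (hT : ∀ n : ℕ, ((u : ℝ) / v) ^ n ≤ C * ((n : ℝ) + 1) ^ d * T n)
    (h : ∀ n : ℕ, n₀ ≤ n → ∀ F : Formula n, IsKCNF k F →
      AttemptBound k F D a b δ (1 / (((u : ℝ) / v) ^ n * ((n : ℝ) + 1) ^ e))) :
    HasDiamAlgorithm k (1 / 2 * (1 - δ)) T := by
  classical
  obtain ⟨c, hc⟩ := (mainProg k D a b u v (e + 1)).exists_costLe
  obtain ⟨L, hL⟩ := exists_memory_bound k D u v (e + 1) hv hu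
  refine ⟨mainProg k D a b u v (e + 1), 2 * C * (40 * k + 240) * (c * (L + 2)), d + (e + 1) + 3,
    -- For small `n` the error 1 makes the success claim void; termination and the time bound are
    -- proved for all `n`.
    fun n => if n < n₀ then 1 else 2 * Real.exp (-((n : ℝ) + 1)), ?_, ?_⟩
  · have h1 : Tendsto (fun n : ℕ => 2 * Real.exp (-((n : ℝ) + 1))) atTop (𝓝 0) := by
      rw [← mul_zero (2 : ℝ)]
      refine Tendsto.const_mul 2 (Real.tendsto_exp_neg_atTop_nhds_zero.comp ?_)
      exact tendsto_atTop_add_const_right _ _ tendsto_natCast_atTop_atTop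
    refine h1.congr' ?_
    filter_upwards [eventually_ge_atTop n₀] with n hn
    rw [if_neg (by omega)]
  · intro n F hF
    obtain ⟨M, hM⟩ : ∃ M, M = 2 ^ (L * (n + F.clauses.size + 1)) := ⟨_, rfl⟩
    obtain ⟨m1, m2, m3, m4, m5, m6, m7⟩ := hL n F M hM
    have hP : Params k M F D a b := ⟨m1, m2, hD, m3, hab⟩
    have hin : ∀ x, inputMem F x ≤ M := fun x => (inputMem_le hF x).trans (by omega)
    set X : ℝ := (n : ℝ) + F.clauses.size + 1 with hX
    have hXn : (n : ℝ) + 1 ≤ X := by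
      have : (0 : ℝ) ≤ F.clauses.size := Nat.cast_nonneg _
      linarith
    have hX1 : 1 ≤ X := by
      have : (0 : ℝ) ≤ n := Nat.cast_nonneg _
      linarith
    have hv' : (0 : ℝ) < v := by exact_mod_cast hv
    have hu' : (0 : ℝ) < u := by exact_mod_cast (by omega : 0 < u)
    have hpos : 0 < (C : ℝ) * ((n : ℝ) + 1) ^ d * T n :=
      lt_of_lt_of_le (by positivity) (hT n)
    have hTpos : 0 ≤ T n := by
      by_contra hneg
      have : (C : ℝ) * ((n : ℝ) + 1) ^ d * T n ≤ 0 :=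
        mul_nonpos_of_nonneg_of_nonpos (by positivity) (by linarith)
      linarith
    have htime : ∀ t : ℕ, t ≤ mainSteps k n F.clauses.size (rounds u v (e + 1) n) *
        (c * (Nat.size M + 1)) → (t : ℝ) ≤ ((2 * C * (40 * k + 240) * (c * (L + 2)) : ℕ) : ℝ) *
          X ^ (d + (e + 1) + 3) * T n := by
      intro t ht
      have hr1 : 1 ≤ rounds u v (e + 1) n := Nat.mul_pos (Nat.succ_pos _) (by positivity)
      have h1 := mainSteps_le k n F.clauses.size _ hr1
      have hsize : Nat.size M + 1 ≤ (L + 2) * (n + F.clauses.size + 1) := by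
        rw [hM, Nat.size_pow]; nlinarith
      have h2 := ht.trans (Nat.mul_le_mul h1 (Nat.mul_le_mul_left c hsize))
      have h3 : (t : ℝ) ≤ (40 * k + 240) * X ^ 2 * rounds u v (e + 1) n * (c * ((L + 2) * X)) := by
        rw [hX]
        exact_mod_cast h2
      have h4 : (rounds u v (e + 1) n : ℝ) ≤ 2 * (C * X ^ d * T n) * X ^ (e + 1) := by
        refine (rounds_le u v (e + 1) n hv hu).trans ?_
        gcongr
        refine (hT n).trans ?_
        gcongr
      calc (t : ℝ) ≤ (40 * k + 240) * X ^ 2 * (2 * (C * X ^ d * T n) * X ^ (e + 1)) *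
            (c * ((L + 2) * X)) := by
              refine h3.trans ?_
              gcongr
        _ = _ := by push_cast; ring
    have hfinal : ∀ μ : PMF Outcome, (∀ o ∈ μ.support,
        o.2 ≤ mainSteps k n F.clauses.size (rounds u v (e + 1) n) * (c * (Nat.size M + 1)) ∧
        (∀ a, o.1 a ≤ M) ∧ True) → ∀ o ∈ μ.support, (o.2 : ℝ) ≤
        ((2 * C * (40 * k + 240) * (c * (L + 2)) : ℕ) : ℝ) * X ^ (d + (e + 1) + 3) * T n :=
      fun μ hμ o ho => htime _ (hμ o ho).1
    by_cases hgood : n < n₀ ∨ ¬ (solutions F).Nonempty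
    · obtain ⟨μ, h1, h2, -⟩ := main_sure (κ := c * (Nat.size M + 1)) hF hP (hv.trans hu) hv m4 m5 m6
        hin (hc M)
      refine ⟨μ, h1, hfinal μ h2, fun hsol => ?_⟩
      rcases hgood with hn | hn
      · simp only [if_pos hn, sub_self]
        exact ENNReal.toReal_nonneg
      · exact absurd hsol hn
    · push Not at hgood
      obtain ⟨hn, hsol⟩ := hgood
      obtain ⟨p, hp⟩ : ∃ p, p = 1 / (((u : ℝ) / v) ^ n * ((n : ℝ) + 1) ^ e) := ⟨_, rfl⟩
      obtain ⟨hp0, hp1, herr⟩ := error_bound hv hu hp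
      have hab := h n hn F hF
      rw [← hp] at hab
      obtain ⟨μ, h1, h2, h3⟩ := main_spec (κ := c * (Nat.size M + 1)) hF hP (hv.trans hu) hv m4 m5 m6
        hsol hp0 hp1 hab hin (hc M)
      refine ⟨μ, h1, hfinal μ h2, fun _ => ?_⟩
      simp only [if_neg (not_lt.2 hn)]
      refine herr.trans ?_
      have h4 : expect μ (fun o => if GoodOutput (1 / 2 * (1 - δ)) F o.1 then (1 : ℝ≥0∞) else 0) =
          μ.toOuterMeasure {o | GoodOutput (1 / 2 * (1 - δ)) F o.1} := by
        rw [PMF.toOuterMeasure_apply, expect]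
        refine tsum_congr fun o => ?_
        simp [Set.indicator]
      rw [h4] at h3
      have hfin : μ.toOuterMeasure {o | GoodOutput (1 / 2 * (1 - δ)) F o.1} ≠ ⊤ := by
        refine ne_top_of_le_ne_top ENNReal.one_ne_top ?_
        rw [← h4]
        refine (expect_mono μ (g := fun _ => 1) fun o _ => ?_).trans (expect_const μ 1).le
        split_ifs <;> simp
      exact (ENNReal.ofReal_le_iff_le_toReal hfin).1 h3

end KSat

/-! ### Probabilistic and combinatorial estimates for a single attempt. -/

namespace KSat

open RandRAM Std.Sat
open scoped ENNReal

/-! ### Bounds for the hitting probabilities -/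

theorem pow_le_hit (k d : ℕ) : (1 / (k : ℝ)) ^ d ≤ hit k d d := by
  induction d with
  | zero => simp [hit_zero]
  | succ d ih =>
    have h0 : 0 ≤ 1 / (k : ℝ) := by positivity
    have h1 : 0 ≤ 1 - 1 / (k : ℝ) := by linarith [one_div_cast_le_one k]
    rw [hit_succ, pow_succ']
    have := mul_nonneg h1 (hit_mem_Icc k d (d + 2)).1
    nlinarith [mul_le_mul_of_nonneg_left ih h0]

theorem hit_mono (k : ℕ) (d : ℕ) : Monotone fun T => hit k T d := by
  refine monotone_nat_of_le_succ fun T => ?_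
  induction T generalizing d with
  | zero =>
    cases d with
    | zero => simp [hit_zero]
    | succ d => rw [hit_zero_succ]; exact (hit_mem_Icc _ _ _).1
  | succ T ih =>
    cases d with
    | zero => simp [hit_zero]
    | succ d =>
      have h0 : 0 ≤ 1 / (k : ℝ) := by positivity
      have h1 : 0 ≤ 1 - 1 / (k : ℝ) := by linarith [one_div_cast_le_one k]
      rw [hit_succ, hit_succ]
      exact add_le_add (mul_le_mul_of_nonneg_left (ih d) h0)
        (mul_le_mul_of_nonneg_left (ih (d + 2)) h1)

/-- The expected duration of the walk that is conditioned on hitting `0`. -/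
theorem sum_one_sub_hit_le {k : ℕ} (hk : 3 ≤ k) (T d : ℕ) :
    ∑ t ∈ Finset.range (T + 1), (1 - ((k : ℝ) - 1) ^ d * hit k t d) ≤
      (k : ℝ) / ((k : ℝ) - 2) * d := by
  have hk' : (3 : ℝ) ≤ k := by exact_mod_cast hk
  induction T generalizing d with
  | zero =>
    cases d with
    | zero => simp [hit_zero]
    | succ d =>
      have h1 : 1 ≤ (k : ℝ) / ((k : ℝ) - 2) := by
        rw [le_div_iff₀ (by linarith)]; linarith
      have h2 : (1 : ℝ) ≤ ((d + 1 : ℕ) : ℝ) := by push_cast; linarith [Nat.cast_nonneg (α := ℝ) d]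
      simp only [zero_add, Finset.sum_range_one, hit_zero_succ, mul_zero, sub_zero]
      nlinarith
  | succ T ih =>
    cases d with
    | zero => simp [hit_zero]
    | succ d =>
      rw [Finset.sum_range_succ']
      -- Multiplication by (k-1)^d exchanges the two step probabilities: the product is the
      -- probability of having hit 0 for the walk that steps down with probability (k-1)/k. Its
      -- drift (k-2)/k explains the expected duration kd/(k-2), and the sum is one of tail
      -- probabilities.
      have hstep : ∀ t, (1 - ((k : ℝ) - 1) ^ (d + 1) * hit k (t + 1) (d + 1)) =
          ((k : ℝ) - 1) / k * (1 - ((k : ℝ) - 1) ^ d * hit k t d) +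
          1 / k * (1 - ((k : ℝ) - 1) ^ (d + 2) * hit k t (d + 2)) := by
        intro t
        rw [hit_succ]
        field_simp
        ring
      simp only [hstep, Finset.sum_add_distrib, ← Finset.mul_sum, hit_zero_succ, mul_zero, sub_zero]
      have h1 := mul_le_mul_of_nonneg_left (ih d)
        (div_nonneg (by linarith) (by linarith) : 0 ≤ ((k : ℝ) - 1) / k)
      have h2 := mul_le_mul_of_nonneg_left (ih (d + 2)) (by positivity : 0 ≤ 1 / (k : ℝ))
      refine (add_le_add (add_le_add h1 h2) le_rfl).trans (le_of_eq ?_)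
      have h3 : (k : ℝ) - 2 ≠ 0 := by linarith
      push_cast
      field_simp
      ring

/-- Markov's inequality for the duration of the conditioned walk: the tail probabilities decrease in
`t`, so T+1 times the last one is at most their sum. -/
theorem le_hit {k : ℕ} (hk : 3 ≤ k) (T d : ℕ) :
    (1 / ((k : ℝ) - 1)) ^ d * (1 - (k : ℝ) / ((k : ℝ) - 2) * d / (T + 1)) ≤ hit k T d := by
  have hk' : (3 : ℝ) ≤ k := by exact_mod_cast hk
  have hq : 0 < ((k : ℝ) - 1) ^ d := pow_pos (by linarith) _
  have hT : (0 : ℝ) < (T : ℝ) + 1 := by positivity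
  have h1 : ((T : ℝ) + 1) * (1 - ((k : ℝ) - 1) ^ d * hit k T d) ≤ (k : ℝ) / ((k : ℝ) - 2) * d := by
    refine le_trans ?_ (sum_one_sub_hit_le hk T d)
    have : ∑ t ∈ Finset.range (T + 1), (1 - ((k : ℝ) - 1) ^ d * hit k T d) ≤
        ∑ t ∈ Finset.range (T + 1), (1 - ((k : ℝ) - 1) ^ d * hit k t d) := by
      refine Finset.sum_le_sum fun t ht => ?_
      have := hit_mono k d (Nat.lt_succ_iff.1 (Finset.mem_range.1 ht))
      have := mul_le_mul_of_nonneg_left this hq.le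
      simp only at this
      linarith
    rw [Finset.sum_const, Finset.card_range, nsmul_eq_mul] at this
    push_cast at this
    exact this
  have h2 : 1 - (k : ℝ) / ((k : ℝ) - 2) * d / (T + 1) ≤ ((k : ℝ) - 1) ^ d * hit k T d := by
    rw [sub_le_comm, le_div_iff₀ hT]
    linarith
  rw [one_div, inv_pow, inv_mul_le_iff₀ hq]
  exact h2

/-! ### The probability of a perturbation -/

theorem perturbed_ofReal {n D t : ℕ} (hD : 1 ≤ D) (ht : t ≤ D) (z : Fin n → Bool)
    {G : (Fin n → Bool) → ℝ} (hG : ∀ y, 0 ≤ G y) :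
    perturbed D t z (fun y => ENNReal.ofReal (G y)) = ENNReal.ofReal
      (∑ y : Fin n → Bool, G y * ∏ i, if y i = z i then 1 - (t : ℝ) / D else (t : ℝ) / D) := by
  have hD' : (0 : ℝ) < D := by exact_mod_cast hD
  have ht' : (t : ℝ) ≤ D := by exact_mod_cast ht
  have h0 : 0 ≤ (t : ℝ) / D := by positivity
  have h1 : 0 ≤ 1 - (t : ℝ) / D := by rw [sub_nonneg, div_le_one hD']; exact ht'
  have hw : ∀ z b, bitWeight D t z b =
      ENNReal.ofReal (if b = z then 1 - (t : ℝ) / D else (t : ℝ) / D) := by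
    intro z b
    unfold bitWeight
    split_ifs
    · rw [show 1 - (t : ℝ) / D = ((D - t : ℕ) : ℝ) / D by
        rw [Nat.cast_sub ht]; field_simp, ENNReal.ofReal_div_of_pos hD', ENNReal.ofReal_natCast,
        ENNReal.ofReal_natCast]
    · rw [ENNReal.ofReal_div_of_pos hD', ENNReal.ofReal_natCast, ENNReal.ofReal_natCast]
  have hp : ∀ y : Fin n → Bool, ∀ i, 0 ≤ if y i = z i then 1 - (t : ℝ) / D else (t : ℝ) / D := by
    intro y i; split_ifs <;> assumption
  rw [perturbed, ENNReal.ofReal_sum_of_nonneg fun y _ =>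
    mul_nonneg (hG y) (Finset.prod_nonneg fun i _ => hp y i)]
  refine Finset.sum_congr rfl fun y _ => ?_
  rw [ENNReal.ofReal_mul (hG y), ENNReal.ofReal_prod_of_nonneg fun i _ => hp y i]
  simp only [hw]

theorem half_perturbed_le_mixture_left {n : ℕ} (D a b : ℕ) (z : Fin n → Bool)
    (G : (Fin n → Bool) → ℝ≥0∞) : perturbed D a z G / 2 ≤ mixture D a b z G := by
  unfold mixture
  gcongr
  exact le_self_add

theorem half_perturbed_le_mixture_right {n : ℕ} (D a b : ℕ) (z : Fin n → Bool)
    (G : (Fin n → Bool) → ℝ≥0∞) : perturbed D (a + b) z G / 2 ≤ mixture D a b z G := by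
  unfold mixture
  gcongr
  exact le_add_self

/-- In the second mode each bit is flipped with probability 1/2, so the starting point is uniform
whatever `z` is. The additional factor 1/2 is the probability of choosing this mode. -/
theorem ofReal_le_mixture_uniform {n D a b : ℕ} (hD : 1 ≤ D) (hab : 2 * (a + b) = D)
    (z : Fin n → Bool) {G : (Fin n → Bool) → ℝ} (hG : ∀ y, 0 ≤ G y) {p : ℝ}
    (hp : p ≤ 1 / 2 * (1 / 2) ^ n * ∑ y, G y) :
    ENNReal.ofReal p ≤ mixture D a b z fun y => ENNReal.ofReal (G y) := by
  refine le_trans ?_ (half_perturbed_le_mixture_right D a b z _)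
  have h2 : ((a + b : ℕ) : ℝ) / D = 1 / 2 := by
    rw [← hab]
    have : ((a + b : ℕ) : ℝ) ≠ 0 := by
      have : 0 < a + b := by omega
      exact_mod_cast this.ne'
    push_cast at *
    field_simp
  rw [perturbed_ofReal hD (by omega) z hG, h2, ← ENNReal.ofReal_ofNat,
    ← ENNReal.ofReal_div_of_pos (by norm_num)]
  apply ENNReal.ofReal_le_ofReal
  refine hp.trans (le_of_eq ?_)
  have : ∀ y : Fin n → Bool, (∏ i, if y i = z i then (1 : ℝ) - 1 / 2 else 1 / 2) = (1 / 2) ^ n := by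
    intro y
    rw [Finset.prod_congr rfl fun i _ => show (if y i = z i then (1 : ℝ) - 1 / 2 else 1 / 2) = 1 / 2 by
      split_ifs <;> norm_num]
    simp
  simp only [this, ← Finset.sum_mul]
  ring

/-! ### Starting points at a given distance from a solution -/

/-- The assignment `w` with the bits in `S` flipped. -/
def flipSet {n : ℕ} (w : Fin n → Bool) (S : Finset (Fin n)) : Fin n → Bool :=
  fun i => if i ∈ S then !w i else w i

theorem flipSet_ne_iff {n : ℕ} (w : Fin n → Bool) (S : Finset (Fin n)) (i : Fin n) :
    flipSet w S i ≠ w i ↔ i ∈ S := by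
  unfold flipSet; split_ifs with h <;> simp [h]

theorem flipSet_injective {n : ℕ} (w : Fin n → Bool) : Function.Injective (flipSet w) := by
  intro S S' h
  ext i
  rw [← flipSet_ne_iff w S, ← flipSet_ne_iff w S', h]

theorem hammingDist_flipSet {n : ℕ} (w : Fin n → Bool) (S : Finset (Fin n)) :
    hammingDist (flipSet w S) w = S.card := by
  unfold hammingDist
  congr 1
  ext i
  simp only [Finset.mem_filter, Finset.mem_univ, true_and]
  exact flipSet_ne_iff w S i

/-- The set of coordinates in which two assignments differ. -/
def diffSet {n : ℕ} (z w : Fin n → Bool) : Finset (Fin n) := Finset.univ.filter fun i => z i ≠ w i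

theorem card_diffSet {n : ℕ} (z w : Fin n → Bool) : (diffSet z w).card = hammingDist z w := rfl

theorem hammingDist_flipSet_add {n : ℕ} (z w : Fin n → Bool) (S : Finset (Fin n)) :
    hammingDist z (flipSet w S) + 2 * (S ∩ diffSet z w).card = hammingDist z w + S.card := by
  have h1 : hammingDist z (flipSet w S) = (symmDiff S (diffSet z w)).card := by
    unfold hammingDist
    congr 1
    ext i
    rw [Finset.mem_symmDiff, diffSet, Finset.mem_filter, Finset.mem_filter]
    unfold flipSet
    by_cases h : i ∈ S <;> by_cases h' : z i = w i <;> simp [h, h']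
  have h2 := Finset.card_sdiff_add_card_inter S (diffSet z w)
  have h3 := Finset.card_sdiff_add_card_inter (diffSet z w) S
  rw [Finset.inter_comm] at h3
  have h4 : (symmDiff S (diffSet z w)).card = (S \ diffSet z w).card + (diffSet z w \ S).card := by
    rw [symmDiff_def]
    exact Finset.card_union_of_disjoint disjoint_sdiff_sdiff
  have h5 := card_diffSet z w
  omega

/-- Double counting: each coordinate belongs to the fraction R/n of all sets of size R. The sets
containing it are counted through those avoiding it. -/
theorem sum_card_inter {n R : ℕ} (hR : R ≤ n) (A : Finset (Fin n)) :
    n * ∑ S ∈ Finset.powersetCard R (Finset.univ : Finset (Fin n)), (S ∩ A).card =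
      A.card * (R * n.choose R) := by
  rcases n with _ | n
  · have : A = ∅ := Finset.eq_empty_of_isEmpty A
    simp [this]
  have hcount : ∀ i : Fin (n + 1), ((Finset.powersetCard R (Finset.univ : Finset (Fin (n + 1)))).filter
      fun S => i ∈ S).card + n.choose R = (n + 1).choose R := by
    intro i
    have h1 := Finset.card_filter_add_card_filter_not
      (s := Finset.powersetCard R (Finset.univ : Finset (Fin (n + 1)))) (fun S => i ∈ S)
    have h2 : (Finset.powersetCard R (Finset.univ : Finset (Fin (n + 1)))).filter (fun S => i ∉ S) =
        Finset.powersetCard R (Finset.univ.erase i) := by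
      ext S
      simp only [Finset.mem_filter, Finset.mem_powersetCard, Finset.subset_univ, true_and,
        Finset.subset_erase]
      tauto
    rw [h2, Finset.card_powersetCard, Finset.card_powersetCard,
      Finset.card_erase_of_mem (Finset.mem_univ i), Finset.card_univ, Fintype.card_fin] at h1
    exact h1
  have hsum : ∑ S ∈ Finset.powersetCard R (Finset.univ : Finset (Fin (n + 1))), (S ∩ A).card =
      ∑ i ∈ A, ((Finset.powersetCard R (Finset.univ : Finset (Fin (n + 1)))).filter
        fun S => i ∈ S).card := by
    simp only [Finset.card_filter, Finset.inter_comm _ A, Finset.card_eq_sum_ones (A ∩ _)]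
    rw [Finset.sum_comm]
    refine Finset.sum_congr rfl fun S _ => ?_
    rw [← Finset.card_eq_sum_ones, ← Finset.card_filter, Finset.filter_mem_eq_inter]
  have hone : ∀ i, (n + 1) * ((Finset.powersetCard R (Finset.univ : Finset (Fin (n + 1)))).filter
      fun S => i ∈ S).card = R * (n + 1).choose R := by
    intro i
    have h1 := hcount i
    have h2 := Nat.choose_mul_succ_eq n R
    zify [hR] at h1 h2 ⊢
    nlinarith
  rw [hsum, Finset.mul_sum, Finset.sum_congr rfl fun i _ => hone i]
  simp

/-- Most sets of size `R` meet a given set in not many more points than expected. -/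
theorem card_few_le {n R : ℕ} (hR : R ≤ n) (A : Finset (Fin n)) {l θ : ℝ} (hl : 0 ≤ l)
    (hn : 0 < n) (h : (R : ℝ) * A.card ≤ θ * (n * l)) (hθ : 0 ≤ θ) :
    (1 - θ) * n.choose R ≤ ((Finset.powersetCard R (Finset.univ : Finset (Fin n))).filter
      fun S => ((S ∩ A).card : ℝ) ≤ l).card := by
  set P := Finset.powersetCard R (Finset.univ : Finset (Fin n))
  have hP : P.card = n.choose R := by simp [P]
  have hn' : (0 : ℝ) < n := by exact_mod_cast hn
  have h1 : ((P.filter fun S => ((S ∩ A).card : ℝ) ≤ l).card : ℝ) +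
      (P.filter fun S => ¬ ((S ∩ A).card : ℝ) ≤ l).card = n.choose R := by
    rw [← hP]
    exact_mod_cast Finset.card_filter_add_card_filter_not (s := P) _
  have hsum : (n : ℝ) * ∑ S ∈ P, ((S ∩ A).card : ℝ) = A.card * (R * n.choose R) := by
    exact_mod_cast sum_card_inter hR A
  set b : ℝ := ((P.filter fun S => ¬ ((S ∩ A).card : ℝ) ≤ l).card : ℝ) with hb
  have h2 : b * l ≤ ∑ S ∈ P, ((S ∩ A).card : ℝ) := by
    rw [hb, ← nsmul_eq_mul]
    refine (Finset.card_nsmul_le_sum _ _ _ fun S hS => ?_).trans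
      (Finset.sum_le_sum_of_subset_of_nonneg (Finset.filter_subset _ P) fun _ _ _ => Nat.cast_nonneg _)
    exact (not_le.1 (Finset.mem_filter.1 hS).2).le
  have hc : (0 : ℝ) ≤ n.choose R := Nat.cast_nonneg _
  have h3 : n * (b * l) ≤ n * (θ * l * n.choose R) := by
    refine (mul_le_mul_of_nonneg_left h2 hn'.le).trans ?_
    rw [hsum]
    nlinarith [mul_le_mul_of_nonneg_right h hc]
  have h4 := le_of_mul_le_mul_left h3 hn'
  -- Markov's inequality needs l > 0. For l = 0 the hypothesis forces R|A| = 0, and all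
  -- intersections are empty.
  rcases hl.eq_or_lt with rfl | hl
  · have hzero : ∑ S ∈ P, ((S ∩ A).card : ℝ) = 0 := by
      have h5 : (R : ℝ) * A.card = 0 := le_antisymm (by simpa using h) (by positivity)
      have h6 : (n : ℝ) * ∑ S ∈ P, ((S ∩ A).card : ℝ) = 0 := by
        rw [hsum, ← mul_assoc, mul_comm (A.card : ℝ), h5, zero_mul]
      exact (mul_eq_zero.1 h6).resolve_left hn'.ne'
    have h6 := (Finset.sum_eq_zero_iff_of_nonneg fun S _ => Nat.cast_nonneg _).1 hzero
    have hb0 : b = 0 := by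
      rw [hb, Nat.cast_eq_zero, Finset.card_eq_zero, Finset.filter_eq_empty_iff]
      intro S hS
      rw [not_not, h6 S hS]
    nlinarith
  · have h5 : b ≤ θ * n.choose R := by
      have : b * l ≤ (θ * n.choose R) * l := by linarith
      exact le_of_mul_le_mul_right this hl
    linarith

/-! ### Lower bounds for the success of an attempt -/

section Attempt

variable {n k D a b : ℕ} {F : Formula n} {δ : ℝ}

/-- Starting points at distance `R` from the solution `w`. -/
theorem exists_walkBound_of_sets {z w : Fin n → Bool} (hw : w ∈ solutions F) {R T : ℕ}
    (hT : T ≤ 4 * n + 4) {h : ℝ} (h0 : 0 ≤ h) (hh : h ≤ hit k T R)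
    {good : (Fin n → Bool) → Prop} (A : Finset (Finset (Fin n))) (hA : ∀ S ∈ A, S.card = R)
    (hgood : ∀ S ∈ A, ∀ v, hammingDist (flipSet w S) v ≤ T → good v) (hD : 1 ≤ D)
    (hab : 2 * (a + b) = D) {p : ℝ} (hp : p ≤ 1 / 2 * (1 / 2) ^ n * (A.card * h)) :
    ∃ G, WalkBound k F good G ∧ ENNReal.ofReal p ≤ mixture D a b z fun y => ENNReal.ofReal (G y) := by
  classical
  refine ⟨fun y => if y ∈ A.image (flipSet w) then h else 0, ⟨w, hw, fun y => ?_⟩,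
    ofReal_le_mixture_uniform hD hab z (fun y => by split_ifs <;> simp [h0]) (hp.trans ?_)⟩
  · simp only
    split_ifs with hy
    · obtain ⟨S, hS, rfl⟩ := Finset.mem_image.1 hy
      refine Or.inr ⟨T, hT, fun v _ hv => hgood S hS v hv, ?_⟩
      rw [hammingDist_flipSet, hA S hS]
      exact hh
    · exact Or.inl le_rfl
  · rw [← Finset.sum_filter, Finset.sum_const, nsmul_eq_mul]
    have : (Finset.univ.filter fun y => y ∈ A.image (flipSet w)).card = A.card := by
      rw [Finset.filter_mem_eq_inter, Finset.univ_inter,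
        Finset.card_image_of_injective _ (flipSet_injective w)]
    rw [this]

/-- A start that meets the differing coordinates in at most `l` points has distance at least
d(z,w)+R-2l from `z`. A solution within `T` of it keeps at least d(z,w)+R-2l-T, and `hδ` makes this
at least (1-δ)d(z,w). -/
theorem exists_walkBound_of_few {z w : Fin n → Bool} (hw : w ∈ solutions F) {R T : ℕ} (hR : R ≤ n)
    (hn : 0 < n) (hT : T ≤ 4 * n + 4) {h : ℝ} (h0 : 0 ≤ h) (hh : h ≤ hit k T R) {l θ : ℝ}
    (hl : 0 ≤ l) (hθ : 0 ≤ θ) (hRl : (R : ℝ) * hammingDist z w ≤ θ * (n * l))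
    (hδ : 2 * l + T ≤ R + δ * hammingDist z w) (hD : 1 ≤ D)
    (hab : 2 * (a + b) = D) {p : ℝ}
    (hp : p ≤ 1 / 2 * (1 / 2) ^ n * ((1 - θ) * n.choose R * h)) :
    ∃ G, WalkBound k F (fun v => (1 - δ) * hammingDist z w ≤ hammingDist z v) G ∧
      ENNReal.ofReal p ≤ mixture D a b z fun y => ENNReal.ofReal (G y) := by
  refine exists_walkBound_of_sets hw hT h0 hh
    ((Finset.powersetCard R (Finset.univ : Finset (Fin n))).filter
      fun S => ((S ∩ diffSet z w).card : ℝ) ≤ l) (fun S hS => ?_) (fun S hS v hv => ?_) hD hab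
      (hp.trans ?_)
  · exact (Finset.mem_powersetCard.1 (Finset.mem_filter.1 hS).1).2
  · have hcard := (Finset.mem_powersetCard.1 (Finset.mem_filter.1 hS).1).2
    have hinter := (Finset.mem_filter.1 hS).2
    have h1 := hammingDist_flipSet_add z w S
    have h2 := hammingDist_triangle z v (flipSet w S)
    rw [hammingDist_comm v] at h2
    have h1' : (hammingDist z (flipSet w S) : ℝ) + 2 * (S ∩ diffSet z w).card =
        hammingDist z w + R := by rw [← hcard]; exact_mod_cast h1
    have h2' : (hammingDist z (flipSet w S) : ℝ) ≤ hammingDist z v + T := by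
      exact_mod_cast h2.trans (by omega)
    linarith
  · have := card_few_le hR (diffSet z w) hl hn hRl hθ
    gcongr

/-- Attempts with starting points at distance `R` from the solution and shortest possible walks. -/
theorem attemptBound_of_shortest (hδ : 0 ≤ δ) {R : ℕ} (hR : R ≤ n) (hn : 0 < n) {θ : ℝ}
    (hθ : 0 ≤ θ) (hRδ : 2 * (R : ℝ) ≤ θ * δ * n) (hD : 1 ≤ D) (hab : 2 * (a + b) = D) {p : ℝ}
    (hp : p ≤ 1 / 2 * (1 / 2) ^ n * ((1 - θ) * n.choose R * (1 / (k : ℝ)) ^ R)) :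
    AttemptBound k F D a b δ p := by
  intro z w hw
  have hr : (0 : ℝ) ≤ hammingDist z w := Nat.cast_nonneg _
  -- With T = R the radius cancels from the loss, so all of δd(z,w) can be spent on the
  -- intersection.
  refine exists_walkBound_of_few hw hR hn (T := R) (by omega) (by positivity) (pow_le_hit k R)
    (l := δ * hammingDist z w / 2) (by positivity) hθ ?_ (by linarith) hD hab hp
  nlinarith [mul_le_mul_of_nonneg_right hRδ hr]

/-- The length of the walk from distance `R` that is needed. -/
theorem exists_walk_length (hk : 3 ≤ k) {R : ℕ} (hR : R ≤ n) : ∃ T : ℕ, T ≤ 4 * n + 4 ∧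
    (T : ℝ) ≤ R + 2 / ((k : ℝ) - 2) * R + 1 ∧
    (1 / ((k : ℝ) - 1)) ^ R * (1 / (4 * ((n : ℝ) + 1))) ≤ hit k T R := by
  have hk' : (3 : ℝ) ≤ k := by exact_mod_cast hk
  have hR' : (R : ℝ) ≤ n := by exact_mod_cast hR
  have hR0 : (0 : ℝ) ≤ R := Nat.cast_nonneg _
  have hκ : (k : ℝ) / ((k : ℝ) - 2) = 1 + 2 / ((k : ℝ) - 2) := by
    have : (k : ℝ) - 2 ≠ 0 := by linarith
    field_simp; ring
  have h2 : 2 / ((k : ℝ) - 2) ≤ 2 := by rw [div_le_iff₀ (by linarith)]; linarith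
  have h2' : 0 ≤ 2 / ((k : ℝ) - 2) := div_nonneg (by norm_num) (by linarith)
  set x : ℝ := (k : ℝ) / ((k : ℝ) - 2) * R with hx
  have hx0 : 0 ≤ x := by rw [hx, hκ]; positivity
  have hx3 : x ≤ 3 * n := by rw [hx, hκ]; nlinarith
  have hf := Nat.floor_le hx0
  have hf' := Nat.lt_floor_add_one x
  -- With x the expected duration, T + 1 exceeds x by more than 1, so `le_hit` retains a factor at
  -- least 1/(T+1); and T + 1 ≤ 3n+2.
  refine ⟨⌊x⌋₊ + 1, ?_, ?_, le_trans ?_ (le_hit hk _ _)⟩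
  · have : ((⌊x⌋₊ + 1 : ℕ) : ℝ) ≤ ((4 * n + 4 : ℕ) : ℝ) := by push_cast; linarith
    exact_mod_cast this
  · push_cast
    rw [hx, hκ] at hf
    rw [hx, hκ]
    linarith
  · refine mul_le_mul_of_nonneg_left ?_ (pow_nonneg (div_nonneg zero_le_one (by linarith)) _)
    push_cast
    rw [← hx, le_sub_iff_add_le, div_add_div _ _ (by positivity) (by positivity),
      div_le_one (by positivity)]
    nlinarith

/-- Attempts with starting points at distance `R` from a solution that is not too close. -/
theorem exists_walkBound_of_far (hk : 3 ≤ k) {z w : Fin n → Bool} (hw : w ∈ solutions F) {R : ℕ}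
    (hR : R ≤ n) (hn : 0 < n) {θ : ℝ} (hθ : 0 ≤ θ)
    (hl : 0 ≤ δ * hammingDist z w - 2 / ((k : ℝ) - 2) * R - 1)
    (hRδ : 2 * ((R : ℝ) * hammingDist z w) ≤
      θ * (n * (δ * hammingDist z w - 2 / ((k : ℝ) - 2) * R - 1)))
    (hD : 1 ≤ D) (hab : 2 * (a + b) = D) {p : ℝ}
    (hp : p ≤ 1 / 2 * (1 / 2) ^ n * ((1 - θ) * n.choose R *
      ((1 / ((k : ℝ) - 1)) ^ R * (1 / (4 * ((n : ℝ) + 1)))))) :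
    ∃ G, WalkBound k F (fun v => (1 - δ) * hammingDist z w ≤ hammingDist z v) G ∧
      ENNReal.ofReal p ≤ mixture D a b z fun y => ENNReal.ofReal (G y) := by
  have hk' : (3 : ℝ) ≤ k := by exact_mod_cast hk
  obtain ⟨T, hT1, hT2, hT3⟩ := exists_walk_length hk hR
  have hq : 0 ≤ 1 / ((k : ℝ) - 1) := div_nonneg zero_le_one (by linarith)
  exact exists_walkBound_of_few hw hR hn hT1 (mul_nonneg (pow_nonneg hq _) (by positivity)) hT3
    (l := (δ * hammingDist z w - 2 / ((k : ℝ) - 2) * R - 1) / 2) (by linarith) hθ (by linarith)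
    (by linarith) hD hab hp

/-- If the allowed loss is total, every solution is good. -/
theorem attemptBound_of_one_le (hk : 3 ≤ k) (hδ : 1 ≤ δ) {R : ℕ} (hR : R ≤ n)
    (hD : 1 ≤ D) (hab : 2 * (a + b) = D) {p : ℝ}
    (hp : p ≤ 1 / 2 * (1 / 2) ^ n * (n.choose R *
      ((1 / ((k : ℝ) - 1)) ^ R * (1 / (4 * ((n : ℝ) + 1)))))) :
    AttemptBound k F D a b δ p := by
  intro z w hw
  have hk' : (3 : ℝ) ≤ k := by exact_mod_cast hk
  obtain ⟨T, hT1, hT2, hT3⟩ := exists_walk_length hk hR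
  have hq : 0 ≤ 1 / ((k : ℝ) - 1) := div_nonneg zero_le_one (by linarith)
  refine exists_walkBound_of_sets hw hT1 (mul_nonneg (pow_nonneg hq _) (by positivity)) hT3
    (Finset.powersetCard R (Finset.univ : Finset (Fin n)))
    (fun S hS => (Finset.mem_powersetCard.1 hS).2) (fun S hS v hv => ?_) hD hab (by simpa using hp)
  have h1 : (0 : ℝ) ≤ hammingDist z w := Nat.cast_nonneg _
  have h2 : (0 : ℝ) ≤ hammingDist z v := Nat.cast_nonneg _
  nlinarith

/-- Attempts with starting points beyond the solution `w`, as seen from `z`. -/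
theorem exists_walkBound_of_near (hδ : 0 ≤ δ) {z w : Fin n → Bool} (hw : w ∈ solutions F)
    (hD : 1 ≤ D) (haD : a ≤ D) {p : ℝ}
    (hp : p ≤ 1 / 2 * (((a : ℝ) / D) ^ hammingDist z w *
      (1 - (a : ℝ) / D + (a : ℝ) / D * (1 / k)) ^ (n - hammingDist z w))) :
    ∃ G, WalkBound k F (fun v => (1 - δ) * hammingDist z w ≤ hammingDist z v) G ∧
      ENNReal.ofReal p ≤ mixture D a b z fun y => ENNReal.ofReal (G y) := by
  classical
  set t : ℝ := (a : ℝ) / D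
  -- The product over the coordinates vanishes unless `y` agrees with `w` wherever `z` and `w`
  -- differ; otherwise it is k^(-d(y,w)), the bound for a walk straight back to `w`.
  set f : Fin n → Bool → ℝ := fun i c =>
    if c = w i then 1 else if z i = w i then 1 / (k : ℝ) else 0 with hf
  have hf0 : ∀ i c, 0 ≤ f i c := by
    intro i c; simp only [hf]; split_ifs <;> positivity
  refine ⟨fun y => ∏ i, f i (y i), ⟨w, hw, fun y => ?_⟩, ?_⟩
  · by_cases hy : ∀ i, z i ≠ w i → y i = w i
    · refine Or.inr ⟨hammingDist y w, ?_, fun v _ hv => ?_, ?_⟩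
      · have := hammingDist_le_card_fintype (x := y) (y := w)
        rw [Fintype.card_fin] at this
        omega
      -- Such a `y` lies beyond `w` as seen from `z`, so walking back at most d(y,w) steps cannot
      -- end closer to `z` than `w` is.
      · have h1 : hammingDist z y = hammingDist z w + hammingDist y w := by
          unfold hammingDist
          rw [← Finset.card_union_of_disjoint]
          · congr 1
            ext i
            simp only [Finset.mem_filter, Finset.mem_univ, true_and, Finset.mem_union]
            by_cases h : z i = w i
            · simp [h, eq_comm]
            · simp [h, hy i h]
          · rw [Finset.disjoint_filter]
            intro i _ h h'
            exact h' (hy i h)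
        have h2 := hammingDist_triangle z v y
        rw [hammingDist_comm v y] at h2
        have h3 : (hammingDist z w : ℝ) ≤ hammingDist z v := by
          exact_mod_cast (by omega : hammingDist z w ≤ hammingDist z v)
        have h4 : (0 : ℝ) ≤ hammingDist z w := Nat.cast_nonneg _
        nlinarith
      · refine le_trans (le_of_eq ?_) (pow_le_hit k (hammingDist y w))
        have : ∀ i, f i (y i) = if y i ≠ w i then 1 / (k : ℝ) else 1 := by
          intro i
          simp only [hf]
          by_cases h : y i = w i
          · simp [h]
          · have h' : z i = w i := by by_contra h'; exact h (hy i h')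
            simp [h, h']
        simp only [this]
        rw [← Finset.prod_filter, Finset.prod_const]
        rfl
    · push Not at hy
      obtain ⟨i, h1, h2⟩ := hy
      exact Or.inl (Finset.prod_eq_zero (Finset.mem_univ i) (by simp [hf, h1, h2])).le
  · refine le_trans ?_ (half_perturbed_le_mixture_left D a b z _)
    rw [perturbed_ofReal hD haD z fun y => Finset.prod_nonneg fun i _ => hf0 i (y i),
      ← ENNReal.ofReal_ofNat, ← ENNReal.ofReal_div_of_pos (by norm_num)]
    apply ENNReal.ofReal_le_ofReal
    refine hp.trans (le_of_eq ?_)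
    rw [mul_comm, mul_one_div]
    congr 1
    simp only [← Finset.prod_mul_distrib]
    -- The expectation factorises: a coordinate where `z` and `w` differ contributes t, any other
    -- one 1-t+t/k.
    have h1 := Finset.prod_univ_sum (fun _ : Fin n => (Finset.univ : Finset Bool))
      fun i c => f i c * if c = z i then 1 - t else t
    rw [Fintype.piFinset_univ] at h1
    rw [← h1]
    have h2 : ∀ i, (∑ c : Bool, f i c * if c = z i then 1 - t else t) =
        if z i ≠ w i then t else 1 - t + t * (1 / k) := by
      intro i
      simp only [hf, Fintype.sum_bool]
      cases z i <;> cases w i <;> simp <;> ring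
    simp only [h2]
    rw [Finset.prod_ite, Finset.prod_const, Finset.prod_const]
    have h3 : (Finset.univ.filter fun i => ¬ z i ≠ w i).card = n - hammingDist z w := by
      have := Finset.card_filter_add_card_filter_not (s := Finset.univ) (fun i : Fin n => z i ≠ w i)
      rw [Finset.card_univ, Fintype.card_fin] at this
      unfold hammingDist
      omega
    rw [h3]
    rfl

end Attempt

end KSat

/-! ### Choice of radius and rational base, and comparison with the time bounds. -/

namespace KSat

open RandRAM Std.Sat
open scoped ENNReal

/-! ### Exponential bases -/

/-- `B ^ n` is a lower bound for `2 ^ n * K ^ R / n.choose R` whenever `R ≤ c * n`. -/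
def IsBaseBound (K c B : ℝ) : Prop :=
  ∀ n R : ℕ, R ≤ n → (R : ℝ) ≤ c * n → B ^ n * n.choose R ≤ 2 ^ n * K ^ R

theorem choose_mul_pow_le {x : ℝ} (hx : 0 ≤ x) {n R : ℕ} (hR : R ≤ n) :
    (n.choose R : ℝ) * x ^ R ≤ (1 + x) ^ n := by
  rw [add_comm, add_pow]
  refine le_trans (le_of_eq ?_) (Finset.single_le_sum (f := fun i => x ^ i * 1 ^ (n - i) *
    (n.choose i : ℝ)) (fun i _ => by positivity) (Finset.mem_range.2 (Nat.lt_succ_of_le hR)))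
  simp [mul_comm]

/-- One term of the binomial expansion gives C(n,R) x^R ≤ (1+x)^n, and Kx ≤ 1 with R ≤ cn gives
(Kx)^R ≥ (Kx)^(cn). The choice x = c/(1-c) is the best one when it is allowed. -/
theorem isBaseBound_rpow {K c x : ℝ} (hK : 0 < K) (hx : 0 < x) (hKx : K * x ≤ 1) :
    IsBaseBound K c (2 * (K * x) ^ c / (1 + x)) := by
  intro n R hR hRc
  have h0 : 0 < K * x := mul_pos hK hx
  have h1 : ((K * x) ^ c) ^ n ≤ (K * x) ^ R := by
    rw [← Real.rpow_natCast, ← Real.rpow_mul h0.le, ← Real.rpow_natCast]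
    exact Real.rpow_le_rpow_of_exponent_ge h0 hKx hRc
  have h2 := choose_mul_pow_le hx.le hR
  rw [div_pow, mul_pow, div_mul_eq_mul_div, div_le_iff₀ (by positivity)]
  calc 2 ^ n * ((K * x) ^ c) ^ n * (n.choose R : ℝ)
      ≤ 2 ^ n * (K * x) ^ R * n.choose R := by gcongr
    _ = 2 ^ n * K ^ R * (n.choose R * x ^ R) := by rw [mul_pow]; ring
    _ ≤ 2 ^ n * K ^ R * (1 + x) ^ n := by gcongr

theorem IsBaseBound.mono {K c B B' : ℝ} (h : IsBaseBound K c B') (hB : 0 ≤ B) (hBB : B ≤ B') :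
    IsBaseBound K c B := by
  intro n R hR hRc
  refine le_trans ?_ (h n R hR hRc)
  gcongr

theorem isBaseBound_two_mul_div {K c : ℝ} (hK : 0 < K) : IsBaseBound K c (2 * K / (K + 1)) := by
  have h := isBaseBound_rpow (c := c) hK (x := 1 / K) (by positivity)
    (by rw [mul_one_div_cancel hK.ne'])
  rw [mul_one_div_cancel hK.ne', Real.one_rpow] at h
  convert h using 1
  field_simp

/-- Raising to the power `N` removes the real exponent; for rational K, x and B the remaining
condition is an inequality between rational numbers. -/
theorem isBaseBound_of_pow_le {K c x B : ℝ} {N : ℕ} (hN : N ≠ 0) (hK : 0 < K) (hx : 0 < x)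
    (hKx : K * x ≤ 1) (hc : c ≤ 1 / N) (hB : 0 ≤ B) (h : (B * (1 + x)) ^ N ≤ 2 ^ N * (K * x)) :
    IsBaseBound K c B := by
  refine (isBaseBound_rpow hK hx hKx).mono hB ?_
  have h0 : 0 < K * x := mul_pos hK hx
  rw [le_div_iff₀ (by positivity)]
  have h1 : (K * x) ^ (1 / (N : ℝ)) ≤ (K * x) ^ c := Real.rpow_le_rpow_of_exponent_ge h0 hKx hc
  refine le_trans ?_ (mul_le_mul_of_nonneg_left h1 zero_le_two)
  refine le_of_pow_le_pow_left₀ hN (by positivity) (h.trans (le_of_eq ?_))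
  rw [mul_pow, one_div, Real.rpow_inv_natCast_pow h0.le hN]

/-- The largest term of the binomial expansion of `(1 + x) ^ n`. -/
theorem exists_large_term {x : ℝ} (hx : 0 < x) (n : ℕ) : ∃ R ≤ n,
    (R : ℝ) ≤ (n + 1) * (x / (1 + x)) ∧ n * (x / (1 + x)) - 1 ≤ R ∧
    (1 + x) ^ n ≤ (n + 1) * (n.choose R * x ^ R) := by
  obtain ⟨R, hR, hmax⟩ := Finset.exists_max_image (Finset.range (n + 1))
    (fun i => (n.choose i : ℝ) * x ^ i) ⟨0, by simp⟩
  have hRn : R ≤ n := Nat.lt_succ_iff.1 (Finset.mem_range.1 hR)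
  have hRn' : (R : ℝ) ≤ n := by exact_mod_cast hRn
  have hx1 : 0 < 1 + x := by linarith
  have hR0 : (0 : ℝ) ≤ R := Nat.cast_nonneg R
  refine ⟨R, hRn, ?_, ?_, ?_⟩
  · rcases R with _ | R
    · simp only [Nat.cast_zero]; positivity
    · have h1 := hmax R (Finset.mem_range.2 (by omega))
      have h2 : ((n.choose (R + 1) : ℝ)) * (R + 1) = n.choose R * (n - R) := by
        have := Nat.choose_succ_right_eq n R
        rw [← Nat.cast_sub (by omega)]
        exact_mod_cast this
      have hc : (0 : ℝ) < n.choose R := by exact_mod_cast Nat.choose_pos (by omega)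
      simp only [pow_succ] at h1
      have h3 : (n.choose R : ℝ) ≤ n.choose (R + 1) * x := by
        refine le_of_mul_le_mul_right (a := x ^ R) ?_ (by positivity)
        linarith
      have h4 : (n.choose R : ℝ) * (R + 1) ≤ n.choose R * ((n - R) * x) := by
        have := mul_le_mul_of_nonneg_right h3 (by positivity : (0 : ℝ) ≤ R + 1)
        nlinarith
      have h5 := le_of_mul_le_mul_left h4 hc
      rw [mul_div_assoc', le_div_iff₀ hx1]
      push_cast
      nlinarith
  · rw [mul_div_assoc', sub_le_iff_le_add, div_le_iff₀ hx1]
    rcases hRn.eq_or_lt with rfl | hlt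
    · nlinarith
    · have h1 := hmax (R + 1) (Finset.mem_range.2 (by omega))
      have h2 : ((n.choose (R + 1) : ℝ)) * (R + 1) = n.choose R * (n - R) := by
        have := Nat.choose_succ_right_eq n R
        rw [← Nat.cast_sub (by omega)]
        exact_mod_cast this
      have hc : (0 : ℝ) < n.choose R := by exact_mod_cast Nat.choose_pos (by omega)
      simp only [pow_succ] at h1
      have h3 : (n.choose (R + 1) : ℝ) * x ≤ n.choose R := by
        refine le_of_mul_le_mul_right (a := x ^ R) ?_ (by positivity)
        linarith
      have h4 : (n.choose R : ℝ) * ((n - R) * x) ≤ n.choose R * (R + 1) := by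
        have := mul_le_mul_of_nonneg_right h3 (by positivity : (0 : ℝ) ≤ R + 1)
        nlinarith
      have h5 := le_of_mul_le_mul_left h4 hc
      nlinarith
  · rw [add_comm 1 x, add_pow]
    refine (Finset.sum_le_card_nsmul _ _ (n.choose R * x ^ R) fun i hi => ?_).trans (le_of_eq ?_)
    · rw [one_pow, mul_one, mul_comm]
      exact hmax i hi
    · rw [Finset.card_range, nsmul_eq_mul]
      push_cast
      rfl

/-- The number of attempts that suffices if an attempt succeeds with probability about
`2 ^ (-n) * n.choose R * K ^ (-R)` for every `R` near `n * x / (1 + x)`. -/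
theorem exists_radius {K x B θ : ℝ} (hK : 0 < K) (hx : 0 < x) (hKx : K * x ≤ 1) (hθ : 0 < θ)
    (hB : 2 * (K * x) ^ (x / (1 + x)) / (1 + x) ≤ B) : ∃ n₀ : ℕ, ∀ n, n₀ ≤ n → ∃ R ≤ n,
    (R : ℝ) ≤ (n + 1) * (x / (1 + x)) ∧
    1 / (B ^ n * ((n : ℝ) + 1) ^ 3) ≤ 1 / 2 * (1 / 2) ^ n *
      (θ * n.choose R * ((1 / K) ^ R * (1 / (4 * ((n : ℝ) + 1))))) := by
  -- Of the three factors n+1, one pays for the walk, one for the passage from (1+x)^n to its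
  -- largest term, and one absorbs the constant 8/(Kxθ) for large `n`.
  obtain ⟨n₀, hn₀⟩ := exists_nat_ge (8 / (K * x * θ))
  refine ⟨n₀, fun n hn => ?_⟩
  obtain ⟨R, hR, h1, h2, h3⟩ := exists_large_term hx n
  refine ⟨R, hR, h1, ?_⟩
  have h0 : 0 < K * x := mul_pos hK hx
  have hx1 : 0 < 1 + x := by linarith
  have hb : 0 < 2 * (K * x) ^ (x / (1 + x)) / (1 + x) := by positivity
  have hc : (0 : ℝ) < n.choose R := by exact_mod_cast Nat.choose_pos hR
  -- The radius may be smaller than nx/(1+x) by up to one, hence the extra factor Kx.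
  have h4 : (K * x) ^ R * (K * x) ≤ ((K * x) ^ (x / (1 + x))) ^ n := by
    rw [← pow_succ, ← Real.rpow_natCast _ n, ← Real.rpow_mul h0.le, ← Real.rpow_natCast]
    refine Real.rpow_le_rpow_of_exponent_ge h0 hKx ?_
    push_cast
    linarith
  have h5 : 2 ^ n * K ^ R * (K * x) ≤ B ^ n * ((n + 1) * n.choose R) := by
    have h6 : (2 * (K * x) ^ (x / (1 + x)) / (1 + x)) ^ n ≤ B ^ n := by gcongr
    refine le_trans ?_ (mul_le_mul_of_nonneg_right h6 (by positivity))
    rw [div_pow, mul_pow, div_mul_eq_mul_div, le_div_iff₀ (by positivity)]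
    calc 2 ^ n * K ^ R * (K * x) * (1 + x) ^ n
        ≤ 2 ^ n * K ^ R * (K * x) * ((n + 1) * (n.choose R * x ^ R)) := by gcongr
      _ = 2 ^ n * ((K * x) ^ R * (K * x)) * ((n + 1) * n.choose R) := by rw [mul_pow K x R]; ring
      _ ≤ _ := by gcongr
  have h6 : 8 ≤ K * x * θ * ((n : ℝ) + 1) := by
    have h7 : 8 / (K * x * θ) ≤ (n : ℝ) + 1 := by
      have : (n₀ : ℝ) ≤ n := by exact_mod_cast hn
      linarith
    rw [div_le_iff₀ (by positivity)] at h7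
    linarith
  have hBn : 0 < B ^ n := pow_pos (hb.trans_le hB) n
  rw [div_le_iff₀ (by positivity)]
  have h7 : 1 / 2 * (1 / 2) ^ n * (θ * n.choose R * ((1 / K) ^ R * (1 / (4 * ((n : ℝ) + 1))))) *
      (B ^ n * ((n : ℝ) + 1) ^ 3) =
      θ * ((n : ℝ) + 1) * (B ^ n * ((n + 1) * n.choose R)) / (8 * (2 ^ n * K ^ R)) := by
    rw [div_pow, div_pow, one_pow, one_pow]
    field_simp
    norm_num
  rw [h7, le_div_iff₀ (by positivity), one_mul]
  calc 8 * (2 ^ n * K ^ R) ≤ K * x * θ * ((n : ℝ) + 1) * (2 ^ n * K ^ R) := by gcongr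
    _ = θ * ((n : ℝ) + 1) * (2 ^ n * K ^ R * (K * x)) := by ring
    _ ≤ _ := by gcongr

theorem exists_natCast_div_between {r s : ℝ} (hr : 0 ≤ r) (hrs : r < s) :
    ∃ u v : ℕ, 1 ≤ v ∧ r < (u : ℝ) / v ∧ (u : ℝ) / v < s := by
  obtain ⟨t, ht1, ht2⟩ := exists_rat_btwn hrs
  have ht : 0 ≤ t := by
    have : (0 : ℝ) ≤ t := hr.trans ht1.le
    exact_mod_cast this
  have h : ((t.num.toNat : ℕ) : ℝ) / (t.den : ℝ) = t := by
    have h1 : ((t.num.toNat : ℕ) : ℤ) = t.num := Int.toNat_of_nonneg (Rat.num_nonneg.2 ht)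
    have h2 : ((t.num.toNat : ℕ) : ℝ) = ((t.num : ℤ) : ℝ) := by
      rw [← Int.cast_natCast (R := ℝ), h1]
    rw [h2, ← Rat.cast_def]
  exact ⟨t.num.toNat, t.den, t.den_pos, by rwa [h], by rwa [h]⟩

/-- A rational base strictly below `β` and above `B` and a given rational base. -/
theorem exists_base_of_lt {K c B β : ℝ} (hB : 0 ≤ B) (h : B < β) (hβ : IsBaseBound K c β)
    {u₀ v₀ : ℕ} (hv₀ : 1 ≤ v₀) (huv₀ : v₀ ≤ u₀) (h₀ : IsBaseBound K c ((u₀ : ℝ) / v₀)) :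
    ∃ u v : ℕ, 1 ≤ v ∧ v ≤ u ∧ (u₀ : ℝ) / v₀ ≤ (u : ℝ) / v ∧ B ≤ (u : ℝ) / v ∧
      IsBaseBound K c ((u : ℝ) / v) := by
  obtain ⟨u, v, hv, h1, h2⟩ := exists_natCast_div_between hB h
  rcases le_total ((u₀ : ℝ) / v₀) ((u : ℝ) / v) with hle | hle
  · refine ⟨u, v, hv, ?_, hle, h1.le, hβ.mono (by positivity) h2.le⟩
    have h3 : (1 : ℝ) ≤ (u₀ : ℝ) / v₀ := by
      rw [one_le_div (by exact_mod_cast hv₀)]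
      exact_mod_cast huv₀
    have h4 := h3.trans hle
    rw [one_le_div (by exact_mod_cast hv)] at h4
    exact_mod_cast h4
  · exact ⟨u₀, v₀, hv₀, huv₀, le_rfl, h1.le.trans hle, h₀⟩

theorem exists_base {K : ℕ} (hK : 1 ≤ K) {c c' : ℝ} (hc0 : 0 < c) (hcK : c ≤ 1 / ((K : ℝ) + 1))
    (hcc : c < c') {u₀ v₀ : ℕ} (hv₀ : 1 ≤ v₀) (huv₀ : v₀ ≤ u₀)
    (h₀ : IsBaseBound K c ((u₀ : ℝ) / v₀)) :
    ∃ (u v : ℕ) (x : ℝ), 1 ≤ v ∧ v ≤ u ∧ (u₀ : ℝ) / v₀ ≤ (u : ℝ) / v ∧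
      2 * (K * x) ^ (x / (1 + x)) / (1 + x) ≤ (u : ℝ) / v ∧ IsBaseBound K c ((u : ℝ) / v) ∧
      0 < x ∧ K * x ≤ 1 ∧ x / (1 + x) < c' := by
  have hK' : (1 : ℝ) ≤ K := by exact_mod_cast hK
  have hK0 : (0 : ℝ) < K := by linarith
  rcases hcK.eq_or_lt with rfl | hlt
  · have hKx : (K : ℝ) * (1 / K) = 1 := mul_one_div_cancel hK0.ne'
    have hy : (1 / (K : ℝ)) / (1 + 1 / K) = 1 / ((K : ℝ) + 1) := by field_simp
    have hb : 2 * ((K : ℝ) * (1 / K)) ^ ((1 / (K : ℝ)) / (1 + 1 / K)) / (1 + 1 / K) =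
        2 * K / (K + 1) := by
      rw [hKx, Real.one_rpow]; field_simp
    have hcast : (((2 * K : ℕ) : ℝ)) / ((K + 1 : ℕ) : ℝ) = 2 * K / (K + 1) := by push_cast; rfl
    rcases le_total ((u₀ : ℝ) / v₀) (2 * K / (K + 1)) with hle | hle
    · exact ⟨2 * K, K + 1, 1 / K, by omega, by omega, by rwa [hcast], by rw [hcast, hb],
        by rw [hcast]; exact isBaseBound_two_mul_div hK0, by positivity, hKx.le, by rwa [hy]⟩
    · exact ⟨u₀, v₀, 1 / K, hv₀, huv₀, le_rfl, by rwa [hb], h₀, by positivity, hKx.le, by rwa [hy]⟩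
  · obtain ⟨y, hy1, hy2⟩ := exists_between (lt_min hcc hlt)
    have hy3 := hy2.trans_le (min_le_left _ _)
    have hy4 := hy2.trans_le (min_le_right _ _)
    rw [lt_div_iff₀ (by positivity)] at hy4
    have hy0 : 0 < y := hc0.trans hy1
    have hy5 : 0 < 1 - y := by nlinarith
    have hxy : y / (1 - y) / (1 + y / (1 - y)) = y := by field_simp; ring
    have hx0 : 0 < y / (1 - y) := by positivity
    have hKx : K * (y / (1 - y)) < 1 := by
      rw [mul_div_assoc', div_lt_one hy5]; linarith
    have h0 : 0 < K * (y / (1 - y)) := by positivity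
    have hlt : 2 * (K * (y / (1 - y))) ^ y / (1 + y / (1 - y)) <
        2 * (K * (y / (1 - y))) ^ c / (1 + y / (1 - y)) := by
      have := Real.rpow_lt_rpow_of_exponent_gt h0 hKx hy1
      gcongr
    obtain ⟨u, v, h1, h2, h3, h4, h5⟩ := exists_base_of_lt (by positivity) hlt
      (isBaseBound_rpow hK0 hx0 hKx.le) hv₀ huv₀ h₀
    exact ⟨u, v, y / (1 - y), h1, h2, h3, by rwa [hxy], h5, hx0, hKx.le, by rwa [hxy]⟩

/-! ### Algorithms -/

theorem hasDiamAlgorithm_of_shortest {k : ℕ} {δ x : ℝ} (hk : 3 ≤ k) (hδ : 0 < δ) (hx : 0 < x)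
    (hkx : k * x ≤ 1) (hxδ : x / (1 + x) < δ / 2) {u v : ℕ} (hv : 1 ≤ v) (hu : v ≤ u)
    (hB : 2 * (k * x) ^ (x / (1 + x)) / (1 + x) ≤ (u : ℝ) / v) {T : ℕ → ℝ}
    (hT : ∀ n, ((u : ℝ) / v) ^ n ≤ T n) : HasDiamAlgorithm k (1 / 2 * (1 - δ)) T := by
  set y := x / (1 + x) with hy
  have hy0 : 0 < y := by positivity
  have hk0 : (0 : ℝ) < k := by exact_mod_cast (by omega : 0 < k)
  obtain ⟨n₁, hn₁⟩ := exists_nat_ge (2 * y / (δ / 2 - y))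
  have hθ1 : 1 / 2 + y / δ < 1 := by
    have : y / δ < 1 / 2 := by rw [div_lt_iff₀ hδ]; linarith
    linarith
  obtain ⟨n₂, hn₂⟩ := exists_radius hk0 hx hkx (sub_pos.2 hθ1) hB
  refine hasDiamAlgorithm_of_attemptBound (D := 2) (a := 1) (b := 0) hv hu (by norm_num)
    (by norm_num) 3 (n₁ + n₂ + 1) 1 0 (fun n => by simpa using hT n) fun n hn F _ => ?_
  obtain ⟨R, hR, h1, h2⟩ := hn₂ n (by omega)
  -- This makes θδ = δ/2 + y the midpoint of 2y and δ: θ stays below 1, and 2R ≤ θδn holds for large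
  -- `n` in spite of R being bounded only by (n+1)y.
  refine attemptBound_of_shortest hδ.le hR (by omega) (θ := 1 / 2 + y / δ) (by positivity) ?_
    (by norm_num) (by norm_num) (h2.trans ?_)
  · have h3 : 2 * y / (δ / 2 - y) ≤ n := hn₁.trans (by exact_mod_cast (by omega : n₁ ≤ n))
    rw [div_le_iff₀ (by linarith)] at h3
    have h4 : (1 / 2 + y / δ) * δ * n = (δ / 2 + y) * n := by field_simp
    rw [h4]
    linarith
  · have h3 : 1 / (4 * ((n : ℝ) + 1)) ≤ 1 := by
      rw [div_le_one (by positivity)]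
      linarith [Nat.cast_nonneg (α := ℝ) n]
    have h4 : (1 / (k : ℝ)) ^ R * (1 / (4 * ((n : ℝ) + 1))) ≤ (1 / (k : ℝ)) ^ R :=
      mul_le_of_le_one_right (by positivity) h3
    have := sub_pos.2 hθ1
    gcongr

/-- The success probability for close solutions. -/
theorem one_div_le_near {n r m : ℕ} {t s B : ℝ} (hn : 0 < n) (hr : m * r ≤ n) (hm : 1 ≤ m)
    (ht : 0 ≤ t) (hts : t ≤ s) (hB : 0 < B) (h : 1 ≤ B ^ m * (t * s ^ (m - 1))) :
    1 / (B ^ n * ((n : ℝ) + 1) ^ 3) ≤ 1 / 2 * (t ^ r * s ^ (n - r)) := by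
  have hs : 0 ≤ s := ht.trans hts
  have hrn : r ≤ n := le_trans (Nat.le_mul_of_pos_left r hm) hr
  -- Because t ≤ s, the worst case is r = n/m. Comparing m-th powers avoids the fraction.
  have h1 : 1 ≤ B ^ n * (t ^ r * s ^ (n - r)) := by
    refine (one_le_pow_iff_of_nonneg (by positivity) (by omega : m ≠ 0)).1 ?_
    calc (1 : ℝ) ≤ (B ^ m * (t * s ^ (m - 1))) ^ n := one_le_pow₀ h
      _ = B ^ (n * m) * (t ^ (m * r) * t ^ (n - m * r) * s ^ ((m - 1) * n)) := by
        rw [← pow_add, Nat.add_sub_cancel' hr, mul_pow, mul_pow, ← pow_mul, ← pow_mul, mul_comm m n]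
      _ ≤ B ^ (n * m) * (t ^ (m * r) * s ^ (n - m * r) * s ^ ((m - 1) * n)) := by gcongr
      _ = (B ^ n * (t ^ r * s ^ (n - r))) ^ m := by
        rw [mul_pow, mul_pow, ← pow_mul, ← pow_mul, ← pow_mul, mul_assoc, ← pow_add, mul_comm r m]
        congr 3
        obtain ⟨m, rfl⟩ : ∃ l, m = l + 1 := ⟨m - 1, by omega⟩
        rw [Nat.add_sub_cancel]
        zify [hr, hrn]
        ring
  have h2 : (2 : ℝ) ≤ ((n : ℝ) + 1) ^ 3 := by
    have hn' : (1 : ℝ) ≤ n := by exact_mod_cast hn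
    nlinarith [pow_le_pow_left₀ (by norm_num) (by linarith : (2 : ℝ) ≤ n + 1) 3]
  rw [div_le_iff₀ (by positivity)]
  calc (1 : ℝ) ≤ 1 / 2 * 2 * (B ^ n * (t ^ r * s ^ (n - r))) := by linarith
    _ ≤ 1 / 2 * ((n : ℝ) + 1) ^ 3 * (B ^ n * (t ^ r * s ^ (n - r))) := by gcongr
    _ = _ := by ring

/-- The threshold d(z,w) = n/m separates the two modes. Beyond it, n ≤ m·d(z,w) turns the excess
walk length 2R/(k-2), with R about yn, into a multiple of d(z,w), and Markov's inequality needs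
exactly y(2 + 2m/(k-2)) < δ. Below it, `hnear` says that the mode with flip probability a/D succeeds
often enough. -/
theorem hasDiamAlgorithm_of_far_near {k m a b D : ℕ} {δ x : ℝ} (hk : 3 ≤ k) (hδ : 0 < δ)
    (hx : 0 < x) (hkx : ((k : ℝ) - 1) * x ≤ 1) (hm : 1 ≤ m)
    (hxδ : x / (1 + x) * (2 + 2 / ((k : ℝ) - 2) * m) < δ) {u v : ℕ} (hv : 1 ≤ v) (hu : v ≤ u)
    (hB : 2 * (((k : ℝ) - 1) * x) ^ (x / (1 + x)) / (1 + x) ≤ (u : ℝ) / v)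
    (hD : 1 ≤ D) (hab : 2 * (a + b) = D)
    (hts : (a : ℝ) / D ≤ 1 - (a : ℝ) / D + (a : ℝ) / D * (1 / k))
    (hnear : 1 ≤ ((u : ℝ) / v) ^ m * ((a : ℝ) / D *
      (1 - (a : ℝ) / D + (a : ℝ) / D * (1 / k)) ^ (m - 1))) {T : ℕ → ℝ}
    (hT : ∀ n, ((u : ℝ) / v) ^ n ≤ T n) : HasDiamAlgorithm k (1 / 2 * (1 - δ)) T := by
  have hk' : (3 : ℝ) ≤ k := by exact_mod_cast hk
  have hm' : (1 : ℝ) ≤ m := by exact_mod_cast hm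
  have hm0 : (0 : ℝ) < m := by linarith
  set y := x / (1 + x) with hy
  set s := 2 / ((k : ℝ) - 2) with hs
  have hs0 : 0 < s := div_pos two_pos (by linarith)
  have hy0 : 0 < y := by positivity
  have hden : 0 < δ - s * m * y := by nlinarith
  obtain ⟨θ, hθ1, hθ2⟩ := exists_between (show 2 * y / (δ - s * m * y) < 1 by
    rw [div_lt_one hden]; linarith)
  have hθ0 : 0 < θ := lt_trans (by positivity) hθ1
  rw [div_lt_iff₀ hden] at hθ1
  -- The strict gap g, multiplied by n, absorbs the bounded errors from R ≤ (n+1)y and from rounding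
  -- the walk length.
  set g := θ * (δ - s * m * y) - 2 * y with hg
  have hg0 : 0 < g := by rw [hg]; linarith
  obtain ⟨n₁, hn₁⟩ := exists_nat_ge ((2 * y + θ * m * (s * y + 1)) / g)
  obtain ⟨n₂, hn₂⟩ := exists_radius (by linarith) hx hkx (sub_pos.2 hθ2) hB
  refine hasDiamAlgorithm_of_attemptBound (a := a) (b := b) hv hu hD (by omega) 3 (n₁ + n₂ + 1) 1 0
    (fun n => by simpa using hT n) fun n hn F _ z w hw => ?_
  have hn0 : 0 < n := by omega
  have hn0' : (0 : ℝ) < n := by exact_mod_cast hn0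
  have hB0 : (0 : ℝ) < (u : ℝ) / v := by
    have h1 : (0 : ℝ) < v := by exact_mod_cast hv
    have h2 : (0 : ℝ) < u := by exact_mod_cast (hv.trans hu)
    positivity
  rcases le_total (m * hammingDist z w) n with hr | hr
  · exact exists_walkBound_of_near hδ.le hw hD (by omega)
      (one_div_le_near hn0 hr hm (by positivity) hts hB0 hnear)
  · obtain ⟨R, hR, h1, h2⟩ := hn₂ n (by omega)
    have hr' : (n : ℝ) ≤ m * hammingDist z w := by exact_mod_cast hr
    set r : ℝ := (hammingDist z w : ℝ) with hrdef
    have hr0 : 0 < r := by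
      by_contra h
      nlinarith
    have hR0 : (0 : ℝ) ≤ R := Nat.cast_nonneg R
    have h3 : (2 * y + θ * m * (s * y + 1)) / g ≤ n :=
      hn₁.trans (by exact_mod_cast (by omega : n₁ ≤ n))
    rw [div_le_iff₀ hg0] at h3
    have h4 : θ * m * (s * R + 1) ≤ θ * δ * n - 2 * R := by
      have h5 : (2 + θ * m * s) * R ≤ (2 + θ * m * s) * ((n + 1) * y) :=
        mul_le_mul_of_nonneg_left h1 (by positivity)
      rw [hg] at h3
      linarith
    have h6 : 0 ≤ θ * δ * n - 2 * R := le_trans (by positivity) h4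
    have h7 : 2 * ((R : ℝ) * r) ≤ θ * (n * (δ * r - s * R - 1)) := by
      have h8 := mul_le_mul_of_nonneg_right h4 hr0.le
      have h9 := mul_le_mul_of_nonneg_left hr' (by positivity : 0 ≤ θ * (s * R + 1))
      linarith
    refine exists_walkBound_of_far hk hw hR hn0 hθ0.le ?_ h7 hD hab h2
    have h8 : 0 ≤ θ * n * (δ * r - s * R - 1) := by
      refine le_trans (by positivity : 0 ≤ 2 * ((R : ℝ) * r)) (h7.trans (le_of_eq (by ring)))
    exact nonneg_of_mul_nonneg_right h8 (by positivity)

theorem hasDiamAlgorithm_of_one_le {k : ℕ} {δ x : ℝ} (hk : 3 ≤ k) (hδ : 1 ≤ δ) (hx : 0 < x)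
    (hkx : ((k : ℝ) - 1) * x ≤ 1) {u v : ℕ} (hv : 1 ≤ v) (hu : v ≤ u)
    (hB : 2 * (((k : ℝ) - 1) * x) ^ (x / (1 + x)) / (1 + x) ≤ (u : ℝ) / v) {T : ℕ → ℝ}
    (hT : ∀ n, ((u : ℝ) / v) ^ n ≤ T n) : HasDiamAlgorithm k (1 / 2 * (1 - δ)) T := by
  have hk' : (3 : ℝ) ≤ k := by exact_mod_cast hk
  obtain ⟨n₀, hn₀⟩ := exists_radius (by linarith) hx hkx one_pos hB
  refine hasDiamAlgorithm_of_attemptBound (D := 2) (a := 1) (b := 0) hv hu (by norm_num)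
    (by norm_num) 3 n₀ 1 0 (fun n => by simpa using hT n) fun n hn F _ => ?_
  obtain ⟨R, hR, -, h2⟩ := hn₀ n hn
  exact attemptBound_of_one_le hk hδ hR (by norm_num) (by norm_num) (by rwa [one_mul] at h2)

/-! ### The two time bounds -/

theorem IsBaseBound.pow_le_τ₁ {k : ℕ} {δ B : ℝ} (hδ : 0 < δ)
    (h : IsBaseBound k (δ / (2 * (2 + δ))) B) (n : ℕ) : B ^ n ≤ τ₁ δ k n := by
  have h0 : δ * n / (2 * (2 + δ)) = δ / (2 * (2 + δ)) * n := by ring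
  have h1 : (R₁ δ n : ℝ) ≤ δ / (2 * (2 + δ)) * n := by
    rw [← h0]; exact Nat.floor_le (by positivity)
  have h2 : R₁ δ n ≤ n := by
    have h3 : δ / (2 * (2 + δ)) ≤ 1 := by rw [div_le_one (by positivity)]; linarith
    have : (R₁ δ n : ℝ) ≤ n := h1.trans (mul_le_of_le_one_left (Nat.cast_nonneg n) h3)
    exact_mod_cast this
  unfold τ₁
  rw [le_div_iff₀ (by exact_mod_cast Nat.choose_pos h2)]
  exact h n _ h2 h1

theorem IsBaseBound.pow_le_τ₂ {k : ℕ} {δ B : ℝ} (hk : 3 ≤ k) (hδ : 0 < δ)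
    (h : IsBaseBound ((k : ℝ) - 1) (δ / (2 * (2 + δ + 2 / ((k : ℝ) - 2)))) B) (n : ℕ) :
    B ^ n ≤ τ₂ δ k n := by
  have hs0 : 0 < 2 / ((k : ℝ) - 2) := by
    have hk' : (3 : ℝ) ≤ k := by exact_mod_cast hk
    exact div_pos two_pos (by linarith)
  set s := 2 / ((k : ℝ) - 2) with hs
  have h0 : δ * n / (2 * (2 + δ + s)) = δ / (2 * (2 + δ + s)) * n := by ring
  have h1 : (R₂ δ k n : ℝ) ≤ δ / (2 * (2 + δ + s)) * n := by
    rw [← h0]; exact Nat.floor_le (by positivity)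
  have h2 : R₂ δ k n ≤ n := by
    have h3 : δ / (2 * (2 + δ + s)) ≤ 1 := by rw [div_le_one (by positivity)]; linarith
    have : (R₂ δ k n : ℝ) ≤ n := h1.trans (mul_le_of_le_one_left (Nat.cast_nonneg n) h3)
    exact_mod_cast this
  unfold τ₂
  rw [le_div_iff₀ (by exact_mod_cast Nat.choose_pos h2)]
  exact h n _ h2 h1

/-- The condition δ ≤ 4/(k-1) is equivalent to δ/(2(2+δ)) ≤ 1/(k+1), the range in which enlarging
the radius improves the rate. Markov's inequality admits all relative radii below δ/2, which leaves
strict room. -/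
theorem hasDiamAlgorithm_τ₁ {k : ℕ} (hk : 3 ≤ k) {δ : ℝ} (hδ : 0 < δ) (hδk : δ ≤ δ₁ k) :
    HasDiamAlgorithm k (1 / 2 * (1 - δ)) (τ₁ δ k) := by
  have hk' : (3 : ℝ) ≤ k := by exact_mod_cast hk
  rw [δ₁, le_div_iff₀ (by linarith)] at hδk
  have hbase : IsBaseBound k (δ / (2 * (2 + δ))) (((2 * k : ℕ) : ℝ) / ((k + 1 : ℕ) : ℝ)) := by
    push_cast
    exact isBaseBound_two_mul_div (by linarith)
  obtain ⟨u, v, x, hv, hu, -, hB, hbb, hx, hkx, hxδ⟩ := exists_base (K := k) (by omega)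
    (c := δ / (2 * (2 + δ))) (c' := δ / 2) (by positivity)
    (by rw [div_le_div_iff₀ (by positivity) (by positivity)]; linarith)
    (by rw [div_lt_div_iff₀ (by positivity) (by positivity)]; nlinarith) (by omega) (by omega) hbase
  exact hasDiamAlgorithm_of_shortest hk hδ hx hkx hxδ hv hu hB (hbb.pow_le_τ₁ hδ)

theorem one_le_two_pow_mul {k : ℕ} (hk : 5 ≤ k) :
    1 ≤ (2 * ((k : ℝ) - 1) / k) ^ k * (1 / ((k : ℝ) - 1) * (1 - 1 / (k : ℝ)) ^ (k - 1)) := by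
  obtain ⟨q, rfl⟩ : ∃ q, k = q + 1 := ⟨k - 1, by omega⟩
  have hq : 4 ≤ q := by omega
  have hq0 : (0 : ℝ) < q := by exact_mod_cast (by omega : 0 < q)
  rw [Nat.add_sub_cancel]
  push_cast
  have h0 : 1 - 1 / ((q : ℝ) + 1) = q / (q + 1) := by field_simp; ring
  rw [h0, add_sub_cancel_right]
  have h1 : (2 * (q : ℝ) / (q + 1)) ^ (q + 1) * (1 / (q : ℝ) * (q / (q + 1)) ^ q) =
      2 ^ (q + 1) / ((((q : ℝ) + 1) / q) ^ q) ^ 2 / (q + 1) := by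
    rw [div_pow, div_pow, div_pow, pow_succ, pow_succ, mul_pow]
    field_simp
    ring
  rw [h1, div_div, one_le_div (by positivity)]
  -- The estimate by e² < 8 needs 8(q+1) ≤ 2^(q+1), which fails at q = 4; that case is computed
  -- directly.
  rcases hq.eq_or_lt with rfl | hq5
  · norm_num
  have h2 : (((q : ℝ) + 1) / q) ^ q ≤ Real.exp 1 := by
    have h3 : ((q : ℝ) + 1) / q ≤ Real.exp (1 / q) := by
      refine le_trans (le_of_eq ?_) (Real.add_one_le_exp (1 / (q : ℝ)))
      field_simp
      ring
    refine (pow_le_pow_left₀ (by positivity) h3 q).trans (le_of_eq ?_)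
    rw [← Real.exp_nat_mul, mul_one_div_cancel hq0.ne']
  have h4 : ((((q : ℝ) + 1) / q) ^ q) ^ 2 ≤ 8 := by
    have h5 : (((q : ℝ) + 1) / q) ^ q ≤ 2.8 := h2.trans (Real.exp_one_lt_d9.le.trans (by norm_num))
    refine (pow_le_pow_left₀ (by positivity) h5 2).trans (by norm_num)
  have h6 : 8 * (q + 1) ≤ 2 ^ (q + 1) := by
    clear * - hq5
    induction q, hq5 using Nat.le_induction with
    | base => norm_num
    | succ q _ ih => rw [pow_succ]; omega
  calc ((((q : ℝ) + 1) / q) ^ q) ^ 2 * (q + 1) ≤ 8 * (q + 1) := by gcongr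
    _ ≤ 2 ^ (q + 1) := by exact_mod_cast h6

/-- The parameters of the walks for close solutions. -/
theorem near_walk_parameters {k : ℕ} (hk : 5 ≤ k) :
    ((2 : ℕ) : ℝ) / ((2 * (k - 1) : ℕ) : ℝ) ≤ 1 - ((2 : ℕ) : ℝ) / ((2 * (k - 1) : ℕ) : ℝ) +
      ((2 : ℕ) : ℝ) / ((2 * (k - 1) : ℕ) : ℝ) * (1 / k) ∧
    1 ≤ (((2 * (k - 1) : ℕ) : ℝ) / k) ^ k * (((2 : ℕ) : ℝ) / ((2 * (k - 1) : ℕ) : ℝ) *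
      (1 - ((2 : ℕ) : ℝ) / ((2 * (k - 1) : ℕ) : ℝ) +
      ((2 : ℕ) : ℝ) / ((2 * (k - 1) : ℕ) : ℝ) * (1 / k)) ^ (k - 1)) := by
  have hk' : (5 : ℝ) ≤ k := by exact_mod_cast hk
  have hk1 : 0 < (k : ℝ) - 1 := by linarith
  have hcast : (((2 * (k - 1) : ℕ) : ℝ)) = 2 * ((k : ℝ) - 1) := by
    rw [Nat.cast_mul, Nat.cast_sub (by omega), Nat.cast_one, Nat.cast_ofNat]
  have h1 : ((2 : ℕ) : ℝ) / (2 * ((k : ℝ) - 1)) = 1 / ((k : ℝ) - 1) := by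
    rw [Nat.cast_ofNat]; field_simp
  have h2 : 1 - 1 / ((k : ℝ) - 1) + 1 / ((k : ℝ) - 1) * (1 / k) = 1 - 1 / (k : ℝ) := by
    field_simp; ring
  rw [hcast, h1, h2]
  refine ⟨?_, one_le_two_pow_mul hk⟩
  rw [one_sub_div (by positivity), div_le_div_iff₀ hk1 (by positivity)]
  nlinarith

/-- For `k = 3` shortest walks are sufficient. -/
theorem hasDiamAlgorithm_τ₂_three {δ : ℝ} (hδ : 0 < δ) (hδ1 : δ ≤ 1) :
    HasDiamAlgorithm 3 (1 / 2 * (1 - δ)) (τ₂ δ 3) := by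
  set c := δ / (8 + 2 * δ) with hc
  have hcc : δ / (2 * (2 + δ + 2 / (((3 : ℕ) : ℝ) - 2))) = c := by
    rw [hc]; norm_num; ring_nf
  have hc0 : 0 < c := by positivity
  have hK : (((3 : ℕ) : ℝ)) - 1 = 2 := by norm_num
  have hy : δ / 4 / (1 + δ / 4) = c * (2 : ℕ) := by rw [hc]; push_cast; field_simp; ring
  -- Shortest walks (K = 3) at the relative radius 2c, still below δ/2, are compared with the bound
  -- for K = 2 at c. The quotient of the powers is (9δ(8+δ)/32)^c, at most e^c because 81/32 < e,
  -- and e^c < (8+δ)/8 is just what the denominators allow.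
  have hlt : 2 * (((3 : ℕ) : ℝ) * (δ / 4)) ^ (δ / 4 / (1 + δ / 4)) / (1 + δ / 4) <
      2 * (2 * (δ / (8 + δ))) ^ c / (1 + δ / (8 + δ)) := by
    have h1 : (((3 : ℕ) : ℝ) * (δ / 4)) ^ (c * (2 : ℕ)) =
        (9 * δ * (8 + δ) / 32) ^ c * (2 * (δ / (8 + δ))) ^ c := by
      rw [mul_comm c, Real.rpow_mul (by positivity), Real.rpow_natCast,
        ← Real.mul_rpow (by positivity) (by positivity)]
      congr 1
      push_cast
      field_simp
      norm_num
    have h2 : (9 * δ * (8 + δ) / 32) ^ c ≤ Real.exp c := by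
      rw [← Real.exp_one_rpow]
      refine Real.rpow_le_rpow (by positivity) ?_ hc0.le
      have := Real.exp_one_gt_d9
      nlinarith
    have h3 : Real.exp c < (8 + δ) / 8 := by
      have h4 := Real.add_one_le_exp (-c)
      have h5 : Real.exp c * Real.exp (-c) = 1 := by rw [← Real.exp_add]; simp
      have h6 : 8 / (8 + δ) < 1 - c := by
        rw [hc, div_lt_iff₀ (by positivity), one_sub_div (by positivity), div_mul_eq_mul_div,
          lt_div_iff₀ (by positivity)]
        nlinarith
      have h7 : Real.exp c * (8 / (8 + δ)) < 1 := by
        rw [← h5]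
        have := Real.exp_pos c
        gcongr
        linarith
      rw [mul_div_assoc', div_lt_one (by positivity)] at h7
      linarith
    have h8 : 0 < (2 * (δ / (8 + δ))) ^ c := by positivity
    rw [hy, h1, div_lt_div_iff₀ (by positivity) (by positivity)]
    have h9 : (9 * δ * (8 + δ) / 32) ^ c * (1 + δ / (8 + δ)) < 1 + δ / 4 := by
      calc (9 * δ * (8 + δ) / 32) ^ c * (1 + δ / (8 + δ))
          < (8 + δ) / 8 * (1 + δ / (8 + δ)) := by
            gcongr
            exact h2.trans_lt h3
        _ = 1 + δ / 4 := by field_simp; ring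
    nlinarith
  have hbb := isBaseBound_rpow (c := c) (two_pos : (0 : ℝ) < 2) (x := δ / (8 + δ)) (by positivity)
    (by rw [mul_div_assoc', div_le_one (by positivity)]; linarith)
  have h0 : IsBaseBound 2 c (((4 : ℕ) : ℝ) / ((3 : ℕ) : ℝ)) := by
    have := isBaseBound_two_mul_div (c := c) (two_pos : (0 : ℝ) < 2)
    norm_num at this ⊢
    exact this
  obtain ⟨u, v, hv, hu, -, hB, hbb'⟩ := exists_base_of_lt (by positivity) hlt hbb (by norm_num)
    (by norm_num) h0
  refine hasDiamAlgorithm_of_shortest le_rfl hδ (x := δ / 4) (by positivity) (by push_cast; linarith)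
    ?_ hv hu hB (IsBaseBound.pow_le_τ₂ le_rfl hδ (by rwa [hcc, hK]))
  rw [div_lt_iff₀ (by positivity)]
  nlinarith

/-- The bound δ ≤ δ₂ is equivalent to the relative radius of R₂ being at most 1/k, as `exists_base`
requires for K = k-1, and `hmδ` says that this radius is strictly below the supremum δ/(2 +
2m/(k-2)) for the threshold n/m. The base finally chosen is at least u₀/v₀, so the condition for
close solutions carries over. -/
theorem hasDiamAlgorithm_τ₂_of_near {k m a b D u₀ v₀ : ℕ} (hk : 3 ≤ k) {δ : ℝ} (hδ : 0 < δ)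
    (hδk : δ ≤ δ₂ k) (hm : 1 ≤ m)
    (hmδ : 2 / ((k : ℝ) - 2) * m < 2 + 2 * δ + 2 * (2 / ((k : ℝ) - 2)))
    (hv₀ : 1 ≤ v₀) (hu₀ : v₀ ≤ u₀)
    (h₀ : IsBaseBound ((k : ℝ) - 1) (δ / (2 * (2 + δ + 2 / ((k : ℝ) - 2)))) ((u₀ : ℝ) / v₀))
    (hD : 1 ≤ D) (hab : 2 * (a + b) = D)
    (hts : (a : ℝ) / D ≤ 1 - (a : ℝ) / D + (a : ℝ) / D * (1 / k))
    (hnear : 1 ≤ ((u₀ : ℝ) / v₀) ^ m * ((a : ℝ) / D *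
      (1 - (a : ℝ) / D + (a : ℝ) / D * (1 / k)) ^ (m - 1))) :
    HasDiamAlgorithm k (1 / 2 * (1 - δ)) (τ₂ δ k) := by
  have hk' : (3 : ℝ) ≤ k := by exact_mod_cast hk
  have hk2 : 0 < (k : ℝ) - 2 := by linarith
  have hm' : (1 : ℝ) ≤ m := by exact_mod_cast hm
  have hKcast : (((k - 1 : ℕ) : ℝ)) = (k : ℝ) - 1 := by
    rw [Nat.cast_sub (by omega), Nat.cast_one]
  have hck : δ / (2 * (2 + δ + 2 / ((k : ℝ) - 2))) ≤ 1 / (((k - 1 : ℕ) : ℝ) + 1) := by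
    rw [hKcast, sub_add_cancel, div_le_div_iff₀ (by positivity) (by linarith)]
    have h1 : δ₂ k = 4 * ((k : ℝ) - 1) / ((k : ℝ) - 2) ^ 2 := by
      have : (k : ℝ) - 1 ≠ 0 := by linarith
      unfold δ₂
      field_simp
      ring
    rw [h1, le_div_iff₀ (by positivity)] at hδk
    have h2 : δ * ((k : ℝ) - 2) ≤ 4 * ((k : ℝ) - 1) / ((k : ℝ) - 2) := by
      rw [le_div_iff₀ hk2]
      linarith
    have h3 : 4 * ((k : ℝ) - 1) / ((k : ℝ) - 2) = 4 + 2 * (2 / ((k : ℝ) - 2)) := by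
      field_simp; ring
    linarith
  set s := 2 / ((k : ℝ) - 2) with hs
  have hs0 : 0 < s := by positivity
  obtain ⟨u, v, x, hv, hu, huv, hB, hbb, hx, hkx, hxδ⟩ := exists_base (K := k - 1) (by omega)
    (c := δ / (2 * (2 + δ + s))) (c' := δ / (2 + s * m)) (by positivity) hck
    (by
      rw [div_lt_div_iff₀ (by positivity) (by positivity)]
      exact mul_lt_mul_of_pos_left (by linarith) hδ)
    hv₀ hu₀ (by rwa [hKcast])
  rw [hKcast] at hB hbb hkx
  rw [lt_div_iff₀ (by positivity)] at hxδ
  refine hasDiamAlgorithm_of_far_near hk hδ hx hkx hm hxδ hv hu hB hD hab hts (hnear.trans ?_)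
    (hbb.pow_le_τ₂ hk hδ)
  have h1 : 0 ≤ (a : ℝ) / D := by positivity
  have h2 := h1.trans hts
  gcongr

/-- The flip probability is k/((k-1)m) throughout, the maximiser of t(1-t+t/k)^(m-1). For k ≥ 5 the
base 2(k-1)/k, valid for every radius, handles close solutions with m = k. For k = 4 that base is
3/2 and too small, so larger bases are used that are valid only for the restricted range of δ. -/
theorem hasDiamAlgorithm_τ₂ {k : ℕ} (hk : 3 ≤ k) {δ : ℝ} (hδ : 0 < δ) (hδ1 : δ ≤ 1)
    (hδk : δ ≤ δ₂ k) : HasDiamAlgorithm k (1 / 2 * (1 - δ)) (τ₂ δ k) := by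
  rcases hk.eq_or_lt with rfl | hk4
  · exact hasDiamAlgorithm_τ₂_three hδ hδ1
  rcases (Nat.succ_le_of_lt hk4).eq_or_lt with rfl | hk5
  · rcases le_or_gt δ (1 / 2) with h | h
    -- For δ ≤ 1/2 the relative radius is at most 1/14, whence N = 14 and x = (1/14)/(13/14).
    · refine hasDiamAlgorithm_τ₂_of_near (m := 4) (a := 2) (b := 1) (D := 6) (u₀ := 41) (v₀ := 25) hk hδ
        hδk (by norm_num) (by norm_num; linarith) (by norm_num) (by norm_num)
        (isBaseBound_of_pow_le (N := 14) (x := 1 / 13) (by norm_num) (by norm_num) (by norm_num)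
          (by norm_num) ?_ (by norm_num) (by norm_num)) (by norm_num) (by norm_num) (by norm_num)
        (by norm_num)
      norm_num
      rw [div_le_div_iff₀ (by positivity) (by norm_num)]
      linarith
    -- For δ ≤ 1 the relative radius is at most 1/8. The smaller base 39/25 needs m = 5, which is
    -- admissible exactly because δ > 1/2.
    · refine hasDiamAlgorithm_τ₂_of_near (m := 5) (a := 8) (b := 7) (D := 30) (u₀ := 39) (v₀ := 25) hk hδ
        hδk (by norm_num) ?_ (by norm_num) (by norm_num)
        (isBaseBound_of_pow_le (N := 8) (x := 1 / 7) (by norm_num) (by norm_num) (by norm_num)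
          (by norm_num) ?_ (by norm_num) (by norm_num)) (by norm_num) (by norm_num) (by norm_num)
        (by norm_num)
      · norm_num; linarith
      · norm_num
        rw [div_le_div_iff₀ (by positivity) (by norm_num)]
        linarith
  · have hk' : (5 : ℝ) ≤ k := by exact_mod_cast hk5
    have hcast : (((2 * (k - 1) : ℕ) : ℝ)) = 2 * ((k : ℝ) - 1) := by
      rw [Nat.cast_mul, Nat.cast_sub (by omega), Nat.cast_one, Nat.cast_ofNat]
    obtain ⟨h1, h2⟩ := near_walk_parameters hk5
    refine hasDiamAlgorithm_τ₂_of_near (m := k) (a := 2) (b := k - 3) (D := 2 * (k - 1))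
      (u₀ := 2 * (k - 1)) (v₀ := k) hk hδ hδk (by omega) ?_ (by omega) (by omega) ?_ (by omega)
      (by omega) h1 h2
    · have h3 : 2 / ((k : ℝ) - 2) * k = 2 + 2 * (2 / ((k : ℝ) - 2)) := by
        have : (k : ℝ) - 2 ≠ 0 := by linarith
        field_simp; ring
      linarith
    · rw [hcast]
      have := isBaseBound_two_mul_div (K := (k : ℝ) - 1)
        (c := δ / (2 * (2 + δ + 2 / ((k : ℝ) - 2)))) (by linarith)
      rwa [sub_add_cancel] at this

/-- With x = 1/(k-1) the relative radius is 1/k and the base is exactly 2(1-1/k). For k ≥ 5 the loss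
required is 4(k-1)/(k(k-2)), strictly below δ₂ = 4(k-1)/(k-2)². For k = 3 and 4 one has δ₂ ≥ 1, so
any two solutions will do. -/
theorem hasDiamAlgorithm_δ₂ {k : ℕ} (hk : 3 ≤ k) :
    HasDiamAlgorithm k (1 / 2 * (1 - δ₂ k)) fun n => (2 * (1 - 1 / (k : ℝ))) ^ n := by
  have hk' : (3 : ℝ) ≤ k := by exact_mod_cast hk
  have hk1 : 0 < (k : ℝ) - 1 := by linarith
  have hk2 : 0 < (k : ℝ) - 2 := by linarith
  have hcast : (((2 * (k - 1) : ℕ) : ℝ)) / k = 2 * (1 - 1 / (k : ℝ)) := by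
    rw [Nat.cast_mul, Nat.cast_sub (by omega), Nat.cast_one, Nat.cast_ofNat]
    field_simp
  have hkx : ((k : ℝ) - 1) * (1 / ((k : ℝ) - 1)) = 1 := mul_one_div_cancel hk1.ne'
  have hy : 1 / ((k : ℝ) - 1) / (1 + 1 / ((k : ℝ) - 1)) = 1 / k := by
    field_simp; ring
  have hB : 2 * (((k : ℝ) - 1) * (1 / ((k : ℝ) - 1))) ^
      (1 / ((k : ℝ) - 1) / (1 + 1 / ((k : ℝ) - 1))) / (1 + 1 / ((k : ℝ) - 1)) ≤
      (((2 * (k - 1) : ℕ) : ℝ)) / k := by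
    rw [hcast, hkx, Real.one_rpow]
    refine le_of_eq ?_
    field_simp
    ring
  have hT : ∀ n : ℕ, ((((2 * (k - 1) : ℕ) : ℝ)) / k) ^ n ≤ (2 * (1 - 1 / (k : ℝ))) ^ n :=
    fun n => by rw [hcast]
  rcases le_or_gt 5 k with hk5 | hk5
  · obtain ⟨h1, h2⟩ := near_walk_parameters hk5
    refine hasDiamAlgorithm_of_far_near (m := k) (a := 2) (b := k - 3) (D := 2 * (k - 1)) hk ?_
      (one_div_pos.2 hk1) hkx.le (by omega) ?_ (by omega) (by omega) hB (by omega) (by omega) h1 h2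
      hT
    · unfold δ₂; positivity
    · rw [hy, δ₂]
      have h3 : 1 / (k : ℝ) * (2 + 2 / ((k : ℝ) - 2) * k) =
          4 * ((k : ℝ) - 1) / (k * ((k : ℝ) - 2)) := by
        field_simp; ring
      have h4 : 4 / ((k : ℝ) - 1) * (1 + 1 / ((k : ℝ) - 2)) ^ 2 =
          4 * ((k : ℝ) - 1) / ((k : ℝ) - 2) ^ 2 := by
        field_simp; ring
      rw [h3, h4]
      refine div_lt_div_of_pos_left (by positivity) (by positivity) ?_
      nlinarith
  · refine hasDiamAlgorithm_of_one_le hk ?_ (one_div_pos.2 hk1) hkx.le (by omega) (by omega) hB hT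
    interval_cases k <;> norm_num [δ₂]

theorem δ₂_sub_isTheta :
    (fun k : ℕ => δ₂ k - 4 / (k : ℝ)) =Θ[atTop] (fun k : ℕ => 1 / (k : ℝ) ^ 2) := by
  have h : ∀ k : ℕ, 4 ≤ k →
      δ₂ k - 4 / (k : ℝ) = 4 * (3 * (k : ℝ) - 4) / (k * ((k : ℝ) - 2) ^ 2) := by
    intro k hk
    have hk' : (4 : ℝ) ≤ k := by exact_mod_cast hk
    have h1 : (k : ℝ) - 1 ≠ 0 := by linarith
    have h2 : (k : ℝ) - 2 ≠ 0 := by linarith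
    have h3 : (k : ℝ) ≠ 0 := by linarith
    unfold δ₂
    field_simp
    ring
  constructor
  -- For k ≥ 4 one has k ≤ 2(k-2), so the exact difference 4(3k-4)/(k(k-2)²) is at most 12·4/k².
  · refine IsBigO.of_bound 48 ?_
    filter_upwards [eventually_ge_atTop 4] with k hk
    have hk' : (4 : ℝ) ≤ k := by exact_mod_cast hk
    have h2 : 0 < (k : ℝ) - 2 := by linarith
    rw [h k hk, Real.norm_of_nonneg (div_nonneg (by linarith) (by positivity)),
      Real.norm_of_nonneg (by positivity), mul_one_div, div_le_div_iff₀ (by positivity)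
      (by positivity)]
    have h5 : (k : ℝ) ^ 2 ≤ 4 * ((k : ℝ) - 2) ^ 2 := by nlinarith
    calc 4 * (3 * (k : ℝ) - 4) * (k : ℝ) ^ 2 ≤ 4 * (3 * (k : ℝ)) * (4 * ((k : ℝ) - 2) ^ 2) := by
          gcongr
          linarith
      _ = 48 * (k * ((k : ℝ) - 2) ^ 2) := by ring
  · refine IsBigO.of_bound 1 ?_
    filter_upwards [eventually_ge_atTop 4] with k hk
    have hk' : (4 : ℝ) ≤ k := by exact_mod_cast hk
    have h2 : 0 < (k : ℝ) - 2 := by linarith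
    rw [h k hk, Real.norm_of_nonneg (by positivity),
      Real.norm_of_nonneg (div_nonneg (by linarith) (by positivity)), one_mul, div_le_div_iff₀ (by positivity)
      (by positivity), one_mul]
    have h3 : 0 ≤ 3 * (k : ℝ) - 4 := by linarith
    calc k * ((k : ℝ) - 2) ^ 2 ≤ k * (4 * (3 * (k : ℝ) - 4) * k) := by
          gcongr
          nlinarith
      _ = 4 * (3 * (k : ℝ) - 4) * (k : ℝ) ^ 2 := by ring

end KSat

theorem mainTheorem8 :
    (∀ k : ℕ, 3 ≤ k → ∀ δ : ℝ, 0 < δ → δ ≤ min 1 (KSat.δ₁ k) →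
      KSat.HasDiamAlgorithm k (1 / 2 * (1 - δ)) (KSat.τ₁ δ k)) ∧
    (∀ k : ℕ, 3 ≤ k → ∀ δ : ℝ, 0 < δ → δ ≤ min 1 (KSat.δ₂ k) →
      KSat.HasDiamAlgorithm k (1 / 2 * (1 - δ)) (KSat.τ₂ δ k)) ∧
    (∀ k : ℕ, 3 ≤ k →
      KSat.HasDiamAlgorithm k (1 / 2 * (1 - KSat.δ₂ k))
        (fun n => (2 * (1 - 1 / (k : ℝ))) ^ n)) ∧
    (fun k : ℕ => KSat.δ₂ k - 4 / (k : ℝ)) =Θ[atTop] (fun k : ℕ => 1 / (k : ℝ) ^ 2) := by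
  exact ⟨fun k hk δ hδ hδk => KSat.hasDiamAlgorithm_τ₁ hk hδ (hδk.trans (min_le_right _ _)),
    fun k hk δ hδ hδk => KSat.hasDiamAlgorithm_τ₂ hk hδ (hδk.trans (min_le_left _ _))
      (hδk.trans (min_le_right _ _)),
    fun k hk => KSat.hasDiamAlgorithm_δ₂ hk, KSat.δ₂_sub_isTheta⟩
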